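/- Let $\mathbb{K}$ be an algebraically closed field of characteristic zero, let $0 \le \ell < n$ be integers, and let $\mathrm{Gr}(\ell,\mathbb{P}^n)$ be the Grassmannian of $\ell$-dimensional projective subspaces $L = \mathbb{P}(\hat L)$ of $\mathbb{P}^n$, where $\hat L \subset \mathbb{K}^{n+1}$ is the corresponding $(\ell+1)$-dimensional linear subspace. It is regarded as a projective variety via the Plücker embedding, with tangent space $\mathrm{Hom}(\hat L, \mathbb{K}^{n+1}/\hat L)$ at $L$. Let $\mathrm{Reg}(\Sigma)$ denote the set of smooth points of a variety $\Sigma$. For an irreducible subvariety $\Sigma \subset \mathrm{Gr}(\ell,\mathbb{P}^n)$ and $L \in \mathrm{Reg}(\Sigma)$, the conormal space of $\Sigma$ at $L$ is $$N^*_{\Sigma,L} := \{\varphi \in \mathrm{Hom}(\mathbb{K}^{n+1}/\hat L, \hat L) \mid \mathrm{tr}(\varphi\circ\psi) = 0 \text{ for all } \psi \in T_{\Sigma,L}\}.$$ For vector spaces $U, W$ let $\mathrm{Seg}(U,W) \subset \mathbb{P}(\mathrm{Hom}(U,W))$ be the Segre variety of homomorphisms of rank one, and let $\mathrm{Sec}_k(\mathrm{Seg}(U,W))$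 be the Zariski closure in $\mathrm{Gr}(k,\mathbb{P}(\mathrm{Hom}(U,W)))$ of the set of all $k$-dimensional projective subspaces that are spanned by their intersection with $\mathrm{Seg}(U,W)$. An irreducible subvariety $\Sigma \subset \mathrm{Gr}(\ell,\mathbb{P}^n)$ of codimension $c \ge 1$ is called coisotropic if $\mathbb{P}(N^*_{\Sigma,L}) \in \mathrm{Sec}_{c-1}(\mathrm{Seg}(\mathbb{K}^{n+1}/\hat L, \hat L))$ for every $L \in \mathrm{Reg}(\Sigma)$. (1) Every irreducible subvariety of $\mathrm{Gr}(\ell,\mathbb{P}^n)$ of dimension at most $n-1$ is coisotropic. (2) Let $\Sigma_1, \Sigma_2 \subset \mathrm{Gr}(\ell,\mathbb{P}^n)$ be coisotropic subvarieties which intersect generically transversely, i.e. every irreducible component of $\Sigma_1 \cap \Sigma_2$ contains a point $L$ that is a smooth point of both $\Sigma_1$ and $\Sigma_2$ and satisfies $T_{\Sigma_1,L} + T_{\Sigma_2,L} = \mathrm{Hom}(\hat L, \mathbb{K}^{n+1}/\hat L)$. Then every irreducible component of $\Sigma_1 \cap \Sigma_2$ is coisotropic. -/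

import Mathlib

open MvPolynomial

noncomputable section

set_option linter.unusedSectionVars false

/-- The Grassmannian `Gr(d, W)` of `d`-dimensional linear subspaces of the vector space `W`.
The Grassmannian `Gr(ℓ, ℙⁿ)` of `ℓ`-dimensional projective subspaces of `ℙⁿ` is
`Gr(ℓ + 1, K^(n+1))`. -/
@[ext]
structure Grassmannian (K W : Type*) [Field K] [AddCommGroup W] [Module K W] (d : ℕ) where
  space : Submodule K W
  finrank_space : Module.finrank K space = d

namespace Grassmannian

section General

variable {K W : Type*} [Field K] [AddCommGroup W] [Module K W] [FiniteDimensional K W]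
  {d : ℕ}

/-- The (homogeneous) Plücker coordinates `⟨φ₁ ∧ ⋯ ∧ φ_d, A₁ ∧ ⋯ ∧ A_d⟩ = det (φᵢ(Aⱼ))` of a
`d`-tuple of vectors `A`, indexed by all `d`-tuples `φ` of linear forms. If `φ` runs through the
tuples of increasing coordinate forms only, these are the usual maximal minors; all others are
linear combinations of those, so that one gets the same zero loci of homogeneous polynomials. -/
def pluckerCoord (A : Fin d → W) (φ : Fin d → Module.Dual K W) : K :=
  Matrix.det (Matrix.of fun i j => φ i (A j))

/-- The differential at `A` in direction `M` of the Plücker coordinates: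
`∑ⱼ ⟨φ₁ ∧ ⋯ ∧ φ_d, A₁ ∧ ⋯ ∧ A_{j-1} ∧ Mⱼ ∧ A_{j+1} ∧ ⋯ ∧ A_d⟩`. -/
def pluckerDeriv (A M : Fin d → W) (φ : Fin d → Module.Dual K W) : K :=
  ∑ j, pluckerCoord (Function.update A j (M j)) φ

/-- The polynomial `f` in the Plücker coordinates vanishes at the point `L`. (If `f` is homogeneous,
it does not matter which basis of `L` is taken.) -/
def VanishesAt (f : MvPolynomial (Fin d → Module.Dual K W) K) (L : Grassmannian K W d) : Prop :=
  ∀ b : Module.Basis (Fin d) K L.space, eval (pluckerCoord fun j => (b j : W)) f = 0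

/-- The common zero locus in the Grassmannian of a set of polynomials in Plücker coordinates. -/
def zeroLocus (F : Set (MvPolynomial (Fin d → Module.Dual K W) K)) : Set (Grassmannian K W d) :=
  {L | ∀ f ∈ F, VanishesAt f L}

/-- Sets of homogeneous polynomials (of possibly different degrees). -/
def HomogeneousSet (F : Set (MvPolynomial (Fin d → Module.Dual K W) K)) : Prop :=
  ∀ f ∈ F, ∃ m : ℕ, f.IsHomogeneous m

lemma pluckerCoord_change (L : Grassmannian K W d) (b b' : Module.Basis (Fin d) K L.space) :
    ∃ t : K, (pluckerCoord fun j => (b' j : W)) =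
      fun φ : Fin d → Module.Dual K W => t * pluckerCoord (fun j => (b j : W)) φ := by
  refine ⟨(b.toMatrix b').det, ?_⟩
  funext φ
  unfold pluckerCoord
  rw [mul_comm, ← Matrix.det_mul]
  congr 1
  ext i j
  simp only [Matrix.of_apply, Matrix.mul_apply]
  rw [← b.sum_toMatrix_smul_self b' j]
  simp only [Submodule.coe_sum, Submodule.coe_smul, map_sum, map_smul, smul_eq_mul, mul_comm]

lemma eval_mul_of_isHomogeneous {σ : Type*} {f : MvPolynomial σ K} {m : ℕ}
    (hf : f.IsHomogeneous m) (t : K) (x : σ → K) :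
    eval (fun i => t * x i) f = t ^ m * eval x f := by
  rw [eval_eq, eval_eq, Finset.mul_sum]
  refine Finset.sum_congr rfl fun s hs => ?_
  have hm : s.degree = m := by
    by_contra hne
    exact mem_support_iff.1 hs (hf.coeff_eq_zero hne)
  have hm' : ∑ i ∈ s.support, s i = m := hm
  simp only [mul_pow, Finset.prod_mul_distrib, Finset.prod_pow_eq_pow_sum]
  rw [hm']
  ring

lemma exists_basis (L : Grassmannian K W d) : Nonempty (Module.Basis (Fin d) K L.space) :=
  ⟨Module.finBasisOfFinrankEq K L.space L.finrank_space⟩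

lemma vanishesAt_iff {f : MvPolynomial (Fin d → Module.Dual K W) K} {m : ℕ}
    (hf : f.IsHomogeneous m) (L : Grassmannian K W d) (b : Module.Basis (Fin d) K L.space) :
    VanishesAt f L ↔ eval (pluckerCoord fun j => (b j : W)) f = 0 := by
  refine ⟨fun h => h b, fun h b' => ?_⟩
  obtain ⟨t, ht⟩ := pluckerCoord_change L b b'
  rw [ht, eval_mul_of_isHomogeneous hf, h, mul_zero]

/-- The Zariski topology on the Grassmannian, induced by the Plücker embedding: the closed sets are
the common zero loci of homogeneous polynomials in the Plücker coordinates. -/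
instance zariskiTopology : TopologicalSpace (Grassmannian K W d) :=
  TopologicalSpace.ofClosed {S | ∃ F, HomogeneousSet F ∧ S = zeroLocus F}
    (by
      refine ⟨{1}, ?_, ?_⟩
      · rintro f rfl
        exact ⟨0, isHomogeneous_one _ _⟩
      · symm
        rw [Set.eq_empty_iff_forall_notMem]
        intro L hL
        obtain ⟨b⟩ := exists_basis L
        have := hL 1 rfl b
        simp at this)
    (by
      intro A hA
      refine ⟨{f | ∃ F, HomogeneousSet F ∧ zeroLocus F ∈ A ∧ f ∈ F}, ?_, ?_⟩
      · rintro f ⟨F, hF, -, hf⟩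
        exact hF f hf
      · ext L
        constructor
        · rintro h f ⟨F, -, hFA, hf⟩
          exact h _ hFA f hf
        · intro h S hS
          obtain ⟨F, hF, rfl⟩ := hA hS
          exact fun f hf => h f ⟨F, hF, hS, hf⟩)
    (by
      rintro _ ⟨F, hF, rfl⟩ _ ⟨G, hG, rfl⟩
      refine ⟨{p | ∃ f ∈ F, ∃ g ∈ G, p = f * g}, ?_, ?_⟩
      · rintro p ⟨f, hf, g, hg, rfl⟩
        obtain ⟨m, hm⟩ := hF f hf
        obtain ⟨k, hk⟩ := hG g hg
        exact ⟨m + k, hm.mul hk⟩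
      · ext L
        constructor
        · rintro (h | h) p ⟨f, hf, g, hg, rfl⟩ b
          · rw [map_mul, h f hf b, zero_mul]
          · rw [map_mul, h g hg b, mul_zero]
        · intro h
          by_contra hc
          simp only [Set.mem_union, not_or, zeroLocus, Set.mem_ofPred_eq, not_forall] at hc
          obtain ⟨⟨f, hf, hfL⟩, ⟨g, hg, hgL⟩⟩ := hc
          obtain ⟨b⟩ := exists_basis L
          obtain ⟨m, hm⟩ := hF f hf
          obtain ⟨k, hk⟩ := hG g hg
          rw [vanishesAt_iff hm L b] at hfL
          rw [vanishesAt_iff hk L b] at hgL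
          have := h (f * g) ⟨f, hf, g, hg, rfl⟩ b
          rw [map_mul] at this
          exact (mul_ne_zero hfL hgL) this)

lemma isClosed_iff {S : Set (Grassmannian K W d)} :
    IsClosed S ↔ ∃ F, HomogeneousSet F ∧ S = zeroLocus F := by
  rw [← isOpen_compl_iff]
  change Sᶜᶜ ∈ {S | ∃ F, HomogeneousSet F ∧ S = zeroLocus F} ↔ _
  rw [compl_compl]
  rfl

lemma pluckerCoord_update_add (A : Fin d → W) (j : Fin d) (x y : W)
    (φ : Fin d → Module.Dual K W) :
    pluckerCoord (Function.update A j (x + y)) φ =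
      pluckerCoord (Function.update A j x) φ + pluckerCoord (Function.update A j y) φ := by
  have key : ∀ z : W, pluckerCoord (Function.update A j z) φ =
      ((Matrix.of fun i k => φ i (A k)).updateCol j fun i => φ i z).det := by
    intro z
    unfold pluckerCoord
    congr 1
    ext i k
    by_cases hk : k = j
    · subst hk; simp
    · simp [hk]
  simp only [key, map_add]
  exact Matrix.det_updateCol_add _ _ _ _

lemma pluckerCoord_update_smul (A : Fin d → W) (j : Fin d) (t : K) (x : W)
    (φ : Fin d → Module.Dual K W) :
    pluckerCoord (Function.update A j (t • x)) φ = t * pluckerCoord (Function.update A j x) φ := by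
  have key : ∀ z : W, pluckerCoord (Function.update A j z) φ =
      ((Matrix.of fun i k => φ i (A k)).updateCol j fun i => φ i z).det := by
    intro z
    unfold pluckerCoord
    congr 1
    ext i k
    by_cases hk : k = j
    · subst hk; simp
    · simp [hk]
  simp only [key, map_smul]
  exact Matrix.det_updateCol_smul _ _ _ _

lemma pluckerDeriv_add (A M M' : Fin d → W) (φ : Fin d → Module.Dual K W) :
    pluckerDeriv A (M + M') φ = pluckerDeriv A M φ + pluckerDeriv A M' φ := by
  simp [pluckerDeriv, pluckerCoord_update_add, Finset.sum_add_distrib]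

lemma pluckerDeriv_smul (A M : Fin d → W) (t : K) (φ : Fin d → Module.Dual K W) :
    pluckerDeriv A (t • M) φ = t * pluckerDeriv A M φ := by
  simp [pluckerDeriv, pluckerCoord_update_smul, Finset.mul_sum]

/-- The differential `⟨df|_{p(A)}, dp|_A(M)⟩` at `A`, in direction `M`, of the polynomial `f` in the
Plücker coordinates `p`. -/
def differential (f : MvPolynomial (Fin d → Module.Dual K W) K) (A M : Fin d → W) : K :=
  ∑ φ ∈ f.vars, eval (pluckerCoord A) (pderiv φ f) * pluckerDeriv A M φ

/-- The Zariski tangent space of the reduced subvariety `S` at `L`, as a subspace of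
`T_L Gr(d, W) = Hom(L, W / L)`. The homomorphism `ψ` is the tangent vector at `L` in which, for a
basis `b` of `L`, each `bⱼ` moves in a direction `Mⱼ` with `ψ(bⱼ) = Mⱼ mod L`; it is tangent to `S`
iff the differentials of all homogeneous polynomials vanishing on `S` vanish in this direction. -/
def tangentSpace (S : Set (Grassmannian K W d)) (L : Grassmannian K W d) :
    Submodule K (L.space →ₗ[K] W ⧸ L.space) where
  carrier := {ψ | ∀ b : Module.Basis (Fin d) K L.space, ∃ M : Fin d → W,
    (∀ j, ψ (b j) = L.space.mkQ (M j)) ∧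
    ∀ (f : MvPolynomial (Fin d → Module.Dual K W) K) (m : ℕ), f.IsHomogeneous m →
      (∀ L' ∈ S, VanishesAt f L') → differential f (fun j => (b j : W)) M = 0}
  zero_mem' := by
    intro b
    refine ⟨0, by simp, fun f m _ _ => ?_⟩
    have h0 : ∀ φ : Fin d → Module.Dual K W, pluckerDeriv (fun j => (b j : W)) 0 φ = 0 := by
      intro φ
      simpa using pluckerDeriv_smul (fun j => (b j : W)) 0 (0 : K) φ
    simp [differential, h0]
  add_mem' := by
    intro ψ ψ' h h' b
    obtain ⟨M, hM, hf⟩ := h b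
    obtain ⟨M', hM', hf'⟩ := h' b
    refine ⟨M + M', fun j => by simp [hM, hM'], fun f m hm hv => ?_⟩
    have e := hf f m hm hv
    have e' := hf' f m hm hv
    unfold differential at e e' ⊢
    simp only [pluckerDeriv_add, mul_add, Finset.sum_add_distrib, e, e', add_zero]
  smul_mem' := by
    intro t ψ h b
    obtain ⟨M, hM, hf⟩ := h b
    refine ⟨t • M, fun j => by simp [hM], fun f m hm hv => ?_⟩
    have e := hf f m hm hv
    unfold differential at e ⊢
    simp only [pluckerDeriv_smul, mul_left_comm _ t, ← Finset.mul_sum, e, mul_zero]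

/-- The regular locus of an irreducible variety `S`: the points where the dimension of the Zariski
tangent space is the dimension of `S`. -/
def regularLocus (S : Set (Grassmannian K W d)) : Set (Grassmannian K W d) :=
  {L | L ∈ S ∧ ((Module.finrank K (tangentSpace S L) : ℕ) : WithBot ℕ∞) = topologicalKrullDim S}

/-- The conormal space of `S` at `L`: the annihilator of the tangent space, where `Hom(W / L, L)` is
identified with the dual of `Hom(L, W / L)` via `η ↦ tr(η ∘ ·)`. -/
def conormalSpace (S : Set (Grassmannian K W d)) (L : Grassmannian K W d) :
    Submodule K ((W ⧸ L.space) →ₗ[K] L.space) where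
  carrier := {η | ∀ ψ ∈ tangentSpace S L, LinearMap.trace K L.space (η ∘ₗ ψ) = 0}
  zero_mem' := by
    intro ψ _
    simp
  add_mem' := by
    intro η η' h h' ψ hψ
    rw [LinearMap.add_comp, map_add, h ψ hψ, h' ψ hψ, add_zero]
  smul_mem' := by
    intro t η h ψ hψ
    rw [LinearMap.smul_comp, map_smul, h ψ hψ, smul_zero]

/-- `S ⊆ Gr(d, W)` has codimension `c`, i.e. `dim S + c = d (dim W - d) = dim Gr(d, W)`. -/
def HasCodim (S : Set (Grassmannian K W d)) (c : ℕ) : Prop :=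
  topologicalKrullDim S + (c : WithBot ℕ∞) =
    ((d * (Module.finrank K W - d) : ℕ) : WithBot ℕ∞)

/-- The Grassmann secant variety of a projective variety with affine cone `X ⊆ W`: the Zariski
closure in `Gr(c, W)` of the set of all `c`-dimensional linear subspaces (projective subspaces of
dimension `c - 1`) which are spanned by their intersection with `X`. -/
def secantVariety (X : Set W) (c : ℕ) : Set (Grassmannian K W c) :=
  closure {N | Submodule.span K ((N.space : Set W) ∩ X) = N.space}

/-- `Z` is an irreducible component of the closed set `S`. -/
def IsIrreducibleComponent (Z S : Set (Grassmannian K W d)) : Prop :=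
  Maximal (fun T : Set (Grassmannian K W d) => IsIrreducible T ∧ T ⊆ S) Z

/-- The irreducible varieties `S₁` and `S₂` intersect transversely at the point `L`. (The
Grassmannian itself is smooth, with tangent space `Hom(L, W / L)` at `L`.) -/
def TransverseAt (S₁ S₂ : Set (Grassmannian K W d)) (L : Grassmannian K W d) : Prop :=
  L ∈ regularLocus S₁ ∧ L ∈ regularLocus S₂ ∧ tangentSpace S₁ L ⊔ tangentSpace S₂ L = ⊤

/-- Every irreducible component of the intersection contains a point of transversality. -/
def GenericallyTransverse (S₁ S₂ : Set (Grassmannian K W d)) : Prop :=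
  ∀ Z, IsIrreducibleComponent Z (S₁ ∩ S₂) → ∃ L ∈ Z, TransverseAt S₁ S₂ L

end General

/-- The affine cone over the Segre variety `Seg(U, W) ⊆ ℙ(Hom(U, W))`: the homomorphisms of rank at
most one. -/
def segreCone (K U W : Type*) [Field K] [AddCommGroup U] [Module K U] [AddCommGroup W]
    [Module K W] : Set (U →ₗ[K] W) :=
  {η | Module.finrank K (LinearMap.range η) ≤ 1}

/-- Coisotropic subvarieties of `Gr(d, V)`: irreducible closed subvarieties `S` of some codimension
`c ≥ 1` such that for every regular point `L` of `S` the conormal space at `L` is a point of the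
Grassmann secant variety `Sec_{c-1}(Seg(V / L, L)) ⊆ Gr(c, Hom(V / L, L))`. -/
def IsCoisotropic {K V : Type*} [Field K] [AddCommGroup V] [Module K V] [FiniteDimensional K V]
    {d : ℕ} (S : Set (Grassmannian K V d)) : Prop :=
  IsClosed S ∧ IsIrreducible S ∧ ∃ c : ℕ, 1 ≤ c ∧ HasCodim S c ∧
    ∀ L ∈ regularLocus S,
      ∃ N ∈ secantVariety (K := K) (segreCone K (V ⧸ L.space) L.space) c,
        N.space = conormalSpace S L

end Grassmannian

end

/-! Let W have dimension d + m, with d = ℓ + 1. In a chart of d × m matrices the conormal space of S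
at x becomes the space of gradients at x of the functions vanishing on S
(`mem_conormalSpace_chart`), and x is regular exactly when that space has dimension codim S
(`mem_regularLocus_chart`). Membership in the secant variety is expressed by polynomial equations on
c-tuples of matrices, namely those vanishing on all tuples of linear combinations of c matrices of
rank at most one (`mem_secantVariety_iff`). Coisotropy at a regular point x then says that the
gradients of any c functions in the ideal satisfy these equations (`exists_mem_secantVariety_iff`).
This condition is polynomial in x.

Small dimension: the Segre variety has codimension (d - 1)(m - 1), and dim S ≤ n - 1 = d + m - 2
means c ≥ (d - 1)(m - 1) + 1. In that range tuples of combinations of c rank-one matrices are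
Zariski dense, so there is no nonzero equation to satisfy
(`eq_zero_of_vanishing_on_rankOne_tuples`). Density follows from the Jacobian criterion in
characteristic zero (`eq_zero_of_aeval_eq_zero`), the tangent space being computed at explicit
points of the Segre variety lying on a monomial curve.

Intersections: at a transversal point, c₁ functions from the first ideal and c₂ from the second have
jointly independent gradients. They form part of a regular system of parameters of the local ring,
so the codimensions add (`height_eq_add_of_mem_minimalPrimes_sup`), and on a dense open part of the
component Z their gradients span its conormal space. There the conormal space is the direct sum of
the two given ones, and a concatenation of limits of rank-one spans is again such a limit
(`eval_sum_eq_zero_of_vanishesOnSpans`). As the equations are polynomial and the ideal of Z is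
prime, they extend from the open part to every point of Z. -/

noncomputable section

set_option linter.unusedSectionVars false

/-! ### Regular local rings and partial systems of parameters. -/

section RegularLocal

open IsLocalRing

/-- The classical argument for regular local rings: choose x in the maximal ideal, outside its
square and outside all minimal primes. Then A/(x) is regular of smaller dimension, so (x) is prime
by induction; a minimal prime q inside (x) satisfies q = xq and vanishes by Nakayama. -/
theorem IsLocalRing.isDomain_of_span_maximalIdeal (n : ℕ) :
    ∀ (A : Type*) [CommRing A] [IsLocalRing A] [IsNoetherianRing A] (s : Finset A),
      Ideal.span (s : Set A) = maximalIdeal A → s.card ≤ n → (n : WithBot ℕ∞) ≤ ringKrullDim A →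
      IsDomain A := by
  classical
  induction n with
  | zero =>
    intro A _ _ _ s hs hc _
    obtain rfl : s = ∅ := by simpa using hc
    have : IsField A := by
      rw [IsLocalRing.isField_iff_maximalIdeal_eq, ← hs]; simp
    exact this.isDomain
  | succ n ih =>
    intro A _ _ _ s hs hc hd
    have hpos : (1 : WithBot ℕ∞) ≤ ringKrullDim A := le_trans (by push_cast; exact_mod_cast Nat.le_add_left 1 n) hd
    have hbot : maximalIdeal A ≠ ⊥ := by
      intro h
      rw [← IsLocalRing.isField_iff_maximalIdeal_eq] at h
      rw [ringKrullDim_eq_zero_of_isField h] at hpos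
      exact absurd hpos (by decide)
    have hsq : ¬ maximalIdeal A ≤ maximalIdeal A ^ 2 := by
      intro h
      refine hbot (Submodule.eq_bot_of_le_smul_of_le_jacobson_bot (maximalIdeal A) (maximalIdeal A)
        (IsNoetherian.noetherian _) ?_ (IsLocalRing.maximalIdeal_le_jacobson _))
      rwa [smul_eq_mul, ← sq]
    have hfin := minimalPrimes.finite_of_isNoetherianRing A
    -- Prime avoidance tolerates a non-prime ideal in the family, here the square of the maximal
    -- ideal.
    obtain ⟨x, hxm, hx⟩ : ∃ x ∈ maximalIdeal A, x ∉ ⋃ i ∈ (↑(insert (maximalIdeal A ^ 2)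
        hfin.toFinset) : Set (Ideal A)), ((i : Ideal A) : Set A) := by
      by_contra! hcon
      have := (Ideal.subset_union_prime (f := fun I : Ideal A => I)
        (maximalIdeal A ^ 2) (maximalIdeal A ^ 2) (by
          intro i hi h1 _
          rw [Finset.mem_insert] at hi
          have := hi.resolve_left h1
          rw [Set.Finite.mem_toFinset] at this
          exact this.1.1)).1 (show (maximalIdeal A : Set A) ⊆ _ from hcon)
      obtain ⟨q, hq, hle⟩ := this
      rw [Finset.mem_insert] at hq
      rcases hq with rfl | hq
      · exact hsq hle
      · rw [Set.Finite.mem_toFinset] at hq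
        have hqp : q.IsPrime := hq.1.1
        have h0 : q.height = 0 := Ideal.height_eq_zero_iff.2 hq
        have : maximalIdeal A = q := le_antisymm hle (le_maximalIdeal hqp.ne_top)
        rw [← maximalIdeal_height_eq_ringKrullDim, this, h0] at hpos
        exact absurd hpos (by decide)
    simp only [Finset.coe_insert, Set.mem_insert_iff, Set.iUnion_iUnion_eq_or_left, Set.mem_union,
      not_or, SetLike.mem_coe, Set.mem_iUnion, not_exists, Set.Finite.coe_toFinset] at hx
    obtain ⟨hx2, hxq⟩ := hx
    obtain ⟨a, -, ha⟩ := Submodule.mem_span_finset.1 (show x ∈ Submodule.span A (s : Set A) by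
      rw [← hs] at hxm; exact hxm)
    -- Since x is not in the square, some coefficient is a unit, and x can replace the corresponding
    -- generator.
    obtain ⟨i, his, hai⟩ : ∃ i ∈ s, a i ∉ maximalIdeal A := by
      by_contra! hcon
      refine hx2 ?_
      rw [← ha, sq]
      refine Submodule.sum_mem _ fun i hi => ?_
      exact Ideal.mul_mem_mul (hcon i hi) (hs ▸ Ideal.subset_span hi)
    have hau : IsUnit (a i) := by simpa using hai
    have hspan : Ideal.span (insert x (s.erase i : Set A)) = maximalIdeal A := by
      apply le_antisymm
      · rw [Ideal.span_le]
        rintro y (rfl | hy)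
        · exact hxm
        · rw [SetLike.mem_coe, ← hs]
          exact Ideal.subset_span (Finset.mem_of_mem_erase hy)
      · rw [← hs, Ideal.span_le]
        intro y hy
        by_cases hyi : y = i
        · subst hyi
          have h2 : a y * y ∈ Ideal.span (insert x (s.erase y : Set A)) := by
            have : a y * y = x - ∑ j ∈ s.erase y, a j * j := by
              rw [← ha, ← Finset.add_sum_erase _ _ his]
              simp
            rw [this]
            refine sub_mem (Ideal.subset_span (by simp)) (Submodule.sum_mem _ fun j hj => ?_)
            exact Ideal.mul_mem_left _ _ (Ideal.subset_span (Set.mem_insert_of_mem _ hj))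
          exact (Ideal.unit_mul_mem_iff_mem _ hau).1 h2
        · exact Ideal.subset_span (Set.mem_insert_of_mem _ (by
            rw [Finset.mem_coe, Finset.mem_erase]; exact ⟨hyi, hy⟩))
    have hxtop : Ideal.span {x} ≠ ⊤ := by
      intro h
      have : Ideal.span {x} ≤ maximalIdeal A := by
        rw [Ideal.span_le]; simpa using hxm
      rw [h, top_le_iff] at this
      exact (maximalIdeal.isMaximal A).ne_top this
    have : Nontrivial (A ⧸ Ideal.span {x}) := Ideal.Quotient.nontrivial_iff.2 hxtop
    have hloc : IsLocalRing (A ⧸ Ideal.span {x}) :=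
      IsLocalRing.of_surjective' (Ideal.Quotient.mk _) Ideal.Quotient.mk_surjective
    have hmap : (maximalIdeal A).map (Ideal.Quotient.mk (Ideal.span {x})) = maximalIdeal _ := by
      refine IsLocalRing.eq_maximalIdeal ?_
      have := Ideal.map_eq_top_or_isMaximal_of_surjective (Ideal.Quotient.mk (Ideal.span {x}))
        Ideal.Quotient.mk_surjective (maximalIdeal.isMaximal A)
      refine this.resolve_left fun h => ?_
      have h1 : (1 : A ⧸ Ideal.span {x}) ∈ (maximalIdeal A).map (Ideal.Quotient.mk (Ideal.span {x})) :=
        h ▸ Submodule.mem_top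
      rw [Ideal.mem_map_iff_of_surjective _ Ideal.Quotient.mk_surjective] at h1
      obtain ⟨y, hy, hy1⟩ := h1
      rw [← map_one (Ideal.Quotient.mk (Ideal.span {x})), Ideal.Quotient.eq] at hy1
      have h2 : y - 1 ∈ maximalIdeal A := by
        refine (Ideal.span_le.2 ?_ : Ideal.span {x} ≤ maximalIdeal A) hy1
        simpa using hxm
      have h3 := sub_mem hy h2
      simp at h3
    have hdom : IsDomain (A ⧸ Ideal.span {x}) := by
      refine ih _ ((s.erase i).image (Ideal.Quotient.mk (Ideal.span {x}))) ?_ ?_ ?_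
      · rw [← hmap, ← hspan, Ideal.map_span, Set.image_insert_eq, Finset.coe_image,
          Ideal.span_insert]
        have : Ideal.Quotient.mk (Ideal.span {x}) x = 0 := by
          rw [Ideal.Quotient.eq_zero_iff_mem]; exact Ideal.subset_span rfl
        rw [this]
        simp
      · refine Finset.card_image_le.trans ?_
        rw [Finset.card_erase_of_mem his]; omega
      · have h := ringKrullDim_le_ringKrullDim_quotient_add_card ({x} : Finset A)
          (by rw [IsLocalRing.ringJacobson_eq_maximalIdeal]; simpa using hxm)
        rw [Finset.coe_singleton, Finset.card_singleton, Nat.cast_one] at h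
        have h2 := hd.trans h
        rw [Nat.cast_add, Nat.cast_one] at h2
        exact ENat.WithBot.add_le_add_one_right_iff.1 h2
    have hprime : (Ideal.span {x}).IsPrime := (Ideal.Quotient.isDomain_iff_prime _).1 hdom
    obtain ⟨q, hq, hqx⟩ := Ideal.exists_minimalPrimes_le (bot_le : ⊥ ≤ Ideal.span {x})
    have hqp : q.IsPrime := hq.1.1
    have hxnq : x ∉ q := fun h => hxq q hq h
    have hq0 : q = ⊥ := by
      refine Submodule.eq_bot_of_le_smul_of_le_jacobson_bot (maximalIdeal A) q
        (IsNoetherian.noetherian _) ?_ (IsLocalRing.maximalIdeal_le_jacobson _)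
      intro y hy
      obtain ⟨z, rfl⟩ := Ideal.mem_span_singleton.1 (hqx hy)
      exact Submodule.smul_mem_smul hxm ((hqp.mem_or_mem hy).resolve_left hxnq)
    rw [hq0] at hqp
    exact (IsDomain.of_bot_isPrime A)

/-- The quotient by `s` is again regular: `t` generates its maximal ideal, and its dimension drops
by at most `s.card`. -/
theorem IsLocalRing.isPrime_span_of_span_union {A : Type*} [CommRing A] [IsLocalRing A]
    [IsNoetherianRing A] [DecidableEq A] (s t : Finset A)
    (h : Ideal.span ((s : Set A) ∪ t) = maximalIdeal A)
    (hd : ((s.card + t.card : ℕ) : WithBot ℕ∞) ≤ ringKrullDim A) :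
    (Ideal.span (s : Set A)).IsPrime := by
  classical
  set I := Ideal.span (s : Set A) with hI
  have hIm : I ≤ maximalIdeal A := by
    rw [← h]; exact Ideal.span_mono Set.subset_union_left
  have hItop : I ≠ ⊤ := fun hh => (maximalIdeal.isMaximal A).ne_top (top_le_iff.1 (hh ▸ hIm))
  have : Nontrivial (A ⧸ I) := Ideal.Quotient.nontrivial_iff.2 hItop
  have hloc : IsLocalRing (A ⧸ I) :=
    IsLocalRing.of_surjective' (Ideal.Quotient.mk _) Ideal.Quotient.mk_surjective
  have hmap : (maximalIdeal A).map (Ideal.Quotient.mk I) = maximalIdeal _ := by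
    refine IsLocalRing.eq_maximalIdeal ?_
    refine Ideal.IsMaximal.map_of_surjective_of_ker_le Ideal.Quotient.mk_surjective ?_
    rwa [Ideal.mk_ker]
  have hdom : IsDomain (A ⧸ I) := by
    refine IsLocalRing.isDomain_of_span_maximalIdeal t.card _ (t.image (Ideal.Quotient.mk I)) ?_
      Finset.card_image_le ?_
    · rw [← hmap, ← h, Ideal.span_union, Ideal.map_sup, ← hI, Ideal.map_quotient_self, bot_sup_eq,
        Ideal.map_span, Finset.coe_image]
    · have h1 := ringKrullDim_le_ringKrullDim_quotient_add_card s
        (by rw [IsLocalRing.ringJacobson_eq_maximalIdeal]; exact (Ideal.subset_span (s := (s : Set A))).trans hIm)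
      have h2 := hd.trans h1
      rw [Nat.cast_add, add_comm] at h2
      exact ENat.WithBot.add_le_add_natCast_right_iff.1 h2
  exact (Ideal.Quotient.isDomain_iff_prime _).1 hdom

/-- Adding the elements one at a time gives a chain of primes. Each inclusion is strict, since
otherwise the maximal ideal would have fewer generators than its height, against Krull's height
theorem. -/
theorem IsLocalRing.card_le_height_span {A : Type*} [CommRing A] [IsLocalRing A]
    [IsNoetherianRing A] [DecidableEq A] (s : Finset A) : ∀ (t : Finset A),
    Ideal.span ((s : Set A) ∪ t) = maximalIdeal A →
    ((s.card + t.card : ℕ) : WithBot ℕ∞) ≤ ringKrullDim A →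
    (s.card : ℕ∞) ≤ (Ideal.span (s : Set A)).height := by
  induction s using Finset.induction_on with
  | empty => simp
  | insert x s hx ih =>
    intro t h hd
    rw [Finset.card_insert_of_notMem hx] at hd ⊢
    have hu : ((s : Set A) ∪ (insert x t : Finset A)) = ((insert x s : Finset A) : Set A) ∪ t := by
      ext; simp [or_assoc]
    have hd' : ((s.card + (insert x t).card : ℕ) : WithBot ℕ∞) ≤ ringKrullDim A := by
      refine le_trans ?_ hd
      have := Finset.card_insert_le x t
      exact_mod_cast (by omega : s.card + (insert x t).card ≤ s.card + 1 + t.card)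
    have h1 := ih (insert x t) (by rw [hu, h]) hd'
    have p1 := isPrime_span_of_span_union s (insert x t) (by rw [hu, h]) hd'
    have p2 := isPrime_span_of_span_union (insert x s) t h
      (by rwa [Finset.card_insert_of_notMem hx])
    have hlt : Ideal.span (s : Set A) < Ideal.span ((insert x s : Finset A) : Set A) := by
      refine lt_of_le_of_ne (Ideal.span_mono (by simp)) fun heq => ?_
      have h3 : maximalIdeal A = Ideal.span ((s ∪ t : Finset A) : Set A) := by
        rw [← h, Ideal.span_union, ← heq, ← Ideal.span_union]; simp
      have h4 : ringKrullDim A ≤ ((s ∪ t).card : ℕ) := by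
        rw [← maximalIdeal_height_eq_ringKrullDim]
        have : (maximalIdeal A).height ≤ ((s ∪ t).card : ℕ∞) := by
          refine Ideal.height_le_card_of_mem_minimalPrimes_span_finset (s := s ∪ t) ?_
          rw [← h3]
          simp [Ideal.minimalPrimes_eq_subsingleton_self]
        exact_mod_cast this
      have h5 := hd.trans h4
      have h6 : s.card + 1 + t.card ≤ (s ∪ t).card := by exact_mod_cast h5
      have := Finset.card_union_le s t
      omega
    have := Ideal.height_add_one_le_of_lt_of_isPrime hlt
    rw [Nat.cast_add, Nat.cast_one]
    exact (add_le_add_left h1 1).trans this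

end RegularLocal

/-! ### First-order Taylor expansion of polynomials. -/

namespace MvPolynomial

section Taylor

variable {K ι : Type*} [Field K] [Fintype ι]

/-- The gradient of a polynomial at a point. -/
def gradient (x : ι → K) (p : MvPolynomial ι K) : ι → K := fun k => eval x (pderiv k p)

@[simp] lemma gradient_apply (x : ι → K) (p : MvPolynomial ι K) (k : ι) :
    gradient x p k = eval x (pderiv k p) := rfl

lemma gradient_add (x : ι → K) (p q : MvPolynomial ι K) :
    gradient x (p + q) = gradient x p + gradient x q := by ext; simp

lemma gradient_C_mul (x : ι → K) (a : K) (p : MvPolynomial ι K) :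
    gradient x (C a * p) = a • gradient x p := by ext; simp

lemma gradient_sub (x : ι → K) (p q : MvPolynomial ι K) :
    gradient x (p - q) = gradient x p - gradient x q := by ext; simp

lemma gradient_sum {κ : Type*} (s : Finset κ) (x : ι → K) (p : κ → MvPolynomial ι K) :
    gradient x (∑ i ∈ s, p i) = ∑ i ∈ s, gradient x (p i) := by ext; simp

lemma gradient_C (x : ι → K) (a : K) : gradient x (C a) = 0 := by ext; simp

lemma gradient_X [DecidableEq ι] (x : ι → K) (k : ι) : gradient x (X k) = Pi.single k 1 := by
  ext j; simp [pderiv_X, Pi.single_apply, apply_ite, eq_comm]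

/-- For p X_n the remainder is (p - p(x))(X_n - x_n) plus x_n times the remainder of p, and the
first product has both factors in the maximal ideal. -/
lemma sub_linear_mem_sq (x : ι → K) (p : MvPolynomial ι K) :
    p - C (eval x p) - ∑ k, C (gradient x p k) * (X k - C (x k)) ∈
      (Ideal.span (Set.range fun k => X k - C (x k)) : Ideal (MvPolynomial ι K)) ^ 2 := by
  classical
  set M : Ideal (MvPolynomial ι K) := Ideal.span (Set.range fun k => X k - C (x k))
  have hX : ∀ k, (X k - C (x k) : MvPolynomial ι K) ∈ M := fun k => Ideal.subset_span ⟨k, rfl⟩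
  have hlin : ∀ a : ι → K, ∑ k, C (a k) * (X k - C (x k) : MvPolynomial ι K) ∈ M := fun a =>
    Submodule.sum_mem _ fun k _ => Ideal.mul_mem_left _ _ (hX k)
  induction p using MvPolynomial.induction_on with
  | C a => simp
  | add p q hp hq =>
    convert add_mem hp hq using 1
    simp only [gradient_add, Pi.add_apply, map_add, add_mul, Finset.sum_add_distrib]
    ring
  | mul_X p n hp =>
    have h1 : p - C (eval x p) ∈ M := by
      have := add_mem (Ideal.pow_le_self two_ne_zero hp) (hlin (gradient x p))
      simpa using this
    have h2 : (p - C (eval x p)) * (X n - C (x n)) ∈ M ^ 2 := by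
      rw [sq]; exact Ideal.mul_mem_mul h1 (hX n)
    convert add_mem h2 (Ideal.mul_mem_left _ (C (x n)) hp) using 1
    have : ∀ k, gradient x (p * X n) k = x n * gradient x p k + eval x p * (Pi.single n 1 : ι → K) k := by
      intro k
      have := congrFun (gradient_X x n) k
      rw [gradient_apply] at this
      rw [gradient_apply, pderiv_mul, map_add, map_mul, map_mul, this, eval_X, gradient_apply]
      ring
    simp only [this, map_add, map_mul, add_mul, Finset.sum_add_distrib, Pi.single_apply, eval_X]
    have e1 : ∑ k, C (eval x p) * C (if k = n then 1 else 0) * (X k - C (x k)) =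
        C (eval x p) * (X n - C (x n) : MvPolynomial ι K) := by
      rw [Finset.sum_eq_single n]
      · simp
      · intro b _ hb; simp [hb]
      · simp
    rw [e1]
    simp only [mul_assoc, ← Finset.mul_sum]
    ring

lemma vanishingIdeal_singleton_eq_span (x : ι → K) :
    vanishingIdeal K {x} = Ideal.span (Set.range fun k => (X k - C (x k) : MvPolynomial ι K)) := by
  apply le_antisymm
  · intro p hp
    have hp0 : eval x p = 0 := by simpa [aeval_eq_eval] using hp
    have h := Ideal.pow_le_self two_ne_zero (sub_linear_mem_sq x p)
    rw [hp0, map_zero, sub_zero] at h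
    have h2 : ∑ k, C (gradient x p k) * (X k - C (x k) : MvPolynomial ι K) ∈
        Ideal.span (Set.range fun k => (X k - C (x k) : MvPolynomial ι K)) :=
      Submodule.sum_mem _ fun k _ => Ideal.mul_mem_left _ _ (Ideal.subset_span ⟨k, rfl⟩)
    simpa using add_mem h h2
  · rw [Ideal.span_le]
    rintro _ ⟨k, rfl⟩
    simp

lemma mem_sq_of_gradient_eq_zero (x : ι → K) (p : MvPolynomial ι K) (h0 : eval x p = 0)
    (h1 : gradient x p = 0) : p ∈ (vanishingIdeal K {x} : Ideal (MvPolynomial ι K)) ^ 2 := by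
  have := sub_linear_mem_sq x p
  rw [h0, h1] at this
  rw [vanishingIdeal_singleton_eq_span]
  simpa using this

end Taylor

/-! ### Heights of primes in polynomial rings and independent gradients. -/

section Height

/-- The element g lies in every component of V(s) other than P but is a unit at m. Hence, locally at
m, any prime containing s contains P. -/
lemma ringKrullDim_quotient_atPrime_le_coheight {R : Type*} [CommRing R] (P : PrimeSpectrum R)
    (m : Ideal R) [m.IsPrime] (s : Set R) {g : R} (hgm : g ∉ m)
    (hg : ∀ q ∈ (Ideal.span s).minimalPrimes, q ≠ P.asIdeal → g ∈ q)
    (J : Ideal (Localization.AtPrime m))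
    (hJ : (Ideal.span s).map (algebraMap R (Localization.AtPrime m)) ≤ J) :
    ringKrullDim (Localization.AtPrime m ⧸ J) ≤ Order.coheight P := by
  rw [Order.coheight_eq_krullDim_Ici]
  let f := (Ideal.Quotient.mk J).comp (algebraMap R (Localization.AtPrime m))
  have key : ∀ q : PrimeSpectrum (Localization.AtPrime m ⧸ J), P ≤ PrimeSpectrum.comap f q := by
    intro q
    have hq1 : Ideal.span s ≤ (PrimeSpectrum.comap f q).asIdeal := by
      intro a ha
      change f a ∈ q.asIdeal
      have : f a = 0 := by
        rw [RingHom.comp_apply, Ideal.Quotient.eq_zero_iff_mem]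
        exact hJ (Ideal.mem_map_of_mem _ ha)
      rw [this]
      exact zero_mem _
    obtain ⟨r, hr, hrq⟩ := Ideal.exists_minimalPrimes_le hq1
    by_cases hrP : r = P.asIdeal
    · subst hrP; exact hrq
    · exfalso
      have hgq : f g ∈ q.asIdeal := hrq (hg r hr hrP)
      have hu : IsUnit (f g) := by
        rw [RingHom.comp_apply]
        exact IsUnit.map _
          ((IsLocalization.AtPrime.isUnit_to_map_iff (Localization.AtPrime m) m g).2 hgm)
      exact q.isPrime.ne_top (Ideal.eq_top_of_isUnit_mem _ hgq hu)
  refine Order.krullDim_le_of_strictMono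
    (fun q => (⟨PrimeSpectrum.comap f q, key q⟩ : Set.Ici P)) ?_
  refine Monotone.strictMono_of_injective (fun a b hab => Ideal.comap_mono hab) ?_
  intro a b hab
  have hab' : PrimeSpectrum.comap f a = PrimeSpectrum.comap f b := congrArg Subtype.val hab
  rw [PrimeSpectrum.comap_comp] at hab'
  exact PrimeSpectrum.comap_injective_of_surjective _ Ideal.Quotient.mk_surjective
    (PrimeSpectrum.localization_comap_injective (Localization.AtPrime m) m.primeCompl hab')

variable {K ι : Type*} [Field K] [Fintype ι]

/-- Translation of the variables, as an automorphism of the polynomial ring. -/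
def translateEquiv (a : ι → K) : MvPolynomial ι K ≃ₐ[K] MvPolynomial ι K :=
  AlgEquiv.ofAlgHom (aeval fun i => X i + C (a i)) (aeval fun i => X i - C (a i))
    (by ext; simp) (by ext; simp)

lemma eval_translateEquiv (a x : ι → K) (p : MvPolynomial ι K) :
    eval x (translateEquiv a p) = eval (x + a) p := by
  have : (aeval x : MvPolynomial ι K →ₐ[K] K).comp (translateEquiv a).toAlgHom =
      aeval (x + a) := by
    ext i; simp [translateEquiv]
  simpa [aeval_eq_eval] using DFunLike.congr_fun this p

variable [IsAlgClosed K]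

instance : FiniteRingKrullDim (MvPolynomial ι K) := by
  rw [finiteRingKrullDim_iff_ne_bot_and_top, ringKrullDim_of_isNoetherianRing,
    ringKrullDim_eq_zero_of_field, zero_add]
  exact ⟨WithBot.natCast_ne_bot _, by
    rw [← ENat.WithBot.coe_eq_natCast]; exact fun h => ENat.natCast_ne_top _ (WithBot.coe_injective h)⟩

/-- Some maximal ideal has full height; by the Nullstellensatz it belongs to a point, and
translations carry that point to any other. -/
lemma height_vanishingIdeal_singleton (x : ι → K) :
    (vanishingIdeal K {x} : Ideal (MvPolynomial ι K)).height = Fintype.card ι := by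
  obtain ⟨m, hm, hd⟩ := Ideal.exists_isMaximal_height (R := MvPolynomial ι K)
  obtain ⟨y, rfl⟩ := eq_vanishingIdeal_singleton_of_isMaximal K hm
  rw [ringKrullDim_of_isNoetherianRing, ringKrullDim_eq_zero_of_field, zero_add,
    Nat.card_eq_fintype_card] at hd
  have hc : (vanishingIdeal K {x}).comap (translateEquiv (x - y)).symm.toRingEquiv
      = (vanishingIdeal K {y} : Ideal (MvPolynomial ι K)) := by
    ext p
    obtain ⟨q, rfl⟩ := (translateEquiv (x - y)).surjective p
    simp only [Ideal.mem_comap, mem_vanishingIdeal_singleton_iff, aeval_eq_eval]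
    erw [AlgEquiv.symm_apply_apply]
    change eval x q = 0 ↔ eval y (translateEquiv (x-y) q) = 0
    rw [eval_translateEquiv]
    simp
  rw [← hc, RingEquiv.height_comap] at hd
  exact_mod_cast hd

lemma exists_mem_zeroLocus_of_notMem {P : Ideal (MvPolynomial ι K)} [P.IsPrime]
    {g : MvPolynomial ι K} (hg : g ∉ P) : ∃ x ∈ zeroLocus K P, eval x g ≠ 0 := by
  by_contra! h
  apply hg
  rw [← IsPrime.vanishingIdeal_zeroLocus (K := K) P]
  intro x hx
  simpa [aeval_eq_eval] using h x hx

lemma le_vanishingIdeal_singleton {P : Ideal (MvPolynomial ι K)} {x : ι → K}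
    (hx : x ∈ zeroLocus K P) : P ≤ vanishingIdeal K {x} := by
  intro p hp
  rw [mem_vanishingIdeal_singleton_iff]
  exact hx p hp

/-- For the nontrivial inequality, P is minimal over height-many elements `s`. At a point of V(P)
off the other components of V(s), the local ring has full dimension, and killing `s` lowers it by at
most the height while leaving at most the coheight. -/
theorem height_add_coheight (P : PrimeSpectrum (MvPolynomial ι K)) :
    Order.height P + Order.coheight P = Fintype.card ι := by
  apply le_antisymm
  · have h := Order.krullDim_eq_iSup_height_add_coheight_of_nonempty
      (α := PrimeSpectrum (MvPolynomial ι K))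
    have h2 : Order.krullDim (PrimeSpectrum (MvPolynomial ι K)) = (Fintype.card ι : ℕ) := by
      rw [← ringKrullDim, ringKrullDim_of_isNoetherianRing, ringKrullDim_eq_zero_of_field, zero_add,
        Nat.card_eq_fintype_card]
    rw [h2] at h
    have h3 : Order.height P + Order.coheight P ≤
        ⨆ a : PrimeSpectrum (MvPolynomial ι K), Order.height a + Order.coheight a :=
      le_iSup (fun a : PrimeSpectrum (MvPolynomial ι K) => Order.height a + Order.coheight a) P
    rw [← WithBot.coe_le_coe, ← h] at h3
    exact_mod_cast h3
  · obtain ⟨s, hs, hcard⟩ := P.asIdeal.exists_finset_card_eq_height_of_isNoetherianRing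
    have hfin := Ideal.finite_minimalPrimes_of_isNoetherianRing (MvPolynomial ι K)
      (Ideal.span (s : Set (MvPolynomial ι K)))
    -- Otherwise the intersection of the other minimal primes would lie in P, and so one of them
    -- would.
    obtain ⟨g, hg, hgP⟩ : ∃ g, (∀ q ∈ (Ideal.span (s : Set (MvPolynomial ι K))).minimalPrimes,
        q ≠ P.asIdeal → g ∈ q) ∧ g ∉ P.asIdeal := by
      by_contra! hcon
      classical
      have : (hfin.toFinset.erase P.asIdeal).inf id ≤ P.asIdeal := by
        intro g hg
        apply hcon
        intro q hq hne
        exact (Finset.inf_le (f := id) (by simp [hne, hq]) :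
          (hfin.toFinset.erase P.asIdeal).inf id ≤ q) hg
      obtain ⟨q, hq, hqP⟩ := (Ideal.IsPrime.inf_le' P.isPrime).1 this
      rw [Finset.mem_erase, Set.Finite.mem_toFinset] at hq
      exact hq.1 (le_antisymm hqP (hs.2 hq.2.1 hqP))
    obtain ⟨x, hxP, hxg⟩ := exists_mem_zeroLocus_of_notMem hgP
    set m : Ideal (MvPolynomial ι K) := vanishingIdeal K {x} with hm
    have hPm : P.asIdeal ≤ m := le_vanishingIdeal_singleton hxP
    have hgm : g ∉ m := by
      rw [hm, mem_vanishingIdeal_singleton_iff]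
      simpa [aeval_eq_eval] using hxg
    let A := Localization.AtPrime m
    have hdimA : ringKrullDim A = Fintype.card ι := by
      rw [IsLocalization.AtPrime.ringKrullDim_eq_height m A, hm, height_vanishingIdeal_singleton]
      rfl
    classical
    let t : Finset A := s.image (algebraMap (MvPolynomial ι K) A)
    have ht : (t : Set A) ⊆ IsLocalRing.maximalIdeal A := by
      intro a ha
      obtain ⟨b, hb, rfl⟩ := Finset.mem_image.1 ha
      rw [← Localization.AtPrime.map_eq_maximalIdeal]
      exact Ideal.mem_map_of_mem _ (hPm (hs.1.2 (Ideal.subset_span hb)))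
    have h1 := ringKrullDim_le_ringKrullDim_quotient_add_card t
      (by rwa [IsLocalRing.ringJacobson_eq_maximalIdeal])
    have h2 : ringKrullDim (A ⧸ Ideal.span (t : Set A)) ≤ Order.coheight P := by
      refine ringKrullDim_quotient_atPrime_le_coheight P m (s : Set (MvPolynomial ι K)) hgm hg _ ?_
      rw [Ideal.map_span, Finset.coe_image]
    have h3 : ((Fintype.card ι : ℕ∞) : WithBot ℕ∞) ≤ Order.coheight P + (s.card : ℕ) := by
      rw [ENat.WithBot.coe_eq_natCast, ← hdimA]
      refine h1.trans (add_le_add h2 ?_)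
      exact_mod_cast Finset.card_image_le
    rw [← PrimeSpectrum.height_eq_orderHeight, ← hcard, add_comm]
    exact_mod_cast h3

/-- Affine-linear forms whose gradients form a basis of a complement complete the g i to a regular
system of parameters of the local ring at x. -/
lemma isPrime_span_and_card_le_height {κ : Type*} [Fintype κ] (x : ι → K)
    (g : κ → MvPolynomial ι K) (h0 : ∀ i, eval x (g i) = 0)
    (hg : LinearIndependent K fun i => gradient x (g i)) :
    (Ideal.span (Set.range fun i => algebraMap _
      (Localization.AtPrime (vanishingIdeal K {x})) (g i))).IsPrime ∧
    (Fintype.card κ : ℕ∞) ≤ (Ideal.span (Set.range fun i => algebraMap _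
      (Localization.AtPrime (vanishingIdeal K {x})) (g i))).height := by
  classical
  set m : Ideal (MvPolynomial ι K) := vanishingIdeal K {x} with hm
  let A := Localization.AtPrime m
  let G := Submodule.span K (Set.range fun i => gradient x (g i))
  obtain ⟨H, hH⟩ := G.exists_isCompl
  have hrG : Module.finrank K G = Fintype.card κ := finrank_span_eq_card hg
  have hsum : Module.finrank K G + Module.finrank K H = Fintype.card ι := by
    rw [Submodule.finrank_add_eq_of_isCompl hH, Module.finrank_fintype_fun_eq_card]
  let l := Module.finBasis K H
  let L : Fin (Module.finrank K H) → MvPolynomial ι K :=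
    fun j => ∑ k, C ((l j : ι → K) k) * (X k - C (x k))
  have hL0 : ∀ j, eval x (L j) = 0 := by intro j; simp [L]
  have hL1 : ∀ j, gradient x (L j) = l j := by
    intro j
    simp only [L, gradient_sum, gradient_C_mul, gradient_sub, gradient_X, gradient_C, sub_zero]
    ext k
    simp [Pi.single_apply]
  have hXm : ∀ k, X k - C (x k) ∈ m := by intro k; simp [hm]
  have halg : Function.Injective (algebraMap (MvPolynomial ι K) A) :=
    IsLocalization.injective A (Ideal.primeCompl_le_nonZeroDivisors m)
  have hginj : Function.Injective fun i => algebraMap _ A (g i) := by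
    intro i j hij
    exact hg.injective (congrArg (gradient x) (halg hij))
  let s : Finset A := Finset.univ.image fun i => algebraMap _ A (g i)
  let t : Finset A := Finset.univ.image fun j => algebraMap _ A (L j)
  have hs : (s : Set A) = Set.range fun i => algebraMap _ A (g i) := by simp [s]
  have hscard : s.card = Fintype.card κ := Finset.card_image_of_injective _ hginj
  have htcard : t.card ≤ Module.finrank K H := by
    refine Finset.card_image_le.trans ?_
    simp
  have hdim : ((s.card + t.card : ℕ) : WithBot ℕ∞) ≤ ringKrullDim A := by
    rw [IsLocalization.AtPrime.ringKrullDim_eq_height m A, hm, height_vanishingIdeal_singleton]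
    rw [ENat.WithBot.coe_eq_natCast]
    exact_mod_cast (by omega : s.card + t.card ≤ Fintype.card ι)
  set I := Ideal.span ((s : Set A) ∪ t) with hI
  have hgI : ∀ i, algebraMap _ A (g i) ∈ I := fun i =>
    Ideal.subset_span (Or.inl (Finset.mem_image_of_mem _ (Finset.mem_univ i)))
  have hLI : ∀ j, algebraMap _ A (L j) ∈ I := fun j =>
    Ideal.subset_span (Or.inr (Finset.mem_image_of_mem _ (Finset.mem_univ j)))
  have hspan : I = IsLocalRing.maximalIdeal A := by
    have hmap : m.map (algebraMap _ A) = IsLocalRing.maximalIdeal A :=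
      Localization.AtPrime.map_eq_maximalIdeal
    apply le_antisymm
    · rw [hI, Ideal.span_le, ← hmap]
      rintro a (ha | ha)
      · obtain ⟨i, -, rfl⟩ := Finset.mem_image.1 ha
        refine Ideal.mem_map_of_mem _ ?_
        simpa [hm, aeval_eq_eval] using h0 i
      · obtain ⟨j, -, rfl⟩ := Finset.mem_image.1 ha
        refine Ideal.mem_map_of_mem _ ?_
        simpa [hm, aeval_eq_eval] using hL0 j
    -- By Nakayama it is enough to generate the maximal ideal modulo its square, where an element
    -- vanishing at x is determined by its gradient.
    · refine Submodule.le_of_le_smul_of_le_jacobson_bot (I := IsLocalRing.maximalIdeal A)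
        (IsNoetherian.noetherian _) (IsLocalRing.maximalIdeal_le_jacobson _) ?_
      have hmspan : m = Ideal.span (Set.range fun k => (X k - C (x k) : MvPolynomial ι K)) :=
        vanishingIdeal_singleton_eq_span x
      rw [← hmap]
      conv_lhs => rw [show Ideal.map (algebraMap _ A) m = Ideal.map (algebraMap _ A)
        (Ideal.span (Set.range fun k => (X k - C (x k) : MvPolynomial ι K))) from
        congrArg _ hmspan]
      rw [Ideal.map_span, Ideal.span_le]
      rintro _ ⟨_, ⟨k, rfl⟩, rfl⟩
      have htop : (Pi.single k 1 : ι → K) ∈ G ⊔ H := by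
        rw [hH.sup_eq_top]; exact Submodule.mem_top
      obtain ⟨u, hu, v, hv, huv⟩ := Submodule.mem_sup.1 htop
      obtain ⟨a, ha⟩ := (Submodule.mem_span_range_iff_exists_fun K).1 hu
      have hb := l.sum_repr ⟨v, hv⟩
      have hb' := congrArg (Subtype.val) hb
      simp only [Submodule.coe_sum, Submodule.coe_smul] at hb'
      set b := l.repr ⟨v, hv⟩
      have hq := mem_sq_of_gradient_eq_zero x
        (X k - C (x k) - ((∑ i, C (a i) * g i) + ∑ j, C (b j) * L j)) (by simp [h0, hL0]) (by
          simp only [gradient_sub, gradient_add, gradient_sum, gradient_C_mul, gradient_X,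
            gradient_C, sub_zero, hL1]
          rw [ha, hb', huv, sub_self])
      rw [← hm] at hq
      have hq' := Ideal.mem_map_of_mem (algebraMap _ A) hq
      rw [Ideal.map_pow, sq, ← smul_eq_mul] at hq'
      have hlin : algebraMap _ A ((∑ i, C (a i) * g i) + ∑ j, C (b j) * L j) ∈ I := by
        rw [map_add, map_sum, map_sum]
        refine add_mem (Submodule.sum_mem _ fun i _ => ?_) (Submodule.sum_mem _ fun j _ => ?_)
        · rw [map_mul]; exact Ideal.mul_mem_left _ _ (hgI i)
        · rw [map_mul]; exact Ideal.mul_mem_left _ _ (hLI j)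
      rw [SetLike.mem_coe]
      have := Submodule.add_mem_sup hlin hq'
      rwa [← map_add, add_sub_cancel] at this
  have r1 := IsLocalRing.isPrime_span_of_span_union s t hspan hdim
  have r2 := IsLocalRing.card_le_height_span s t hspan hdim
  rw [hs] at r1 r2
  rw [hscard] at r2
  exact ⟨r1, r2⟩

lemma disjoint_primeCompl {P m : Ideal (MvPolynomial ι K)} [m.IsPrime] (h : P ≤ m) :
    Disjoint (m.primeCompl : Set (MvPolynomial ι K)) (P : Set (MvPolynomial ι K)) :=
  Set.disjoint_left.2 fun _ ha hb => ha (h hb)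

theorem card_le_height_of_linearIndependent_gradient {κ : Type*} [Fintype κ]
    {P : Ideal (MvPolynomial ι K)} [P.IsPrime] {x : ι → K} (hx : x ∈ zeroLocus K P)
    (g : κ → MvPolynomial ι K) (hgP : ∀ i, g i ∈ P)
    (hg : LinearIndependent K fun i => gradient x (g i)) :
    (Fintype.card κ : ℕ∞) ≤ P.height := by
  have h := isPrime_span_and_card_le_height x g
    (fun i => by simpa [aeval_eq_eval] using hx _ (hgP i)) hg
  rw [← IsLocalization.height_map_of_disjoint (S := Localization.AtPrime (vanishingIdeal K {x}))
    (vanishingIdeal K {x}).primeCompl P (disjoint_primeCompl (le_vanishingIdeal_singleton hx))]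
  refine h.2.trans (Ideal.height_mono ?_)
  rw [Ideal.span_le]
  rintro _ ⟨i, rfl⟩
  exact Ideal.mem_map_of_mem _ (hgP i)

/-- Both ideals are prime, one contains the other, and the smaller already has the height of the
larger. Thus P is locally a complete intersection. -/
lemma span_eq_map_of_height {κ : Type*} [Fintype κ]
    {P : Ideal (MvPolynomial ι K)} [P.IsPrime] {x : ι → K} (hx : x ∈ zeroLocus K P)
    (g : κ → MvPolynomial ι K) (hgP : ∀ i, g i ∈ P)
    (hg : LinearIndependent K fun i => gradient x (g i)) (hP : P.height = Fintype.card κ) :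
    Ideal.span (Set.range fun i => algebraMap _
      (Localization.AtPrime (vanishingIdeal K {x})) (g i)) =
      P.map (algebraMap _ (Localization.AtPrime (vanishingIdeal K {x}))) := by
  have h := isPrime_span_and_card_le_height x g
    (fun i => by simpa [aeval_eq_eval] using hx _ (hgP i)) hg
  have hd := disjoint_primeCompl (le_vanishingIdeal_singleton hx)
  set J := Ideal.span (Set.range fun i => algebraMap _
      (Localization.AtPrime (vanishingIdeal K {x})) (g i)) with hJ
  have : J.IsPrime := h.1
  refine Ideal.eq_of_le_of_height_le (I := J) ?_ ?_
  · rw [Ideal.span_le]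
    rintro _ ⟨i, rfl⟩
    exact Ideal.mem_map_of_mem _ (hgP i)
  · rw [IsLocalization.height_map_of_disjoint (vanishingIdeal K {x}).primeCompl P hd, hP]
    exact h.2

/-- Locally at x both Pᵢ are generated by their families, so P₁ + P₂ is generated by the joint
family. That ideal is prime, hence equals the localized Q; its height is bounded below by
independence and above by Krull's height theorem. -/
theorem height_eq_add_of_mem_minimalPrimes_sup {κ₁ κ₂ : Type*} [Fintype κ₁] [Fintype κ₂]
    {P₁ P₂ Q : Ideal (MvPolynomial ι K)} [P₁.IsPrime] [P₂.IsPrime]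
    (hQ : Q ∈ (P₁ ⊔ P₂).minimalPrimes) {x : ι → K} (hx : x ∈ zeroLocus K Q)
    (g₁ : κ₁ → MvPolynomial ι K) (hg₁ : ∀ i, g₁ i ∈ P₁) (hP₁ : P₁.height = Fintype.card κ₁)
    (g₂ : κ₂ → MvPolynomial ι K) (hg₂ : ∀ i, g₂ i ∈ P₂) (hP₂ : P₂.height = Fintype.card κ₂)
    (hg : LinearIndependent K (Sum.elim (fun i => gradient x (g₁ i)) fun i => gradient x (g₂ i))) :
    Q.height = (Fintype.card κ₁ + Fintype.card κ₂ : ℕ) := by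
  classical
  have hQp : Q.IsPrime := hQ.1.1
  have h1Q : P₁ ≤ Q := le_sup_left.trans hQ.1.2
  have h2Q : P₂ ≤ Q := le_sup_right.trans hQ.1.2
  have hx1 : x ∈ zeroLocus K P₁ := zeroLocus_anti_mono h1Q hx
  have hx2 : x ∈ zeroLocus K P₂ := zeroLocus_anti_mono h2Q hx
  let A := Localization.AtPrime (vanishingIdeal K {x} : Ideal (MvPolynomial ι K))
  have e1 := span_eq_map_of_height hx1 g₁ hg₁
    (by simpa [Function.comp_def] using hg.comp Sum.inl Sum.inl_injective) hP₁
  have e2 := span_eq_map_of_height hx2 g₂ hg₂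
    (by simpa [Function.comp_def] using hg.comp Sum.inr Sum.inr_injective) hP₂
  have hg' : LinearIndependent K fun i => gradient x (Sum.elim g₁ g₂ i) := by
    convert hg using 1
    ext i : 1
    cases i <;> rfl
  have hgQ : ∀ i, Sum.elim g₁ g₂ i ∈ Q := by
    rintro (i | i)
    · exact h1Q (hg₁ i)
    · exact h2Q (hg₂ i)
  have h := isPrime_span_and_card_le_height x (Sum.elim g₁ g₂)
    (fun i => by simpa [aeval_eq_eval] using hx _ (hgQ i)) hg'
  set J : Ideal A := Ideal.span (Set.range fun i => algebraMap _ A (Sum.elim g₁ g₂ i)) with hJ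
  have hJp : J.IsPrime := h.1
  have hJsup : P₁.map (algebraMap (MvPolynomial ι K) A) ⊔ P₂.map (algebraMap (MvPolynomial ι K) A) ≤ J := by
    rw [← e1, ← e2]
    refine sup_le (Ideal.span_mono ?_) (Ideal.span_mono ?_)
    · rintro _ ⟨i, rfl⟩; exact ⟨Sum.inl i, rfl⟩
    · rintro _ ⟨i, rfl⟩; exact ⟨Sum.inr i, rfl⟩
  have hJQ : J ≤ Q.map (algebraMap (MvPolynomial ι K) A) := by
    rw [hJ, Ideal.span_le]
    rintro _ ⟨i, rfl⟩
    exact Ideal.mem_map_of_mem _ (hgQ i)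
  have hd := disjoint_primeCompl (le_vanishingIdeal_singleton hx)
  -- The contraction of J is a prime between P₁ + P₂ and Q, so minimality of Q applies.
  have hQJ : Q ≤ J.comap (algebraMap (MvPolynomial ι K) A) := by
    refine hQ.2 ⟨inferInstance, ?_⟩ ?_
    · rw [← Ideal.map_le_iff_le_comap, Ideal.map_sup]
      exact hJsup
    · have := Ideal.comap_mono (f := algebraMap (MvPolynomial ι K) A) hJQ
      refine this.trans (le_of_eq ?_)
      exact IsLocalization.under_map_of_isPrime_disjoint (vanishingIdeal K {x}).primeCompl A
        hQp hd
  have hJeq : J = Q.map (algebraMap (MvPolynomial ι K) A) := le_antisymm hJQ (Ideal.map_le_iff_le_comap.2 hQJ)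
  rw [← IsLocalization.height_map_of_disjoint (S := A) (vanishingIdeal K {x}).primeCompl Q hd,
    ← hJeq]
  apply le_antisymm
  · let s : Finset A := Finset.univ.image fun i => algebraMap _ A (Sum.elim g₁ g₂ i)
    have hs : (s : Set A) = Set.range fun i => algebraMap _ A (Sum.elim g₁ g₂ i) := by simp [s]
    have : J ∈ (Ideal.span (s : Set A)).minimalPrimes := by
      rw [hs, ← hJ]; simp [Ideal.minimalPrimes_eq_subsingleton_self]
    refine (Ideal.height_le_card_of_mem_minimalPrimes_span_finset this).trans ?_
    have : s.card ≤ Fintype.card κ₁ + Fintype.card κ₂ := by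
      refine Finset.card_image_le.trans ?_
      simp
    exact_mod_cast this
  · simpa using h.2

end Height

end MvPolynomial

/-! ### The Jacobian criterion in characteristic zero. -/

namespace MvPolynomial

lemma eval_aeval {K σ τ : Type*} [Field K] (Φ : τ → MvPolynomial σ K) (F : MvPolynomial τ K) (x : σ → K) :
    eval x (aeval Φ F) = eval (fun k => eval x (Φ k)) F := by
  induction F using MvPolynomial.induction_on with
  | C a => simp
  | add p q hp hq => simp only [map_add, hp, hq]
  | mul_X p n hp => simp only [map_mul, hp, aeval_X, eval_X]

section Jacobian

variable {K σ τ : Type*} [Field K] [Fintype σ] [Fintype τ]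

lemma exists_dual_of_linearIndependent [DecidableEq τ] (v : τ → σ → K)
    (hv : LinearIndependent K v) :
    ∃ B : σ → τ → K, ∀ k l, ∑ s, v k s * B s l = if k = l then 1 else 0 := by
  classical
  obtain ⟨f, hf⟩ := LinearMap.exists_leftInverse_of_injective (Fintype.linearCombination K v)
    (LinearMap.ker_eq_bot.2 (linearIndependent_iff_injective_fintypeLinearCombination.1 hv))
  refine ⟨fun s l => f (Pi.single s 1) l, fun k l => ?_⟩
  have h1 : f (v k) = Pi.single k 1 := by
    have := LinearMap.congr_fun hf (Pi.single k 1)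
    simpa [Fintype.linearCombination_apply_single] using this
  have h2 : v k = ∑ s, v k s • (Pi.single s 1 : σ → K) := by
    ext j; simp [Pi.single_apply]
  rw [h2, map_sum] at h1
  have := congrFun h1 l
  simpa [Pi.single_apply, eq_comm] using this

/-- The Gram-type determinant of gradients against a constant matrix. -/
lemma exists_det_ne_zero {x₀ : σ → K} {g : τ → MvPolynomial σ K}
    (hg : LinearIndependent K fun k => gradient x₀ (g k)) [DecidableEq τ] :
    ∃ B : σ → τ → K, eval x₀ (Matrix.det (Matrix.of fun k l : τ =>
      ∑ s, pderiv s (g k) * C (B s l))) ≠ 0 := by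
  obtain ⟨B, hB⟩ := exists_dual_of_linearIndependent _ hg
  refine ⟨B, ?_⟩
  rw [RingHom.map_det]
  have : (eval x₀).mapMatrix (Matrix.of fun k l : τ => ∑ s, pderiv s (g k) * C (B s l)) = 1 := by
    ext k l
    have := hB k l
    simp only [gradient_apply] at this
    simp [Matrix.one_apply, this]
  rw [this]; simp

/-- Multiply the Jacobian matrix by a constant matrix inverse to it on one side at x₀; the
determinant of the product serves as δ. -/
lemma exists_linearIndependent_gradient_nhds {x₀ : σ → K} {g : τ → MvPolynomial σ K}
    (hg : LinearIndependent K fun k => gradient x₀ (g k)) :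
    ∃ δ : MvPolynomial σ K, eval x₀ δ ≠ 0 ∧
      ∀ x, eval x δ ≠ 0 → LinearIndependent K fun k => gradient x (g k) := by
  classical
  obtain ⟨B, hB⟩ := exists_det_ne_zero hg
  refine ⟨_, hB, fun x hx => ?_⟩
  rw [Fintype.linearIndependent_iff]
  intro a ha
  rw [RingHom.map_det] at hx
  have := Matrix.eq_zero_of_vecMul_eq_zero hx (v := a) (by
    ext l
    simp only [Matrix.vecMul, dotProduct, RingHom.mapMatrix_apply, Matrix.map_apply,
      Matrix.of_apply, map_sum, map_mul, eval_C, Finset.mul_sum, Pi.zero_apply]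
    rw [Finset.sum_comm]
    refine Finset.sum_eq_zero fun s _ => ?_
    have h := congrFun ha s
    simp only [Finset.sum_apply, Pi.smul_apply, gradient_apply, smul_eq_mul, Pi.zero_apply] at h
    simp only [← mul_assoc, ← Finset.sum_mul, h, zero_mul])
  exact fun i => congrFun this i

lemma pderiv_aeval (Φ : τ → MvPolynomial σ K) (F : MvPolynomial τ K) (s : σ) :
    pderiv s (aeval Φ F) = ∑ k, aeval Φ (pderiv k F) * pderiv s (Φ k) := by
  classical
  induction F using MvPolynomial.induction_on with
  | C a => simp
  | add p q hp hq => simp only [map_add, hp, hq, add_mul, Finset.sum_add_distrib]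
  | mul_X p n hp =>
    simp only [map_mul, aeval_X, pderiv_mul, hp, map_add, add_mul, Finset.sum_add_distrib,
      pderiv_X, Pi.single_apply, Finset.sum_mul]
    congr 1
    · exact Finset.sum_congr rfl fun k _ => by ring
    · rw [Finset.sum_eq_single n]
      · simp
      · intro b _ hb; simp [Ne.symm hb]
      · simp

lemma totalDegree_pderiv_lt {F : MvPolynomial τ K} {i : τ} (h : pderiv i F ≠ 0) :
    (pderiv i F).totalDegree < F.totalDegree := by
  have hpos : 0 < F.totalDegree := by
    rw [Nat.pos_iff_ne_zero]
    intro h0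
    rw [totalDegree_eq_zero_iff_eq_C] at h0
    rw [h0] at h
    simp at h
  rw [totalDegree, Finset.sup_lt_iff hpos]
  intro m hm
  rw [mem_support_iff, coeff_pderiv] at hm
  have h1 : m + Finsupp.single i 1 ∈ F.support := mem_support_iff.2 (left_ne_zero_of_mul hm)
  have h2 := le_totalDegree h1
  rw [Finsupp.sum_add_index' (by simp) (by simp)] at h2
  simpa using h2

lemma eq_C_of_pderiv_eq_zero [CharZero K] {F : MvPolynomial τ K} (h : ∀ i, pderiv i F = 0) :
    F = C (coeff 0 F) := by
  classical
  ext m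
  rw [coeff_C]
  split_ifs with hm
  · rw [hm]
  · obtain ⟨i, hi⟩ : ∃ i, m i ≠ 0 := by
      by_contra! hc
      exact hm (Finsupp.ext fun i => (hc i).symm)
    have h1 := coeff_pderiv (i := i) F (m - Finsupp.single i 1)
    rw [h i, coeff_zero, tsub_add_cancel_of_le (by
      rw [Finsupp.single_le_iff]; omega)] at h1
    refine (mul_eq_zero.1 h1.symm).resolve_right ?_
    exact Nat.cast_add_one_ne_zero _

/-- The Jacobian criterion in characteristic zero: polynomials whose gradients are linearly
independent at some point are algebraically independent. -/
theorem eq_zero_of_aeval_eq_zero [CharZero K] {Φ : τ → MvPolynomial σ K} {x₀ : σ → K}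
    (hΦ : LinearIndependent K fun k => gradient x₀ (Φ k)) :
    ∀ F : MvPolynomial τ K, aeval Φ F = 0 → F = 0 := by
  classical
  obtain ⟨B, hB⟩ := exists_det_ne_zero hΦ
  -- By the chain rule the substituted partial derivatives form a row vector killed by a matrix of
  -- nonzero determinant.
  have key : ∀ F : MvPolynomial τ K, aeval Φ F = 0 → ∀ k, aeval Φ (pderiv k F) = 0 := by
    intro F hF
    have := Matrix.eq_zero_of_vecMul_eq_zero (M := Matrix.of fun k l : τ =>
      ∑ s, pderiv s (Φ k) * C (B s l)) (fun h0 => hB (by rw [h0]; simp))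
      (v := fun k => aeval Φ (pderiv k F)) (by
        ext1 l
        simp only [Matrix.vecMul, dotProduct, Matrix.of_apply, Finset.mul_sum, Pi.zero_apply]
        rw [Finset.sum_comm]
        refine Finset.sum_eq_zero fun s _ => ?_
        simp only [← mul_assoc, ← Finset.sum_mul]
        rw [← pderiv_aeval, hF]
        simp)
    exact fun k => congrFun this k
  intro F
  -- The partial derivatives have smaller degree, so they vanish by induction; characteristic zero
  -- makes F constant.
  induction hn : F.totalDegree using Nat.strong_induction_on generalizing F with
  | _ n ih =>
    intro hF
    have h0 : ∀ k, pderiv k F = 0 := by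
      intro k
      by_contra hk
      exact hk (ih _ (hn ▸ totalDegree_pderiv_lt hk) _ rfl (key F hF k))
    have hC := eq_C_of_pderiv_eq_zero h0
    rw [hC, aeval_C, algebraMap_eq, C_eq_zero] at hF
    rw [hC, hF, C_0]

end Jacobian

end MvPolynomial

/-! ### Density of the tuples spanned by rank-one matrices. -/

section RankOne

/-- The expansion in powers of X^D is unique: the summands occupy disjoint ranges of degrees. -/
lemma Polynomial.eq_zero_of_sum_mul_X_pow {K : Type*} [Field K] {D m : ℕ} (A : ℕ → Polynomial K)
    (hA : ∀ k < m, (A k).degree < D) (h : ∑ k ∈ Finset.range m, A k * X ^ (D * k) = 0) :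
    ∀ k < m, A k = 0 := by
  intro k hk
  ext j
  rcases lt_or_ge j D with hj | hj
  · have := congrArg (fun p => coeff p (D * k + j)) h
    simp only [finsetSum_coeff, coeff_zero, coeff_mul_X_pow'] at this
    rw [Finset.sum_eq_single k] at this
    · simpa using this
    · intro l hl hlk
      split_ifs with hle
      · apply coeff_eq_zero_of_degree_lt
        refine (hA l (Finset.mem_range.1 hl)).trans_le ?_
        have hlt : l < k := by
          by_contra hge
          have : D * (k + 1) ≤ D * l := Nat.mul_le_mul_left D (by omega)
          rw [Nat.mul_add] at this
          omega
        have : D * (l + 1) ≤ D * k := Nat.mul_le_mul_left D hlt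
        rw [Nat.mul_add] at this
        exact_mod_cast (by omega : D ≤ D * k + j - D * l)
      · rfl
    · intro hk'; exact absurd (Finset.mem_range.2 hk) hk'
  · rw [coeff_zero]
    exact coeff_eq_zero_of_degree_lt ((hA k hk).trans_le (by exact_mod_cast hj))

/-- The points `((t^j)_j, (t^(D k))_k)` of the Segre variety are in general position with respect
to tangent spaces. -/
lemma Polynomial.eq_zero_of_vanishing_on_moment_points {K : Type*} [Field K] {D m c : ℕ}
    (a : Fin (D + 1) → Fin (m + 1) → K) (t : Fin c → K) (ht : Function.Injective t)
    (hs : D ≠ 0 → Function.Injective fun l => t l ^ D) (hc : D * m + 1 ≤ c) (i : Fin c)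
    (h1 : ∀ l, ∑ j, ∑ k, a j k * (t l ^ (j : ℕ) * (t l ^ D) ^ (k : ℕ)) = 0)
    (h2 : ∀ j, ∑ k, a j k * (t i ^ D) ^ (k : ℕ) = 0)
    (h3 : ∀ k, ∑ j, a j k * t i ^ (j : ℕ) = 0) : a = 0 := by
  classical
  -- View a as a polynomial a(T, S) of bidegree (D, m), with A k the coefficient of S^k. It vanishes
  -- at all points (t l, t l ^ D) and on both ruling lines through the i-th one, so it is divisible
  -- by T - t i and by S - t i ^ D.
  let A : Fin (m + 1) → Polynomial K := fun k => ∑ j : Fin (D + 1), Polynomial.C (a j k) * X ^ (j : ℕ)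
  have hAcoeff : ∀ k (j : Fin (D + 1)), (A k).coeff j = a j k := by
    intro k j
    simp only [A, finsetSum_coeff, coeff_C_mul_X_pow]
    rw [Finset.sum_eq_single j]
    · simp
    · intro b _ hb
      rw [if_neg]
      exact fun h => hb (Fin.ext h.symm)
    · simp
  have hAdeg : ∀ k, (A k).natDegree ≤ D := by
    intro k
    refine natDegree_sum_le_of_forall_le _ _ fun j _ => ?_
    exact (natDegree_C_mul_X_pow_le _ _).trans (by omega)
  have hAroot : ∀ k, (A k).IsRoot (t i) := by
    intro k
    simp only [A, IsRoot, eval_finsetSum, eval_mul, eval_C, eval_pow, eval_X]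
    exact h3 k
  let B : Fin (m + 1) → Polynomial K := fun k => A k /ₘ (X - Polynomial.C (t i))
  have hAB : ∀ k, (X - Polynomial.C (t i)) * B k = A k := fun k =>
    mul_divByMonic_eq_iff_isRoot.2 (hAroot k)
  have hBdeg : ∀ k, (B k).degree < D := by
    intro k
    by_cases hB : B k = 0
    · rw [hB, degree_zero]; exact WithBot.bot_lt_coe _
    · have h := hAdeg k
      rw [← hAB k, natDegree_mul (X_sub_C_ne_zero _) hB, natDegree_X_sub_C] at h
      rw [degree_eq_natDegree hB]
      exact_mod_cast (by omega : (B k).natDegree < D)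
  suffices hB : ∀ k, B k = 0 by
    ext j k
    rw [← hAcoeff k j, ← hAB k, hB k]
    simp
  rcases Nat.eq_zero_or_pos D with hD | hD
  · intro k
    have := hBdeg k
    rw [hD] at this
    by_contra hne
    rw [degree_eq_natDegree hne] at this
    exact absurd this (by simp)
  have hsum : ∑ k, B k * Polynomial.C ((t i ^ D) ^ (k : ℕ)) = 0 := by
    have h : (X - Polynomial.C (t i)) * ∑ k, B k * Polynomial.C ((t i ^ D) ^ (k : ℕ)) = 0 := by
      rw [Finset.mul_sum]
      simp only [← mul_assoc, hAB]
      ext j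
      simp only [finsetSum_coeff, coeff_mul_C, coeff_zero]
      rcases lt_or_ge j (D + 1) with hj | hj
      · have := h2 ⟨j, hj⟩
        rw [← this]
        exact Finset.sum_congr rfl fun k _ => by rw [← hAcoeff k ⟨j, hj⟩]
      · refine Finset.sum_eq_zero fun k _ => ?_
        rw [coeff_eq_zero_of_natDegree_lt (lt_of_le_of_lt (hAdeg k) hj), zero_mul]
    exact (mul_eq_zero.1 h).resolve_left (X_sub_C_ne_zero _)
  -- The quotient of a(T, S) by (T - t i)(S - t i ^ D), restricted to the curve S = T^D.
  let E : Polynomial K := ∑ k : Fin (m + 1), B k * ∑ b ∈ Finset.range k,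
    (X ^ D) ^ b * Polynomial.C ((t i ^ D) ^ ((k : ℕ) - 1 - b))
  have hE : ((X : Polynomial K) ^ D - Polynomial.C (t i ^ D)) * E = ∑ k, B k * (X ^ D) ^ (k : ℕ) := by
    rw [Finset.mul_sum]
    have : ∀ k : Fin (m + 1), (X ^ D - Polynomial.C (t i ^ D)) * (B k * ∑ b ∈ Finset.range k,
        (X ^ D) ^ b * Polynomial.C ((t i ^ D) ^ ((k : ℕ) - 1 - b))) =
        B k * (X ^ D) ^ (k : ℕ) - B k * Polynomial.C ((t i ^ D) ^ (k : ℕ)) := by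
      intro k
      simp only [Polynomial.C_pow (n := (k : ℕ) - 1 - _)]
      simp only [map_pow]
      rw [mul_left_comm, mul_comm (_ - _) (Finset.sum _ _), geom_sum₂_mul, mul_sub]
    rw [Finset.sum_congr rfl fun k _ => this k, Finset.sum_sub_distrib, hsum, sub_zero]
  -- The bidegree of the quotient is at most (D - 1, m - 1), so on the curve the degree is at most D
  -- - 1 + D(m - 1) = Dm - 1. The c - 1 ≥ Dm remaining points are then too many roots.
  have hEdeg : E.degree < (D * m : ℕ) := by
    refine (degree_sum_le _ _).trans_lt ?_
    rw [Finset.sup_lt_iff (WithBot.bot_lt_coe _)]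
    intro k _
    by_cases hBk : B k = 0
    · rw [hBk, zero_mul, degree_zero]; exact WithBot.bot_lt_coe _
    rw [degree_mul, degree_eq_natDegree hBk]
    have hb := hBdeg k
    rw [degree_eq_natDegree hBk] at hb
    have hb' : (B k).natDegree < D := by exact_mod_cast hb
    have h2 : (∑ b ∈ Finset.range k, ((X : Polynomial K) ^ D) ^ b *
        Polynomial.C ((t i ^ D) ^ ((k : ℕ) - 1 - b))).degree ≤ ((D * (m - 1) : ℕ) : WithBot ℕ) := by
      refine (degree_sum_le _ _).trans (Finset.sup_le fun b hb => ?_)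
      rw [← pow_mul, mul_comm]
      refine (degree_C_mul_X_pow_le _ _).trans ?_
      have := Finset.mem_range.1 hb
      have hk := k.2
      exact_mod_cast Nat.mul_le_mul_left D (by omega : b ≤ m - 1)
    rcases Nat.eq_zero_or_pos (k : ℕ) with hk | hk
    · rw [hk, Finset.range_zero, Finset.sum_empty, degree_zero, WithBot.add_bot]
      exact WithBot.bot_lt_coe _
    have hm : 1 ≤ m := by have := k.2; omega
    refine (add_le_add_right h2 _).trans_lt ?_
    have : D * (m - 1) + D = D * m := by
      rw [← Nat.mul_succ]; congr 1; omega
    exact_mod_cast (by omega : (B k).natDegree + D * (m - 1) < D * m)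
  have hE0 : E = 0 := by
    refine eq_zero_of_degree_lt_of_eval_finset_eq_zero
      ((Finset.univ.erase i).image t) ?_ ?_
    · refine hEdeg.trans_le ?_
      rw [Finset.card_image_of_injective _ ht, Finset.card_erase_of_mem (Finset.mem_univ _),
        Finset.card_univ, Fintype.card_fin]
      exact_mod_cast (by omega : D * m ≤ c - 1)
    · intro x hx
      obtain ⟨l, hl, rfl⟩ := Finset.mem_image.1 hx
      have hli : l ≠ i := (Finset.mem_erase.1 hl).1
      have h4 : t l - t i ≠ 0 := sub_ne_zero.2 fun h => hli (ht h)
      have h5 : t l ^ D - t i ^ D ≠ 0 := sub_ne_zero.2 fun h => hli (hs (by omega) h)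
      have h6 := congrArg (Polynomial.eval (t l)) hE
      simp only [eval_mul, eval_sub, eval_pow, eval_X, eval_C, eval_finsetSum] at h6
      have h7 : (t l - t i) * ∑ k, Polynomial.eval (t l) (B k) * (t l ^ D) ^ (k : ℕ) = 0 := by
        rw [← h1 l, Finset.sum_comm, Finset.mul_sum]
        refine Finset.sum_congr rfl fun k _ => ?_
        have h8 := congrArg (Polynomial.eval (t l)) (hAB k)
        simp only [eval_mul, eval_sub, eval_X, eval_C, A, eval_finsetSum, eval_pow] at h8
        rw [← mul_assoc, h8, Finset.sum_mul]
        exact Finset.sum_congr rfl fun j _ => by ring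
      rw [← h6] at h7
      exact (mul_eq_zero.1 ((mul_eq_zero.1 h7).resolve_left h4)).resolve_left h5
  rw [hE0, mul_zero] at hE
  have hfin := Polynomial.eq_zero_of_sum_mul_X_pow (D := D) (m := m + 1)
    (fun k => if h : k < m + 1 then B ⟨k, h⟩ else 0)
    (fun k hk => by simpa [hk] using hBdeg ⟨k, hk⟩)
    (by
      rw [← Fin.sum_univ_eq_sum_range (fun k => (if h : k < m + 1 then B ⟨k, h⟩ else 0) *
        X ^ (D * k)) (m + 1)]
      rw [hE]
      exact Finset.sum_congr rfl fun k _ => by rw [dif_pos k.2, pow_mul])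
  intro k
  simpa [k.2] using hfin k k.2

/-- A polynomial on `c`-tuples of `d × m` matrices which vanishes on all tuples contained in a
subspace spanned by `c` matrices of rank at most one is zero if `c > (d - 1) (m - 1)`. -/
theorem eq_zero_of_vanishing_on_rankOne_tuples {K : Type*} [Field K] [CharZero K] {D m c : ℕ}
    (hc : D * m + 1 ≤ c) (F : MvPolynomial (Fin c × (Fin (D + 1) × Fin (m + 1))) K)
    (hF : ∀ (G : Fin c → Fin c → K) (u : Fin c → Fin (D + 1) → K) (w : Fin c → Fin (m + 1) → K),
      eval (fun q => ∑ l, G q.1 l * (u l q.2.1 * w l q.2.2)) F = 0) : F = 0 := by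
  -- The universal parametrization: coefficients of the combinations, column vectors and row vectors
  -- are all indeterminates.
  let Φ : Fin c × (Fin (D + 1) × Fin (m + 1)) →
      MvPolynomial ((Fin c × Fin c) ⊕ (Fin c × Fin (D + 1)) ⊕ (Fin c × Fin (m + 1))) K :=
    fun q => ∑ l, X (Sum.inl (q.1, l)) * (X (Sum.inr (Sum.inl (l, q.2.1))) *
      X (Sum.inr (Sum.inr (l, q.2.2))))
  -- Positive integers have distinct D-th powers for D ≠ 0, and they stay distinct in characteristic
  -- zero.
  let t : Fin c → K := fun l => ((l : ℕ) + 1 : ℕ)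
  let x₀ : ((Fin c × Fin c) ⊕ (Fin c × Fin (D + 1)) ⊕ (Fin c × Fin (m + 1))) → K :=
    Sum.elim (fun p => if p.1 = p.2 then 1 else 0)
      (Sum.elim (fun p => t p.1 ^ (p.2 : ℕ)) fun p => (t p.1 ^ D) ^ (p.2 : ℕ))
  refine eq_zero_of_aeval_eq_zero (Φ := Φ) (x₀ := x₀) ?_ F ?_
  · rw [Fintype.linearIndependent_iff]
    intro a ha
    have ht : Function.Injective t := by
      intro l l' h
      have : (l : ℕ) + 1 = (l' : ℕ) + 1 := Nat.cast_injective (R := K) h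
      exact Fin.ext (by omega)
    have hs : D ≠ 0 → Function.Injective fun l => t l ^ D := by
      intro hD l l' h
      have h' : ((l : ℕ) + 1) ^ D = ((l' : ℕ) + 1) ^ D := by
        simp only [t] at h
        exact_mod_cast h
      have := Nat.pow_left_injective hD h'
      exact Fin.ext (by simpa using this)
    -- With the identity as coefficient matrix, the derivatives in the coefficients make the i-th
    -- block of a linear relation vanish on all the rank-one points, and those in the i-th vectors
    -- make it vanish on the tangent space of the Segre cone at the i-th point.
    have key : ∀ i, (fun j k => a (i, (j, k))) = 0 := by
      intro i
      refine Polynomial.eq_zero_of_vanishing_on_moment_points _ t ht hs hc i ?_ ?_ ?_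
      · intro l
        have h := congrFun ha (Sum.inl (i, l))
        simp [Φ, x₀, Fintype.sum_prod_type, pderiv_X, Pi.single_apply, ite_and] at h
        rw [Finset.sum_eq_single i (fun x _ hx => by simp [hx]) (by simp)] at h
        simpa using h
      · intro j
        have h := congrFun ha (Sum.inr (Sum.inl (i, j)))
        simp [Φ, x₀, Fintype.sum_prod_type, pderiv_X, Pi.single_apply, ite_and] at h
        rw [Finset.sum_eq_single i (fun x _ hx => by simp [hx, apply_ite (eval _)]) (by simp)] at h
        simpa [apply_ite (eval _)] using h
      · intro k
        have h := congrFun ha (Sum.inr (Sum.inr (i, k)))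
        simp [Φ, x₀, Fintype.sum_prod_type, pderiv_X, Pi.single_apply, ite_and] at h
        rw [Finset.sum_eq_single i (fun x _ hx => by simp [hx, apply_ite (eval _)]) (by simp)] at h
        simpa [apply_ite (eval _)] using h
    rintro ⟨i, j, k⟩
    exact congrFun (congrFun (key i) j) k
  · apply MvPolynomial.funext
    intro y
    have h := hF (fun i l => y (Sum.inl (i, l))) (fun l j => y (Sum.inr (Sum.inl (l, j))))
      (fun l k => y (Sum.inr (Sum.inr (l, k))))
    rw [map_zero, ← h, eval_aeval]
    simp [Φ]

end RankOne

/-! ### Dimension of an irreducible closed set as a height. -/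

section KrullDim

open TopologicalSpace

/-- Irreducible closed subsets of Z embed strictly monotonically into those of X below Z, by closure
of the image, and conversely by preimage. -/
theorem topologicalKrullDim_eq_height {X : Type*} [TopologicalSpace X] (Z : IrreducibleCloseds X) :
    topologicalKrullDim ↥(Z : Set X) = Order.height Z := by
  rw [Order.height_eq_krullDim_Iic, topologicalKrullDim]
  have hcl : Topology.IsClosedEmbedding (Subtype.val : ↥(Z : Set X) → X) :=
    Z.isClosed.isClosedEmbedding_subtypeVal
  apply le_antisymm
  · refine Order.krullDim_le_of_strictMono (fun T => (⟨IrreducibleCloseds.map Subtype.val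
      hcl.continuous T, ?_⟩ : Set.Iic Z)) ?_
    · change closure (Subtype.val '' (T : Set ↥(Z : Set X))) ⊆ (Z : Set X)
      refine closure_minimal ?_ Z.isClosed
      rintro _ ⟨x, -, rfl⟩
      exact x.2
    · exact fun A B h => IrreducibleCloseds.map_strictMono_of_isInducing hcl.isInducing h
  · have key : ∀ V : Set.Iic Z, IsIrreducible ((Subtype.val : ↥(Z : Set X) → X) ⁻¹' (V.1 : Set X)) := by
      intro V
      have hVZ : (V.1 : Set X) ⊆ Z := V.2
      obtain ⟨v, hv⟩ := V.1.isIrreducible.nonempty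
      refine ⟨⟨⟨v, hVZ hv⟩, hv⟩, ?_⟩
      rw [isPreirreducible_iff_isClosed_union_isClosed]
      intro z₁ z₂ h₁ h₂ hsub
      obtain ⟨w₁, hw₁, rfl⟩ := isClosed_induced_iff.1 h₁
      obtain ⟨w₂, hw₂, rfl⟩ := isClosed_induced_iff.1 h₂
      have := isPreirreducible_iff_isClosed_union_isClosed.1 V.1.isIrreducible.2 w₁ w₂ hw₁ hw₂
        (fun x hx => hsub (show (⟨x, hVZ hx⟩ : ↥(Z : Set X)) ∈ _ from hx))
      exact this.imp (fun h x hx => h hx) (fun h x hx => h hx)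
    refine Order.krullDim_le_of_strictMono (fun V => (⟨_, key V,
      V.1.isClosed.preimage hcl.continuous⟩ : IrreducibleCloseds ↥(Z : Set X))) ?_
    refine Monotone.strictMono_of_injective (fun A B h x hx => h hx) ?_
    intro A B h
    have h' : ((Subtype.val : ↥(Z : Set X) → X) ⁻¹' (A.1 : Set X)) = Subtype.val ⁻¹' (B.1 : Set X) :=
      congrArg IrreducibleCloseds.carrier h
    apply Subtype.ext
    apply IrreducibleCloseds.ext
    have hA : (A.1 : Set X) ⊆ Z := A.2
    have hB : (B.1 : Set X) ⊆ Z := B.2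
    ext x
    constructor
    · intro hx
      have : (⟨x, hA hx⟩ : ↥(Z : Set X)) ∈ ((Subtype.val : ↥(Z : Set X) → X) ⁻¹' (A.1 : Set X)) := hx
      rw [h'] at this
      exact this
    · intro hx
      have : (⟨x, hB hx⟩ : ↥(Z : Set X)) ∈ ((Subtype.val : ↥(Z : Set X) → X) ⁻¹' (B.1 : Set X)) := hx
      rw [← h'] at this
      exact this

end KrullDim

/-! ### Affine charts of the Grassmannian and the dimension formula. -/

namespace Grassmannian

section Chart

variable {K W : Type*} [Field K] [AddCommGroup W] [Module K W] [FiniteDimensional K W]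
  {d m : ℕ}

/-- The frame `b_j + ∑ᵢ x_{ji} c_i` attached to a basis `b, c` of `W` and a matrix `x`. -/
def frame (b : Module.Basis (Fin d ⊕ Fin m) K W) (x : Fin d × Fin m → K) (j : Fin d) : W :=
  b (Sum.inl j) + ∑ i, x (j, i) • b (Sum.inr i)

variable (b : Module.Basis (Fin d ⊕ Fin m) K W) (x : Fin d × Fin m → K)

lemma coord_inl_frame (i j : Fin d) :
    b.coord (Sum.inl i) (frame b x j) = if i = j then 1 else 0 := by
  simp [frame, Finsupp.single_apply, eq_comm]

lemma coord_inr_frame (i : Fin m) (j : Fin d) :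
    b.coord (Sum.inr i) (frame b x j) = x (j, i) := by
  simp [frame, Finsupp.single_apply]

lemma linearIndependent_frame : LinearIndependent K (frame b x) := by
  rw [Fintype.linearIndependent_iff]
  intro a ha i
  have := congrArg (b.coord (Sum.inl i)) ha
  simpa only [map_sum, map_smul, coord_inl_frame, smul_eq_mul, mul_ite, mul_one, mul_zero,
    Finset.sum_ite_eq, Finset.mem_univ, if_true, map_zero] using this

/-- The affine chart of the Grassmannian defined by a basis of `W`. -/
def chart (b : Module.Basis (Fin d ⊕ Fin m) K W) (x : Fin d × Fin m → K) : Grassmannian K W d where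
  space := Submodule.span K (Set.range (frame b x))
  finrank_space := by
    rw [finrank_span_eq_card (linearIndependent_frame b x), Fintype.card_fin]

/-- The basis of a point of a chart given by its frame. -/
def chartBasis : Module.Basis (Fin d) K (chart b x).space :=
  Module.Basis.span (linearIndependent_frame b x)

@[simp] lemma coe_chartBasis (j : Fin d) : (chartBasis b x j : W) = frame b x j :=
  congrArg Subtype.val (Module.Basis.span_apply (linearIndependent_frame b x) j)

lemma chart_injective : Function.Injective (chart b) := by
  intro x y h
  have key : ∀ j, frame b x j = frame b y j := by
    intro j
    have h1 : frame b x j ∈ (chart b y).space := by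
      rw [← h]; exact Submodule.subset_span ⟨j, rfl⟩
    obtain ⟨a, ha⟩ := (Submodule.mem_span_range_iff_exists_fun K).1 h1
    have h2 : ∀ i, a i = if i = j then 1 else 0 := by
      intro i
      have := congrArg (b.coord (Sum.inl i)) ha
      simpa only [map_sum, map_smul, coord_inl_frame, smul_eq_mul, mul_ite, mul_one, mul_zero,
        Finset.sum_ite_eq, Finset.mem_univ, if_true, map_zero] using this
    rw [← ha]
    simp [h2]
  ext ⟨j, i⟩
  rw [← coord_inr_frame b x, key j, coord_inr_frame]

/-- The Plücker coordinates, as polynomials, of a family of vectors with polynomial coordinates. -/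
def pluckerPoly {σ κ : Type*} [Fintype κ] (A : Fin d → κ → MvPolynomial σ K)
    (e : Module.Basis κ K W) (φ : Fin d → Module.Dual K W) : MvPolynomial σ K :=
  Matrix.det (Matrix.of fun i j => ∑ k, A j k * C (φ i (e k)))

lemma eval_pluckerPoly {σ κ : Type*} [Fintype κ] (A : Fin d → κ → MvPolynomial σ K)
    (e : Module.Basis κ K W) (φ : Fin d → Module.Dual K W) (y : σ → K) :
    eval y (pluckerPoly A e φ) = pluckerCoord (fun j => ∑ k, eval y (A j k) • e k) φ := by
  rw [pluckerPoly, pluckerCoord, RingHom.map_det]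
  congr 1
  ext i j
  simp

/-- The coordinates of the frame of a chart, as polynomials. -/
def framePoly (K : Type*) [Field K] (d m : ℕ) (j : Fin d) :
    Fin d ⊕ Fin m → MvPolynomial (Fin d × Fin m) K :=
  Sum.elim (fun i => if i = j then 1 else 0) fun i => X (j, i)

lemma sum_eval_framePoly (j : Fin d) :
    ∑ k, eval x (framePoly K d m j k) • b k = frame b x j := by
  simp [framePoly, frame, apply_ite (eval x)]

/-- The pullback to a chart of a polynomial in Plücker coordinates. -/
def pullback (f : MvPolynomial (Fin d → Module.Dual K W) K) : MvPolynomial (Fin d × Fin m) K :=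
  aeval (pluckerPoly (framePoly K d m) b) f

lemma eval_pullback (f : MvPolynomial (Fin d → Module.Dual K W) K) :
    eval x (pullback b f) = eval (pluckerCoord (frame b x)) f := by
  rw [pullback, eval_aeval]
  congr 2
  ext φ
  rw [eval_pluckerPoly]
  simp only [sum_eval_framePoly]

/-- The tuple of linear forms whose Plücker coordinate is `1` on the chart. -/
def chartForms (b : Module.Basis (Fin d ⊕ Fin m) K W) : Fin d → Module.Dual K W :=
  fun i => b.coord (Sum.inl i)

lemma pluckerCoord_frame_chartForms : pluckerCoord (frame b x) (chartForms b) = 1 := by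
  rw [pluckerCoord, ← Matrix.det_one (n := Fin d)]
  congr 1
  ext i j
  rw [Matrix.of_apply, chartForms, coord_inl_frame, Matrix.one_apply]

lemma pluckerCoord_frame_update (j : Fin d) (i : Fin m) :
    pluckerCoord (frame b x) (Function.update (chartForms b) j (b.coord (Sum.inr i))) =
      x (j, i) := by
  have : (Matrix.of fun k l => Function.update (chartForms b) j (b.coord (Sum.inr i)) k
      (frame b x l)) = (1 : Matrix (Fin d) (Fin d) K).updateRow j fun l => x (l, i) := by
    ext k l
    rw [Matrix.of_apply, Matrix.updateRow_apply]
    by_cases hk : k = j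
    · subst hk
      rw [Function.update_self, if_pos rfl, coord_inr_frame]
    · rw [Function.update_of_ne hk, if_neg hk, chartForms, coord_inl_frame, Matrix.one_apply]
  rw [pluckerCoord, this, ← Matrix.cramer_transpose_apply, Matrix.transpose_one, Matrix.cramer_one]
  rfl

/-- Every polynomial function on a chart is the restriction of a homogeneous polynomial in the
Plücker coordinates. -/
lemma exists_isHomogeneous_eval_eq (p : MvPolynomial (Fin d × Fin m) K) :
    ∃ (D : ℕ) (f : MvPolynomial (Fin d → Module.Dual K W) K), f.IsHomogeneous D ∧
      ∀ x, eval (pluckerCoord (frame b x)) f = eval x p := by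
  -- All large degrees are needed so that two summands can be brought to a common degree; the
  -- coordinate of `chartForms b` equals 1 on the chart and only raises the degree.
  suffices h : ∃ D₀ : ℕ, ∀ D, D₀ ≤ D → ∃ f : MvPolynomial (Fin d → Module.Dual K W) K,
      f.IsHomogeneous D ∧ ∀ x, eval (pluckerCoord (frame b x)) f = eval x p by
    obtain ⟨D₀, h⟩ := h
    exact ⟨D₀, h D₀ le_rfl⟩
  induction p using MvPolynomial.induction_on with
  | C a =>
    refine ⟨0, fun D _ => ⟨C a * X (chartForms b) ^ D, ?_, fun x => ?_⟩⟩
    · simpa using (isHomogeneous_C (Fin d → Module.Dual K W) a).mul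
        ((isHomogeneous_X K (chartForms b)).pow D)
    · simp [pluckerCoord_frame_chartForms]
  | add p q hp hq =>
    obtain ⟨D₁, hp⟩ := hp
    obtain ⟨D₂, hq⟩ := hq
    refine ⟨max D₁ D₂, fun D hD => ?_⟩
    obtain ⟨f, hf, hf'⟩ := hp D (le_trans (le_max_left _ _) hD)
    obtain ⟨g, hg, hg'⟩ := hq D (le_trans (le_max_right _ _) hD)
    exact ⟨f + g, hf.add hg, fun x => by rw [map_add, map_add, hf', hg']⟩
  | mul_X p n hp =>
    obtain ⟨D₁, hp⟩ := hp
    refine ⟨D₁ + 1, fun D hD => ?_⟩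
    obtain ⟨f, hf, hf'⟩ := hp (D - 1) (by omega)
    refine ⟨f * X (Function.update (chartForms b) n.1 (b.coord (Sum.inr n.2))), ?_, fun x => ?_⟩
    · have := hf.mul (isHomogeneous_X K (Function.update (chartForms b) n.1 (b.coord (Sum.inr n.2))))
      rwa [Nat.sub_add_cancel (by omega)] at this
    · rw [map_mul, map_mul, hf', eval_X, eval_X, pluckerCoord_frame_update]

/-- Multiplying the basis by the inverse of the nonvanishing minor brings it into the normal form of
a frame. -/
lemma mem_range_chart {L : Grassmannian K W d} (B : Module.Basis (Fin d) K L.space)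
    (hB : pluckerCoord (fun j => (B j : W)) (chartForms b) ≠ 0) : L ∈ Set.range (chart b) := by
  set M : Matrix (Fin d) (Fin d) K := Matrix.of fun i j => chartForms b i (B j : W) with hM
  have hdet : IsUnit M.det := (Ne.isUnit hB)
  let A : Fin d → W := fun j => ∑ k, M⁻¹ k j • (B k : W)
  let x : Fin d × Fin m → K := fun q => b.coord (Sum.inr q.2) (A q.1)
  have hA : ∀ j, frame b x j = A j := by
    intro j
    apply b.ext_elem
    rintro (i | i)
    · have h1 : b.coord (Sum.inl i) (A j) = if i = j then 1 else 0 := by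
        have := congrFun (congrFun (Matrix.mul_nonsing_inv M hdet) i) j
        rw [Matrix.mul_apply, Matrix.one_apply] at this
        rw [← this]
        simp only [A, map_sum, map_smul, smul_eq_mul]
        exact Finset.sum_congr rfl fun k _ => mul_comm _ _
      exact (coord_inl_frame b x i j).trans h1.symm
    · exact coord_inr_frame b x i j
  refine ⟨x, ?_⟩
  apply Grassmannian.ext
  refine Submodule.eq_of_le_of_finrank_eq ?_ ?_
  · refine Submodule.span_le.2 ?_
    rintro _ ⟨j, rfl⟩
    rw [hA, SetLike.mem_coe]
    exact Submodule.sum_mem _ fun k _ => Submodule.smul_mem _ _ (B k).2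
  · rw [(chart b x).finrank_space, L.finrank_space]

lemma pluckerCoord_ne_zero_of_mem_range_chart {L : Grassmannian K W d}
    (hL : L ∈ Set.range (chart b)) (B : Module.Basis (Fin d) K L.space) :
    pluckerCoord (fun j => (B j : W)) (chartForms b) ≠ 0 := by
  obtain ⟨x, rfl⟩ := hL
  obtain ⟨t, ht⟩ := pluckerCoord_change _ B (chartBasis b x)
  have := congrFun ht (chartForms b)
  simp only [coe_chartBasis] at this
  rw [pluckerCoord_frame_chartForms] at this
  intro h0
  rw [h0, mul_zero] at this
  exact one_ne_zero this

lemma vanishesAt_chart_iff {f : MvPolynomial (Fin d → Module.Dual K W) K} {D : ℕ}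
    (hf : f.IsHomogeneous D) : VanishesAt f (chart b x) ↔ eval x (pullback b f) = 0 := by
  rw [vanishesAt_iff hf _ (chartBasis b x), eval_pullback]
  simp only [coe_chartBasis]

lemma isOpen_range_chart : IsOpen (Set.range (chart b)) := by
  rw [← isClosed_compl_iff, isClosed_iff]
  refine ⟨{X (chartForms b)}, ?_, ?_⟩
  · rintro f rfl
    exact ⟨1, isHomogeneous_X _ _⟩
  · ext L
    constructor
    · rintro hL f rfl B
      rw [eval_X]
      by_contra h
      exact hL (mem_range_chart b B h)
    · intro h hL
      obtain ⟨B⟩ := exists_basis L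
      refine pluckerCoord_ne_zero_of_mem_range_chart b hL B ?_
      simpa using h _ rfl B

/-- The source of the chart, with the Zariski topology. -/
def AffineChart (_ : Module.Basis (Fin d ⊕ Fin m) K W) : Type _ := Fin d × Fin m → K

instance : TopologicalSpace (AffineChart b) :=
  TopologicalSpace.induced (chart b) inferInstance

lemma isOpenEmbedding_chart :
    Topology.IsOpenEmbedding (fun x : AffineChart b => chart b x) :=
  ⟨⟨⟨rfl⟩, chart_injective b⟩, isOpen_range_chart b⟩

/-- The topology induced by the Plücker embedding is the affine Zariski topology: equations pull
back to polynomials, and polynomials homogenize. -/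
lemma isClosed_affineChart_iff {S : Set (AffineChart b)} :
    IsClosed S ↔ ∃ I : Ideal (MvPolynomial (Fin d × Fin m) K), S = MvPolynomial.zeroLocus K I := by
  constructor
  · intro hS
    obtain ⟨T, hT, rfl⟩ := isClosed_induced_iff.1 hS
    obtain ⟨F, hF, rfl⟩ := isClosed_iff.1 hT
    refine ⟨Ideal.span (pullback b '' F), ?_⟩
    rw [MvPolynomial.zeroLocus_span]
    ext x
    constructor
    · rintro hx _ ⟨f, hf, rfl⟩
      obtain ⟨D, hD⟩ := hF f hf
      exact (vanishesAt_chart_iff b x hD).1 (hx f hf)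
    · intro hx f hf
      obtain ⟨D, hD⟩ := hF f hf
      exact (vanishesAt_chart_iff b x hD).2 (hx _ ⟨f, hf, rfl⟩)
  · rintro ⟨I, rfl⟩
    choose D f hf hf' using fun p : MvPolynomial (Fin d × Fin m) K =>
      exists_isHomogeneous_eval_eq b p
    refine isClosed_induced_iff.2 ⟨Grassmannian.zeroLocus (f '' I), isClosed_iff.2 ⟨_, ?_, rfl⟩, ?_⟩
    · rintro _ ⟨p, -, rfl⟩
      exact ⟨_, hf p⟩
    · ext x
      constructor
      · intro hx p hp
        have := (vanishesAt_chart_iff b x (hf p)).1 (hx _ ⟨p, hp, rfl⟩)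
        exact (hf' p x).symm.trans ((eval_pullback b x (f p)).symm.trans this)
      · rintro hx _ ⟨p, hp, rfl⟩
        refine (vanishesAt_chart_iff b x (hf p)).2 ?_
        exact (eval_pullback b x (f p)).trans ((hf' p x).trans (hx p hp))

/-- The ideal of the polynomial functions on the chart that vanish on `S`. -/
def chartIdeal (S : Set (Grassmannian K W d)) : Ideal (MvPolynomial (Fin d × Fin m) K) :=
  MvPolynomial.vanishingIdeal K (chart b ⁻¹' S)

lemma mem_chartIdeal {S : Set (Grassmannian K W d)} {p : MvPolynomial (Fin d × Fin m) K} :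
    p ∈ chartIdeal b S ↔ ∀ x, chart b x ∈ S → eval x p = 0 := by
  rw [chartIdeal, mem_vanishingIdeal_iff]
  simp only [aeval_eq_eval, Set.mem_preimage]

lemma chartIdeal_anti {S T : Set (Grassmannian K W d)} (h : S ⊆ T) :
    chartIdeal b T ≤ chartIdeal b S :=
  vanishingIdeal_anti_mono (Set.preimage_mono h)

lemma mem_zeroLocus_chartIdeal {S : Set (Grassmannian K W d)} (hS : IsClosed S)
    (x : Fin d × Fin m → K) :
    x ∈ MvPolynomial.zeroLocus K (chartIdeal b S) ↔ chart b x ∈ S := by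
  constructor
  · intro hx
    have h1 : IsClosed ((fun x : AffineChart b => chart b x) ⁻¹' S) :=
      hS.preimage (isOpenEmbedding_chart b).continuous
    obtain ⟨I, hI⟩ := (isClosed_affineChart_iff b).1 h1
    have h2 : I ≤ chartIdeal b S := by
      rw [chartIdeal, ← le_zeroLocus_iff_le_vanishingIdeal]
      exact le_of_eq hI
    have h3 : x ∈ MvPolynomial.zeroLocus K I := zeroLocus_anti_mono h2 hx
    rw [← hI] at h3
    exact h3
  · intro hx p hp
    exact hp x hx

lemma isPrime_vanishingIdeal {Z : Set (AffineChart b)} (hZ : IsIrreducible Z) :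
    (MvPolynomial.vanishingIdeal K (K := K) (Z : Set (Fin d × Fin m → K))).IsPrime := by
  constructor
  · intro h
    obtain ⟨x, hx⟩ := hZ.nonempty
    have : (1 : MvPolynomial (Fin d × Fin m) K) ∈
        MvPolynomial.vanishingIdeal K (K := K) (Z : Set (Fin d × Fin m → K)) :=
      h ▸ Submodule.mem_top
    simpa using this x hx
  · intro f g hfg
    have := isPreirreducible_iff_isClosed_union_isClosed.1 hZ.2
      (MvPolynomial.zeroLocus K (Ideal.span {f}) : Set (Fin d × Fin m → K))
      (MvPolynomial.zeroLocus K (Ideal.span {g}) : Set (Fin d × Fin m → K))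
      ((isClosed_affineChart_iff b).2 ⟨_, rfl⟩) ((isClosed_affineChart_iff b).2 ⟨_, rfl⟩) (by
        intro x hx
        have h := hfg x hx
        rw [map_mul, mul_eq_zero] at h
        simp only [MvPolynomial.zeroLocus_span]
        exact h.imp (fun h q hq => by rw [Set.mem_singleton_iff.1 hq]; exact h)
          (fun h q hq => by rw [Set.mem_singleton_iff.1 hq]; exact h))
    simp only [MvPolynomial.zeroLocus_span] at this
    exact this.imp (fun h x hx => h hx f rfl) (fun h x hx => h hx g rfl)

variable [IsAlgClosed K]

lemma isIrreducible_zeroLocus (P : Ideal (MvPolynomial (Fin d × Fin m) K)) [hP : P.IsPrime] :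
    IsIrreducible (X := AffineChart b) (MvPolynomial.zeroLocus K P : Set (Fin d × Fin m → K)) := by
  have hPv := IsPrime.vanishingIdeal_zeroLocus (K := K) P
  constructor
  · by_contra h
    have h2 : (MvPolynomial.zeroLocus K P : Set (Fin d × Fin m → K)) = ∅ :=
      Set.not_nonempty_iff_eq_empty.1 h
    rw [h2, vanishingIdeal_empty] at hPv
    exact hP.ne_top hPv.symm
  · refine isPreirreducible_iff_isClosed_union_isClosed.2 fun z₁ z₂ h₁ h₂ hsub => ?_
    obtain ⟨I₁, rfl⟩ := (isClosed_affineChart_iff b).1 h₁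
    obtain ⟨I₂, rfl⟩ := (isClosed_affineChart_iff b).1 h₂
    by_contra! hcon
    obtain ⟨hn₁, hn₂⟩ := hcon
    have key : ∀ I : Ideal (MvPolynomial (Fin d × Fin m) K),
        ¬ (MvPolynomial.zeroLocus K P : Set (Fin d × Fin m → K)) ⊆ MvPolynomial.zeroLocus K I →
        ∃ f ∈ I, f ∉ P := by
      intro I hI
      by_contra! hc
      exact hI (zeroLocus_anti_mono hc)
    obtain ⟨f, hf, hfP⟩ := key I₁ hn₁
    obtain ⟨g, hg, hgP⟩ := key I₂ hn₂
    have : f * g ∈ P := by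
      rw [← hPv]
      intro x hx
      rw [map_mul]
      rcases hsub hx with h | h
      · rw [h f hf, zero_mul]
      · rw [h g hg, mul_zero]
    exact (hP.mem_or_mem this).elim hfP hgP

open TopologicalSpace

/-- Irreducible closed subsets of a chart correspond to prime ideals. -/
def irreducibleClosedsEquiv :
    IrreducibleCloseds (AffineChart b) ≃o (PrimeSpectrum (MvPolynomial (Fin d × Fin m) K))ᵒᵈ where
  toFun Z := OrderDual.toDual ⟨MvPolynomial.vanishingIdeal K (K := K) (Z : Set (AffineChart b)),
    isPrime_vanishingIdeal b Z.isIrreducible⟩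
  invFun P := ⟨(MvPolynomial.zeroLocus K (OrderDual.ofDual P).asIdeal : Set (Fin d × Fin m → K)),
    have := (OrderDual.ofDual P).isPrime
    isIrreducible_zeroLocus b _, (isClosed_affineChart_iff b).2 ⟨_, rfl⟩⟩
  left_inv Z := by
    apply IrreducibleCloseds.ext
    obtain ⟨I, hI⟩ := (isClosed_affineChart_iff b).1 Z.isClosed
    apply subset_antisymm
    · change (MvPolynomial.zeroLocus K (MvPolynomial.vanishingIdeal K (K := K)
        (Z : Set (AffineChart b))) : Set (Fin d × Fin m → K)) ⊆ (Z : Set (AffineChart b))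
      rw [hI]
      exact zeroLocus_anti_mono (le_vanishingIdeal_zeroLocus I)
    · exact zeroLocus_vanishingIdeal_le _
  right_inv P := by
    apply OrderDual.ofDual.injective
    apply PrimeSpectrum.ext
    have := (OrderDual.ofDual P).isPrime
    exact IsPrime.vanishingIdeal_zeroLocus _
  map_rel_iff' {A B} := by
    constructor
    · intro h
      obtain ⟨I, hI⟩ := (isClosed_affineChart_iff b).1 B.isClosed
      have h1 : MvPolynomial.vanishingIdeal K (K := K) (B : Set (AffineChart b)) ≤
        MvPolynomial.vanishingIdeal K (K := K) (A : Set (AffineChart b)) := h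
      have h2 : I ≤ MvPolynomial.vanishingIdeal K (K := K) (A : Set (AffineChart b)) := by
        refine le_trans ?_ h1
        rw [hI]
        exact le_vanishingIdeal_zeroLocus I
      intro x hx
      have : x ∈ (B : Set (AffineChart b)) := by
        rw [hI]
        exact le_zeroLocus_iff_le_vanishingIdeal.2 h2 hx
      exact this
    · intro h
      exact vanishingIdeal_anti_mono h

/-- The trace on a chart of an irreducible closed set. -/
def chartRestrict (Z : IrreducibleCloseds (Grassmannian K W d))
    (hZ : (chart b ⁻¹' (Z : Set (Grassmannian K W d))).Nonempty) :
    IrreducibleCloseds (AffineChart b) :=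
  ⟨chart b ⁻¹' (Z : Set (Grassmannian K W d)),
    ⟨hZ, Z.isIrreducible.2.preimage (isOpenEmbedding_chart b)⟩,
    Z.isClosed.preimage (isOpenEmbedding_chart b).continuous⟩

lemma map_chartRestrict (Z : IrreducibleCloseds (Grassmannian K W d))
    (hZ : (chart b ⁻¹' (Z : Set (Grassmannian K W d))).Nonempty) :
    IrreducibleCloseds.map _ (isOpenEmbedding_chart b).continuous
      (chartRestrict b Z hZ) = Z :=
  IrreducibleCloseds.ext (closure_image_preimage_of_isPreirreducible _
    (isOpenEmbedding_chart b).isOpenMap (Z : Set (Grassmannian K W d)) hZ Z.isIrreducible.2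
    Z.isClosed)

lemma isPrime_chartIdeal {S : Set (Grassmannian K W d)} (hS : IsIrreducible S)
    (hne : (chart b ⁻¹' S).Nonempty) : (chartIdeal b S).IsPrime :=
  isPrime_vanishingIdeal b ⟨hne, hS.2.preimage (isOpenEmbedding_chart b)⟩

/-- Coheight only involves irreducible closed sets containing Z. They all meet the open chart, where
inclusion is reversed inclusion of primes. -/
lemma coheight_eq_height_chartIdeal (Z : IrreducibleCloseds (Grassmannian K W d))
    (hZ : (chart b ⁻¹' (Z : Set (Grassmannian K W d))).Nonempty) :
    Order.coheight Z = (chartIdeal b (Z : Set (Grassmannian K W d))).height := by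
  conv_lhs => rw [← map_chartRestrict b Z hZ]
  rw [(isOpenEmbedding_chart b).coheight_map,
    ← Order.coheight_orderIso (irreducibleClosedsEquiv b)]
  exact (PrimeSpectrum.height_eq_orderHeight
    ⟨chartIdeal b (Z : Set (Grassmannian K W d)), isPrime_chartIdeal b Z.isIrreducible hZ⟩).symm

/-- Chains below the trace of Z on the chart remain chains after taking closures, so the height can
only grow; this gives one half of the dimension formula. -/
lemma le_height_add_height_chartIdeal (Z : IrreducibleCloseds (Grassmannian K W d))
    (hZ : (chart b ⁻¹' (Z : Set (Grassmannian K W d))).Nonempty) :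
    ((d * m : ℕ) : ℕ∞) ≤
      Order.height Z + (chartIdeal b (Z : Set (Grassmannian K W d))).height := by
  let P : PrimeSpectrum (MvPolynomial (Fin d × Fin m) K) :=
    ⟨chartIdeal b (Z : Set (Grassmannian K W d)), isPrime_chartIdeal b Z.isIrreducible hZ⟩
  have h1 : Order.height P + Order.coheight P = _ := height_add_coheight P
  rw [Fintype.card_prod, Fintype.card_fin, Fintype.card_fin] at h1
  rw [← h1, add_comm, show (chartIdeal b (Z : Set (Grassmannian K W d))).height = Order.height P from
    PrimeSpectrum.height_eq_orderHeight P]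
  refine add_le_add_left ?_ _
  have h2 : Order.height (chartRestrict b Z hZ) = Order.coheight P := by
    rw [← Order.height_orderIso (irreducibleClosedsEquiv b)]
    rfl
  rw [← h2]
  conv_rhs => rw [← map_chartRestrict b Z hZ]
  exact Order.height_le_height_apply_of_strictMono _
    (IrreducibleCloseds.map_strictMono_of_isInducing (isOpenEmbedding_chart b).isInducing) _

/-- Every point lies in a chart; it can even be taken as the origin of the chart, with a prescribed
basis as the frame. -/
lemma exists_basis_chart (hW : Module.finrank K W = d + m) (L : Grassmannian K W d)
    (B : Module.Basis (Fin d) K L.space) :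
    ∃ b : Module.Basis (Fin d ⊕ Fin m) K W, (∀ j, b (Sum.inl j) = B j) ∧ chart b 0 = L := by
  obtain ⟨H, hH⟩ := L.space.exists_isCompl
  have hr : Module.finrank K H = m := by
    have := Submodule.finrank_add_eq_of_isCompl hH
    rw [L.finrank_space, hW] at this
    omega
  let B' := Module.finBasisOfFinrankEq K H hr
  let b := (B.prod B').map (Submodule.prodEquivOfIsCompl _ _ hH)
  have hb : ∀ j, b (Sum.inl j) = B j := by
    intro j; simp [b]
  refine ⟨b, hb, ?_⟩
  apply Grassmannian.ext
  refine Submodule.eq_of_le_of_finrank_eq ?_ ?_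
  · refine Submodule.span_le.2 ?_
    rintro _ ⟨j, rfl⟩
    simp [frame, hb]
  · rw [(chart b 0).finrank_space, L.finrank_space]

lemma coheight_le (hW : Module.finrank K W = d + m) (Z : IrreducibleCloseds (Grassmannian K W d)) :
    Order.coheight Z ≤ (d * m : ℕ) := by
  obtain ⟨L, hL⟩ := Z.isIrreducible.nonempty
  obtain ⟨B⟩ := exists_basis L
  obtain ⟨b, -, hb⟩ := exists_basis_chart hW L B
  have hZ : (chart b ⁻¹' (Z : Set (Grassmannian K W d))).Nonempty := ⟨0, by
    rw [Set.mem_preimage, hb]; exact hL⟩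
  rw [coheight_eq_height_chartIdeal b Z hZ]
  have := isPrime_chartIdeal b Z.isIrreducible hZ
  have h := Ideal.height_le_ringKrullDim_of_isPrime (I := chartIdeal b (Z : Set (Grassmannian K W d)))
  rw [ringKrullDim_of_isNoetherianRing, ringKrullDim_eq_zero_of_field, zero_add,
    Nat.card_eq_fintype_card, Fintype.card_prod, Fintype.card_fin, Fintype.card_fin] at h
  exact_mod_cast h

/-- The dimension formula: the codimension of an irreducible closed subset of the Grassmannian is
the height of its ideal in any chart which meets it. -/
theorem topologicalKrullDim_add_height_chartIdeal (hW : Module.finrank K W = d + m)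
    {S : Set (Grassmannian K W d)} (hc : IsClosed S) (hi : IsIrreducible S)
    (hne : (chart b ⁻¹' S).Nonempty) :
    topologicalKrullDim S + ((chartIdeal b S).height : WithBot ℕ∞) = (d * m : ℕ) := by
  let Z : IrreducibleCloseds (Grassmannian K W d) := ⟨S, hi, hc⟩
  have h1 : topologicalKrullDim S = Order.height Z := topologicalKrullDim_eq_height Z
  have h2 := coheight_eq_height_chartIdeal b Z hne
  have h3 := le_height_add_height_chartIdeal b Z hne
  have : Nonempty (IrreducibleCloseds (Grassmannian K W d)) := ⟨Z⟩
  -- The whole Grassmannian has dimension at most dm, since the Krull dimension is the supremum of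
  -- the coheights, each a height in some chart.
  have h4 : Order.height Z + Order.coheight Z ≤ (d * m : ℕ) := by
    have h5 : Order.krullDim (IrreducibleCloseds (Grassmannian K W d)) ≤
        ((d * m : ℕ) : WithBot ℕ∞) := by
      rw [Order.krullDim_eq_iSup_coheight]
      exact iSup_le fun V => by exact_mod_cast coheight_le hW V
    rw [Order.krullDim_eq_iSup_height_add_coheight_of_nonempty] at h5
    have h6 := le_iSup (fun a : IrreducibleCloseds (Grassmannian K W d) =>
      Order.height a + Order.coheight a) Z
    rw [← WithBot.coe_le_coe] at h6
    exact_mod_cast h6.trans h5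
  rw [h1]
  have : Order.height Z + (chartIdeal b S).height = (d * m : ℕ) := le_antisymm (h2 ▸ h4) h3
  exact_mod_cast congrArg (WithBot.some) this

end Chart

end Grassmannian

/-! ### Directional derivatives via dual numbers. -/

section DualNumbers

open TrivSqZeroExt

variable {K σ : Type*} [Field K]

/-- The point `p + ε q` over the dual numbers. -/
def dualPoint (p q : σ → K) (s : σ) : DualNumber K := inl (p s) + inr (q s)

lemma fst_aeval_dualPoint (p q : σ → K) (F : MvPolynomial σ K) :
    (aeval (dualPoint p q) F).fst = eval p F := by
  induction F using MvPolynomial.induction_on with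
  | C a => simp [algebraMap_eq_inl]
  | add F G hF hG => simp [hF, hG]
  | mul_X F s hF => simp [hF, dualPoint]

lemma snd_aeval_dualPoint_of_support (p q : σ → K) (T : Finset σ) (hT : ∀ s, s ∉ T → q s = 0)
    (F : MvPolynomial σ K) :
    (aeval (dualPoint p q) F).snd = ∑ s ∈ T, eval p (pderiv s F) * q s := by
  classical
  induction F using MvPolynomial.induction_on with
  | C a => simp [algebraMap_eq_inl]
  | add F G hF hG => simp [hF, hG, add_mul, Finset.sum_add_distrib]
  | mul_X F s hF =>
    have h1 : ∑ t ∈ T, eval p (pderiv t (X s : MvPolynomial σ K)) * q t = q s := by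
      simp only [pderiv_X, Pi.single_apply]
      by_cases hs : s ∈ T
      · rw [Finset.sum_eq_single s]
        · simp
        · intro t _ ht
          simp [ht.symm]
        · exact fun h => absurd hs h
      · rw [hT s hs]
        refine Finset.sum_eq_zero fun t ht => ?_
        have : s ≠ t := fun h => hs (h ▸ ht)
        simp [this]
    rw [map_mul, snd_mul, fst_aeval_dualPoint, hF, aeval_X]
    simp only [Derivation.leibniz, smul_eq_mul, map_add, map_mul, eval_X, add_mul,
      Finset.sum_add_distrib, mul_assoc, ← Finset.mul_sum, h1]
    simp [dualPoint, mul_comm]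

lemma snd_aeval_dualPoint (p q : σ → K) (F : MvPolynomial σ K) :
    (aeval (dualPoint p q) F).snd = ∑ s ∈ F.vars, eval p (pderiv s F) * q s := by
  classical
  let q' : σ → K := fun s => if s ∈ F.vars then q s else 0
  have h1 : aeval (dualPoint p q) F = aeval (dualPoint p q') F := by
    refine eval₂Hom_congr' rfl (fun s hs _ => ?_) rfl
    simp [dualPoint, q', hs]
  rw [h1, snd_aeval_dualPoint_of_support p q' F.vars (fun s hs => by simp [q', hs])]
  exact Finset.sum_congr rfl fun s hs => by simp [q', hs]

lemma aeval_mul_of_isHomogeneous {R : Type*} [CommRing R] [Algebra K R] {f : MvPolynomial σ K}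
    {m : ℕ} (hf : f.IsHomogeneous m) (t : R) (x : σ → R) :
    aeval (fun i => t * x i) f = t ^ m * aeval x f := by
  rw [aeval_def, aeval_def, eval₂_eq, eval₂_eq, Finset.mul_sum]
  refine Finset.sum_congr rfl fun s hs => ?_
  have hm : s.degree = m := by
    by_contra hne
    exact mem_support_iff.1 hs (hf.coeff_eq_zero hne)
  have hm' : ∑ i ∈ s.support, s i = m := hm
  simp only [mul_pow, Finset.prod_mul_distrib, Finset.prod_pow_eq_pow_sum]
  rw [hm']
  ring

lemma snd_prod_dual {ι : Type*} [DecidableEq ι] (s : Finset ι) (x : ι → DualNumber K) :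
    (∏ i ∈ s, x i).snd = ∑ i ∈ s, (∏ j ∈ s.erase i, (x j).fst) * (x i).snd := by
  induction s using Finset.induction_on with
  | empty => simp
  | insert a s ha ih =>
    rw [Finset.prod_insert ha, Finset.sum_insert ha, Finset.erase_insert ha, snd_mul, ih]
    have h1 : (∏ i ∈ s, x i).fst = ∏ i ∈ s, (x i).fst := map_prod (fstHom K K K) x s
    simp only [smul_eq_mul, MulOpposite.smul_eq_mul_unop, MulOpposite.unop_op, h1]
    rw [add_comm, Finset.mul_sum]
    refine congrArg₂ _ (mul_comm _ _) (Finset.sum_congr rfl fun i hi => ?_)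
    have hia : a ≠ i := fun h => ha (h ▸ hi)
    rw [Finset.erase_insert_of_ne hia, Finset.prod_insert (by simp [ha]), mul_assoc]

lemma fst_det_dual {n : Type*} [Fintype n] [DecidableEq n] (A : Matrix n n (DualNumber K)) :
    A.det.fst = (A.map fst).det :=
  RingHom.map_det (fstHom K K K : DualNumber K →+* K) A

lemma snd_det_dual {n : Type*} [Fintype n] [DecidableEq n] (A : Matrix n n (DualNumber K)) :
    A.det.snd = ∑ j, ((A.map fst).updateCol j fun i => (A i j).snd).det := by
  simp only [Matrix.det_apply, snd_sum]
  rw [Finset.sum_comm]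
  refine Finset.sum_congr rfl fun τ _ => ?_
  rw [← Finset.smul_sum]
  have : (Equiv.Perm.sign τ • ∏ i, A (τ i) i).snd = Equiv.Perm.sign τ • (∏ i, A (τ i) i).snd := rfl
  rw [this, snd_prod_dual]
  congr 1
  refine Finset.sum_congr rfl fun j _ => ?_
  rw [← Finset.mul_prod_erase Finset.univ _ (Finset.mem_univ j), mul_comm]
  congr 1
  · simp
  · refine Finset.prod_congr rfl fun i hi => ?_
    simp [Finset.ne_of_mem_erase hi]

end DualNumbers

/-! ### Differentials of Plücker equations. -/

namespace Grassmannian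

section Tangent

open TrivSqZeroExt

variable {K W : Type*} [Field K] [AddCommGroup W] [Module K W] [FiniteDimensional K W]
  {d m : ℕ}

lemma pluckerCoord_update (A : Fin d → W) (j : Fin d) (z : W) (φ : Fin d → Module.Dual K W) :
    pluckerCoord (Function.update A j z) φ =
      ((Matrix.of fun i k => φ i (A k)).updateCol j fun i => φ i z).det := by
  unfold pluckerCoord
  congr 1
  ext i k
  by_cases hk : k = j
  · subst hk; simp
  · simp [hk]

/-- The Plücker coordinates of the tuple A + εM: differentiating a determinant column by column
gives `pluckerDeriv`. -/
lemma dualPoint_pluckerCoord (A M : Fin d → W) (φ : Fin d → Module.Dual K W) :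
    dualPoint (pluckerCoord A) (pluckerDeriv A M) φ =
      Matrix.det (Matrix.of fun i j => (inl (φ i (A j)) + inr (φ i (M j)) : DualNumber K)) := by
  apply TrivSqZeroExt.ext
  · rw [fst_det_dual, dualPoint, fst_add, fst_inl, fst_inr, add_zero, pluckerCoord]
    congr 1
    ext i j
    simp
  · rw [snd_det_dual, dualPoint, snd_add, snd_inl, snd_inr, zero_add, pluckerDeriv]
    refine Finset.sum_congr rfl fun j _ => ?_
    rw [pluckerCoord_update]
    congr 1
    ext i k
    simp [Matrix.updateCol_apply]

lemma differential_eq_snd (f : MvPolynomial (Fin d → Module.Dual K W) K) (A M : Fin d → W) :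
    differential f A M =
      (aeval (dualPoint (pluckerCoord A) (pluckerDeriv A M)) f).snd :=
  (snd_aeval_dualPoint _ _ f).symm

/-- Over the dual numbers A' + εM' = (A + εM)(g + εc), so the Plücker coordinates are multiplied by
det(g + εc) and f by a power of it. This makes tangency independent of the basis of L and of the
lifts to W. -/
lemma differential_eq_zero_of_change {f : MvPolynomial (Fin d → Module.Dual K W) K} {D : ℕ}
    (hf : f.IsHomogeneous D) {A M A' M' : Fin d → W} (g c : Fin d → Fin d → K)
    (hA : ∀ j, A' j = ∑ k, g k j • A k)
    (hM : ∀ j, M' j = ∑ k, g k j • M k + ∑ k, c k j • A k)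
    (h0 : eval (pluckerCoord A) f = 0) (h : differential f A M = 0) :
    differential f A' M' = 0 := by
  rw [differential_eq_snd] at h ⊢
  have h1 : aeval (dualPoint (pluckerCoord A) (pluckerDeriv A M)) f = 0 := by
    apply TrivSqZeroExt.ext
    · rw [fst_aeval_dualPoint, h0, fst_zero]
    · rw [h, snd_zero]
  have h2 : dualPoint (pluckerCoord A') (pluckerDeriv A' M') = fun φ =>
      Matrix.det (Matrix.of fun i j => (inl (g i j) + inr (c i j) : DualNumber K)) *
        dualPoint (pluckerCoord A) (pluckerDeriv A M) φ := by
    ext1 φ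
    rw [dualPoint_pluckerCoord, dualPoint_pluckerCoord, mul_comm, ← Matrix.det_mul]
    congr 1
    ext i j
    · simp [Matrix.mul_apply, hA, mul_comm, fst_sum]
    · simp [Matrix.mul_apply, hM, snd_sum, Finset.sum_add_distrib, mul_comm, add_comm]
  rw [h2, aeval_mul_of_isHomogeneous hf, h1, mul_zero, snd_zero]

variable (b : Module.Basis (Fin d ⊕ Fin m) K W) (x : Fin d × Fin m → K)

/-- Both sides are the ε-part of f at the frame with coordinates x + εv. -/
lemma differential_frame (f : MvPolynomial (Fin d → Module.Dual K W) K) (v : Fin d × Fin m → K) :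
    differential f (frame b x) (fun j => ∑ i, v (j, i) • b (Sum.inr i)) =
      ∑ k, gradient x (pullback b f) k * v k := by
  have h1 : ∑ k, gradient x (pullback b f) k * v k =
      (aeval (dualPoint x v) (pullback b f)).snd :=
    (snd_aeval_dualPoint_of_support x v Finset.univ (by simp) _).symm
  rw [h1, differential_eq_snd, pullback]
  have h2 : aeval (dualPoint x v) (aeval (pluckerPoly (framePoly K d m) b) f) =
      aeval (fun φ => aeval (dualPoint x v) (pluckerPoly (framePoly K d m) b φ)) f := by
    rw [← AlgHom.comp_apply, comp_aeval]
  rw [h2]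
  congr 3
  ext1 φ
  rw [dualPoint_pluckerCoord, pluckerPoly, AlgHom.map_det]
  congr 1
  ext1 i j
  rw [AlgHom.mapMatrix_apply, Matrix.map_apply, Matrix.of_apply, Matrix.of_apply]
  simp only [framePoly, Fintype.sum_sum_type, Sum.elim_inl, Sum.elim_inr, map_add, map_sum, map_mul,
    aeval_X, algHom_C, ite_mul, one_mul, zero_mul, Finset.sum_ite_eq', Finset.mem_univ, if_true,
    frame, map_smul]
  apply TrivSqZeroExt.ext <;>
    simp [dualPoint, algebraMap_eq_inl, fst_sum, snd_sum, mul_comm]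

end Tangent

end Grassmannian

/-! ### Tangent and conormal spaces and regular points in a chart. -/

namespace Grassmannian

section TangentChart

variable {K W : Type*} [Field K] [AddCommGroup W] [Module K W] [FiniteDimensional K W]
  {d m : ℕ} (b : Module.Basis (Fin d ⊕ Fin m) K W) (x : Fin d × Fin m → K)

lemma linearIndependent_mkQ_inr :
    LinearIndependent K fun i => (chart b x).space.mkQ (b (Sum.inr i)) := by
  rw [Fintype.linearIndependent_iff]
  intro a ha i
  have h1 : ∑ i, a i • b (Sum.inr i) ∈ (chart b x).space := by
    rw [← Submodule.ker_mkQ (chart b x).space, LinearMap.mem_ker, map_sum]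
    simpa only [map_smul] using ha
  obtain ⟨c, hc⟩ := (Submodule.mem_span_range_iff_exists_fun K).1 h1
  have h2 : ∀ j, c j = 0 := by
    intro j
    have := congrArg (b.coord (Sum.inl j)) hc
    simp only [map_sum, map_smul, coord_inl_frame] at this
    simpa using this
  simp only [h2, zero_smul, Finset.sum_const_zero] at hc
  have := congrArg (b.coord (Sum.inr i)) hc.symm
  simpa [Finsupp.single_apply] using this

lemma span_mkQ_inr :
    ⊤ ≤ Submodule.span K (Set.range fun i => (chart b x).space.mkQ (b (Sum.inr i))) := by
  rintro w -
  obtain ⟨w, rfl⟩ := (chart b x).space.mkQ_surjective w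
  have hr : ∀ i, (chart b x).space.mkQ (b (Sum.inr i)) ∈
      Submodule.span K (Set.range fun i => (chart b x).space.mkQ (b (Sum.inr i))) :=
    fun i => Submodule.subset_span ⟨i, rfl⟩
  rw [← b.sum_repr w, map_sum]
  refine Submodule.sum_mem _ fun k _ => ?_
  rw [map_smul]
  refine Submodule.smul_mem _ _ ?_
  rcases k with j | i
  · have h1 : (chart b x).space.mkQ (frame b x j) = 0 := by
      rw [← LinearMap.mem_ker, Submodule.ker_mkQ]
      exact Submodule.subset_span ⟨j, rfl⟩
    have h2 : b (Sum.inl j) = frame b x j - ∑ i, x (j, i) • b (Sum.inr i) := by simp [frame]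
    rw [h2, map_sub, h1, zero_sub, map_sum]
    refine Submodule.neg_mem _ (Submodule.sum_mem _ fun i _ => ?_)
    rw [map_smul]
    exact Submodule.smul_mem _ _ (hr i)
  · exact hr i

/-- The basis of the quotient of `W` by a point of a chart. -/
def quotBasis : Module.Basis (Fin m) K (W ⧸ (chart b x).space) :=
  Module.Basis.mk (linearIndependent_mkQ_inr b x) (span_mkQ_inr b x)

lemma quotBasis_apply (i : Fin m) : quotBasis b x i = (chart b x).space.mkQ (b (Sum.inr i)) :=
  Module.Basis.mk_apply _ _ i

/-- The coordinates of tangent vectors of the Grassmannian in a chart. -/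
def tangentEquiv : ((chart b x).space →ₗ[K] W ⧸ (chart b x).space) ≃ₗ[K] (Fin d × Fin m → K) :=
  (LinearMap.toMatrix (chartBasis b x) (quotBasis b x)).trans
    ((Matrix.transposeLinearEquiv (Fin m) (Fin d) K K).trans
      (LinearEquiv.curry K K (Fin d) (Fin m)).symm)

/-- The coordinates of cotangent vectors of the Grassmannian in a chart. -/
def conormalEquiv : ((W ⧸ (chart b x).space) →ₗ[K] (chart b x).space) ≃ₗ[K] (Fin d × Fin m → K) :=
  (LinearMap.toMatrix (quotBasis b x) (chartBasis b x)).trans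
    (LinearEquiv.curry K K (Fin d) (Fin m)).symm

lemma tangentEquiv_apply (ψ) (j : Fin d) (i : Fin m) :
    tangentEquiv b x ψ (j, i) = LinearMap.toMatrix (chartBasis b x) (quotBasis b x) ψ i j := rfl

lemma conormalEquiv_apply (η) (j : Fin d) (i : Fin m) :
    conormalEquiv b x η (j, i) = LinearMap.toMatrix (quotBasis b x) (chartBasis b x) η j i := rfl

lemma apply_chartBasis (ψ : (chart b x).space →ₗ[K] W ⧸ (chart b x).space) (j : Fin d) :
    ψ (chartBasis b x j) =
      (chart b x).space.mkQ (∑ i, tangentEquiv b x ψ (j, i) • b (Sum.inr i)) := by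
  rw [← (quotBasis b x).sum_repr (ψ (chartBasis b x j)), map_sum]
  refine Finset.sum_congr rfl fun i _ => ?_
  rw [map_smul, quotBasis_apply, tangentEquiv_apply, LinearMap.toMatrix_apply]

/-- The transpose built into `tangentEquiv` is what turns the trace pairing into the standard dot
product. -/
lemma trace_comp_eq_sum (η ψ) :
    LinearMap.trace K (chart b x).space (η ∘ₗ ψ) =
      ∑ k, conormalEquiv b x η k * tangentEquiv b x ψ k := by
  rw [LinearMap.trace_eq_matrix_trace K (chartBasis b x),
    LinearMap.toMatrix_comp _ (quotBasis b x), Fintype.sum_prod_type]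
  rfl

variable [IsAlgClosed K]

lemma mem_tangentSpace_chart {S : Set (Grassmannian K W d)} (hx : chart b x ∈ S) (ψ) :
    ψ ∈ tangentSpace S (chart b x) ↔
      ∀ p ∈ chartIdeal b S, ∑ k, gradient x p k * tangentEquiv b x ψ k = 0 := by
  constructor
  · intro h p hp
    obtain ⟨M, hM, hf⟩ := h (chartBasis b x)
    simp only [coe_chartBasis] at hf
    obtain ⟨D, f, hD, hfp⟩ := exists_isHomogeneous_eval_eq b p
    -- The extra factor is 1 on the chart and 0 off it, so the homogenized equation vanishes on all
    -- of S.
    have hpb : pullback b (f * X (chartForms b)) = p := by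
      refine MvPolynomial.funext fun y => ?_
      rw [eval_pullback, map_mul, hfp, eval_X, pluckerCoord_frame_chartForms, mul_one]
    have hhom : (f * X (chartForms b)).IsHomogeneous (D + 1) := hD.mul (isHomogeneous_X _ _)
    have h1 := hf _ _ hhom (by
      intro L hL
      by_cases hr : L ∈ Set.range (chart b)
      · obtain ⟨y, rfl⟩ := hr
        rw [vanishesAt_chart_iff b y hhom, hpb]
        exact (mem_chartIdeal b).1 hp y hL
      · intro B
        rw [map_mul, eval_X]
        by_contra hne
        exact hr (mem_range_chart b B (right_ne_zero_of_mul hne)))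
    -- Two lifts of the same tangent vector differ by vectors of L, which do not affect tangency.
    have h2 : ∀ j, ∃ c : Fin d → K, (∑ i, tangentEquiv b x ψ (j, i) • b (Sum.inr i)) =
        M j + ∑ k, c k • frame b x k := by
      intro j
      have h3 : (∑ i, tangentEquiv b x ψ (j, i) • b (Sum.inr i)) - M j ∈ (chart b x).space := by
        refine (Submodule.Quotient.mk_eq_zero _).1 ?_
        change (chart b x).space.mkQ _ = 0
        rw [map_sub, ← hM, ← apply_chartBasis, sub_self]
      obtain ⟨c, hc⟩ := (Submodule.mem_span_range_iff_exists_fun K).1 h3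
      exact ⟨c, by rw [hc]; abel⟩
    choose c hc using h2
    rw [← hpb, ← differential_frame]
    refine differential_eq_zero_of_change hhom (fun k j => if k = j then 1 else 0)
      (fun k j => c j k) (A := frame b x) (M := M) (by simp) (fun j => ?_) ?_ h1
    · rw [hc]
      simp
    · rw [← eval_pullback, hpb]
      exact (mem_chartIdeal b).1 hp x hx
  · intro h B
    have hB : ∀ j, ∃ g : Fin d → K, (B j : W) = ∑ k, g k • frame b x k := by
      intro j
      obtain ⟨c, hc⟩ := (Submodule.mem_span_range_iff_exists_fun K).1 (B j).2
      exact ⟨c, hc.symm⟩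
    choose g hg using hB
    refine ⟨fun j => ∑ k, g j k • ∑ i, tangentEquiv b x ψ (k, i) • b (Sum.inr i), ?_, ?_⟩
    · intro j
      have h1 : B j = ∑ k, g j k • chartBasis b x k := by
        apply Subtype.ext
        simp [hg]
      rw [h1, map_sum, map_sum]
      refine Finset.sum_congr rfl fun k _ => ?_
      rw [map_smul, map_smul, apply_chartBasis]
    · intro f D hD hv
      have hp : pullback b f ∈ chartIdeal b S :=
        (mem_chartIdeal b).2 fun y hy => (vanishesAt_chart_iff b y hD).1 (hv _ hy)
      refine differential_eq_zero_of_change hD (fun k j => g j k) (fun _ _ => 0)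
        (A := frame b x) (M := fun k => ∑ i, tangentEquiv b x ψ (k, i) • b (Sum.inr i))
        hg (by simp) ?_ ?_
      · rw [← eval_pullback]
        exact (mem_chartIdeal b).1 hp x hx
      · rw [differential_frame]
        exact h _ hp

/-- The space of the differentials at `x` of the polynomial functions vanishing on `S`. -/
def gradientSpace (S : Set (Grassmannian K W d)) : Submodule K (Fin d × Fin m → K) where
  carrier := gradient x '' (chartIdeal b S)
  zero_mem' := ⟨0, zero_mem _, by ext; simp⟩
  add_mem' := by
    rintro _ _ ⟨p, hp, rfl⟩ ⟨q, hq, rfl⟩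
    exact ⟨p + q, add_mem hp hq, gradient_add x p q⟩
  smul_mem' := by
    rintro a _ ⟨p, hp, rfl⟩
    exact ⟨C a * p, Ideal.mul_mem_left _ _ hp, gradient_C_mul x a p⟩

/-- The standard symmetric bilinear form. -/
def stdForm (K ι : Type*) [Field K] [Fintype ι] [DecidableEq ι] : LinearMap.BilinForm K (ι → K) :=
  Matrix.toBilin' 1

lemma stdForm_apply {ι : Type*} [Fintype ι] [DecidableEq ι] (v w : ι → K) :
    stdForm K ι v w = ∑ k, v k * w k := by
  rw [stdForm, Matrix.toBilin'_apply']
  simp [dotProduct]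

lemma stdForm_isRefl (ι : Type*) [Fintype ι] [DecidableEq ι] : (stdForm K ι).IsRefl := by
  intro v w h
  rw [stdForm_apply] at h ⊢
  rw [← h]
  exact Finset.sum_congr rfl fun k _ => mul_comm _ _

lemma stdForm_nondegenerate (ι : Type*) [Fintype ι] [DecidableEq ι] :
    (stdForm K ι).Nondegenerate := by
  apply Matrix.Nondegenerate.toBilin'
  exact Matrix.nondegenerate_of_det_ne_zero (by simp)

lemma map_tangentSpace {S : Set (Grassmannian K W d)} (hx : chart b x ∈ S) :
    (tangentSpace S (chart b x)).map (tangentEquiv b x).toLinearMap =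
      (stdForm K _).orthogonal (gradientSpace b x S) := by
  ext v
  obtain ⟨ψ, rfl⟩ := (tangentEquiv b x).surjective v
  have h1 : tangentEquiv b x ψ ∈ (tangentSpace S (chart b x)).map (tangentEquiv b x).toLinearMap ↔
      ψ ∈ tangentSpace S (chart b x) :=
    ⟨fun ⟨ψ', h, h'⟩ => (tangentEquiv b x).injective h' ▸ h, fun h => ⟨ψ, h, rfl⟩⟩
  rw [h1, mem_tangentSpace_chart b x hx, LinearMap.BilinForm.mem_orthogonal_iff]
  constructor
  · rintro h _ ⟨p, hp, rfl⟩
    rw [stdForm_apply]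
    exact h p hp
  · intro h p hp
    have := h _ ⟨p, hp, rfl⟩
    rwa [stdForm_apply] at this

/-- The tangent space is the orthogonal complement of the gradients, so its annihilator is their
double orthogonal. -/
lemma mem_conormalSpace_chart {S : Set (Grassmannian K W d)} (hx : chart b x ∈ S) (η) :
    η ∈ conormalSpace S (chart b x) ↔ conormalEquiv b x η ∈ gradientSpace b x S := by
  rw [← LinearMap.BilinForm.orthogonal_orthogonal (stdForm_nondegenerate _) (stdForm_isRefl _)
    (gradientSpace b x S), ← map_tangentSpace b x hx, LinearMap.BilinForm.mem_orthogonal_iff]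
  change (∀ ψ ∈ tangentSpace S (chart b x), LinearMap.trace K (chart b x).space (η ∘ₗ ψ) = 0) ↔ _
  constructor
  · rintro h _ ⟨ψ, hψ, rfl⟩
    refine stdForm_isRefl _ _ _ ?_
    rw [stdForm_apply]
    exact (trace_comp_eq_sum b x η ψ).symm.trans (h ψ hψ)
  · intro h ψ hψ
    have := stdForm_isRefl _ _ _ (h _ ⟨ψ, hψ, rfl⟩)
    rw [stdForm_apply] at this
    exact (trace_comp_eq_sum b x η ψ).trans this

lemma finrank_tangentSpace_add {S : Set (Grassmannian K W d)} (hx : chart b x ∈ S) :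
    Module.finrank K (tangentSpace S (chart b x)) + Module.finrank K (gradientSpace b x S) =
      d * m := by
  have h1 : Module.finrank K (tangentSpace S (chart b x)) =
      Module.finrank K ((stdForm K _).orthogonal (gradientSpace b x S)) := by
    rw [← map_tangentSpace b x hx]
    exact (LinearEquiv.finrank_map_eq (tangentEquiv b x) _).symm
  have h2 := LinearMap.BilinForm.finrank_orthogonal (stdForm_nondegenerate _)
    (gradientSpace b x S)
  have h3 := (gradientSpace b x S).finrank_le
  rw [Module.finrank_fintype_fun_eq_card, Fintype.card_prod, Fintype.card_fin,
    Fintype.card_fin] at h2 h3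
  omega

/-- Two complementary counts of dm: tangent space plus gradients, and dimension plus height. -/
lemma mem_regularLocus_chart (hW : Module.finrank K W = d + m) {S : Set (Grassmannian K W d)}
    (hc : IsClosed S) (hi : IsIrreducible S) (hx : chart b x ∈ S) :
    chart b x ∈ regularLocus S ↔
      (Module.finrank K (gradientSpace b x S) : ℕ∞) = (chartIdeal b S).height := by
  have h1 := finrank_tangentSpace_add b x hx
  have h2 := topologicalKrullDim_add_height_chartIdeal b hW hc hi ⟨x, hx⟩
  have h0 : chart b x ∈ regularLocus S ↔
      ((Module.finrank K (tangentSpace S (chart b x)) : ℕ) : WithBot ℕ∞) =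
        topologicalKrullDim S := ⟨fun h => h.2, fun h => ⟨hx, h⟩⟩
  rw [h0, ← h1, Nat.cast_add] at *
  generalize Module.finrank K (tangentSpace S (chart b x)) = t at *
  generalize Module.finrank K (gradientSpace b x S) = g at *
  generalize (chartIdeal b S).height = e at *
  generalize topologicalKrullDim S = D at *
  induction D with
  | bot =>
    rw [WithBot.bot_add] at h2
    exact absurd h2 (by norm_cast)
  | coe D =>
    have h3 : D + e = t + g := by exact_mod_cast h2
    have h4 : ((t : WithBot ℕ∞) = (D : WithBot ℕ∞)) ↔ (t : ℕ∞) = D := by norm_cast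
    rw [h4]
    have hD : D ≠ ⊤ := by rintro rfl; rw [top_add] at h3; exact ENat.natCast_ne_top (t + g) (by exact_mod_cast h3.symm)
    have he : e ≠ ⊤ := by rintro rfl; rw [add_top] at h3; exact ENat.natCast_ne_top (t + g) (by exact_mod_cast h3.symm)
    lift D to ℕ using hD
    lift e to ℕ using he
    norm_cast at *
    omega

end TangentChart

end Grassmannian

/-! ### Equations of the Grassmann secant variety. -/

section VanishesOnSpans

variable {K ι : Type*} [Field K]

/-- The polynomial `F` vanishes at all `c`-tuples of linear combinations of `c` elements of `X`. -/
def VanishesOnSpans (X : Set (ι → K)) {c : Type*} [Fintype c] (F : MvPolynomial (c × ι) K) : Prop :=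
  ∀ p : c → ι → K, (∀ i, p i ∈ X) → ∀ g : c → c → K, eval (fun q => ∑ l, g q.1 l * p l q.2) F = 0

end VanishesOnSpans

namespace Grassmannian

section Secant

variable {K H ι : Type*} [Field K] [IsAlgClosed K] [AddCommGroup H] [Module K H]
  [FiniteDimensional K H] [Fintype ι] {c : ℕ}

lemma linearIndependent_of_pluckerCoord_ne_zero {A : Fin c → H} {φ : Fin c → Module.Dual K H}
    (h : pluckerCoord A φ ≠ 0) : LinearIndependent K A := by
  have h1 := Matrix.linearIndependent_cols_of_det_ne_zero h
  refine LinearIndependent.of_comp (LinearMap.pi φ) ?_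
  exact h1

lemma exists_fun_span_eq {X : Set H} {N : Grassmannian K H c}
    (hN : Submodule.span K ((N.space : Set H) ∩ X) = N.space) :
    ∃ p : Fin c → H, (∀ i, p i ∈ X) ∧ Submodule.span K (Set.range p) = N.space := by
  have hr : Module.finrank K (Submodule.span K ((N.space : Set H) ∩ X)) = c := by
    rw [hN, N.finrank_space]
  obtain ⟨p, hp, hp', -⟩ := Submodule.exists_fun_fin_finrank_span_eq K ((N.space : Set H) ∩ X)
  refine ⟨p ∘ Fin.cast hr.symm, fun i => (hp _).2, ?_⟩
  refine Eq.trans (congrArg _ ?_) (hp'.trans hN)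
  exact (finCongr hr.symm).surjective.range_comp p

/-- An equation on tuples restricts to the frames of the chart centred at N with frame B,
homogenizes there, and so passes to the closure. Conversely, a Plücker equation of the closure pulls
back to an equation on tuples. -/
theorem mem_secantVariety_iff (τ : H ≃ₗ[K] (ι → K)) (Y : Set H) {N : Grassmannian K H c}
    (B : Module.Basis (Fin c) K N.space) :
    N ∈ secantVariety Y c ↔ ∀ F : MvPolynomial (Fin c × ι) K, VanishesOnSpans (τ '' Y) F →
      eval (fun q => τ (B q.1) q.2) F = 0 := by
  obtain ⟨m, hm⟩ : ∃ m, Module.finrank K H = c + m :=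
    ⟨_, (Nat.add_sub_cancel' (N.finrank_space ▸ N.space.finrank_le)).symm⟩
  obtain ⟨b, hb, hb0⟩ := exists_basis_chart hm N B
  have hframe : ∀ j, frame b 0 j = B j := fun j => by simp [frame, hb]
  constructor
  · intro hN F hF
    let P : MvPolynomial (Fin c × Fin m) K := aeval (fun q : Fin c × ι =>
      C (τ (b (Sum.inl q.1)) q.2) + ∑ i, X (q.1, i) * C (τ (b (Sum.inr i)) q.2)) F
    have hP : ∀ y, eval y P = eval (fun q => τ (frame b y q.1) q.2) F := by
      intro y
      rw [eval_aeval]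
      congr 2
      ext q
      simp [frame]
    obtain ⟨D, f, hD, hf⟩ := exists_isHomogeneous_eval_eq b P
    have hhom : (f * X (chartForms b)).IsHomogeneous (D + 1) :=
      hD.mul (isHomogeneous_X _ _)
    have hev : ∀ y, eval y (pullback b (f * X (chartForms b))) = eval y P := by
      intro y
      rw [eval_pullback, map_mul, hf, eval_X, pluckerCoord_frame_chartForms, mul_one]
    have hcl : IsClosed (zeroLocus {f * X (chartForms b)}) := by
      refine isClosed_iff.2 ⟨_, ?_, rfl⟩
      rintro _ rfl
      exact ⟨_, hhom⟩
    have hsub : {N : Grassmannian K H c | Submodule.span K ((N.space : Set H) ∩ Y) = N.space} ⊆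
        zeroLocus {f * X (chartForms b)} := by
      rintro N' hN' _ rfl
      by_cases hr : N' ∈ Set.range (chart b)
      · obtain ⟨y, rfl⟩ := hr
        rw [vanishesAt_chart_iff b y hhom, hev, hP]
        obtain ⟨p, hpY, hp⟩ := exists_fun_span_eq hN'
        have h1 : ∀ j, ∃ g : Fin c → K, ∑ l, g l • p l = frame b y j := by
          intro j
          refine (Submodule.mem_span_range_iff_exists_fun K).1 ?_
          rw [hp]
          exact Submodule.subset_span ⟨j, rfl⟩
        choose g hg using h1
        rw [← hF (fun l => τ (p l)) (fun l => ⟨_, hpY l, rfl⟩) g]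
        congr 2
        ext q
        rw [← hg]
        simp
      · intro B'
        rw [map_mul, eval_X]
        by_contra hne
        exact hr (mem_range_chart b B' (right_ne_zero_of_mul hne))
    have h0 := closure_minimal hsub hcl hN _ rfl
    rw [← hb0, vanishesAt_chart_iff b 0 hhom, hev, hP] at h0
    simpa only [hframe] using h0
  · intro h
    obtain ⟨S, hS, hcl⟩ := isClosed_iff.1 (isClosed_closure (X := Grassmannian K H c)
      (s := {N | Submodule.span K ((N.space : Set H) ∩ Y) = N.space}))
    rw [secantVariety, hcl]
    intro f hf
    obtain ⟨D, hD⟩ := hS f hf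
    rw [vanishesAt_iff hD N B]
    classical
    let e : Module.Basis ι K H := Module.Basis.ofEquivFun τ
    have he : ∀ v : ι → K, ∑ k, v k • e k = τ.symm v := fun v => by
      rw [← Module.Basis.equivFun_symm_apply, Module.Basis.equivFun_ofEquivFun]
    -- The factor `X (chartForms b)` forces vanishing on linearly dependent tuples, which define no
    -- point of the Grassmannian; at B it equals 1.
    let F : MvPolynomial (Fin c × ι) K :=
      aeval (pluckerPoly (fun j k => X (j, k)) e) (f * X (chartForms b))
    have hF : ∀ A : Fin c → H, eval (fun q : Fin c × ι => τ (A q.1) q.2) F =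
        eval (pluckerCoord A) f * pluckerCoord A (chartForms b) := by
      intro A
      have : (fun φ => eval (fun q : Fin c × ι => τ (A q.1) q.2)
          (pluckerPoly (fun j k => X (j, k)) e φ)) = pluckerCoord A := by
        ext1 φ
        rw [eval_pluckerPoly]
        simp only [eval_X]
        congr 1
        ext1 j
        exact (he (τ (A j))).trans (τ.symm_apply_apply _)
      rw [eval_aeval, this, map_mul, eval_X]
    have h1 : VanishesOnSpans (τ '' Y) F := by
      intro p hp g
      choose p' hpY hp' using hp
      have h2 : (fun q : Fin c × ι => ∑ l, g q.1 l * p l q.2) =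
          fun q => τ (∑ l, g q.1 l • p' l) q.2 := by
        ext q
        simp [← hp']
      rw [h2]
      refine (hF fun j => ∑ l, g j l • p' l).trans ?_
      by_cases hne : pluckerCoord (fun j => ∑ l, g j l • p' l) (chartForms b) = 0
      · rw [hne, mul_zero]
      have hli := linearIndependent_of_pluckerCoord_ne_zero hne
      let N' : Grassmannian K H c := ⟨Submodule.span K (Set.range fun j => ∑ l, g j l • p' l), by
        rw [finrank_span_eq_card hli, Fintype.card_fin]⟩
      have hle : N'.space ≤ Submodule.span K (Set.range p') := by
        refine Submodule.span_le.2 ?_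
        rintro _ ⟨j, rfl⟩
        exact Submodule.sum_mem _ fun l _ => Submodule.smul_mem _ _ (Submodule.subset_span ⟨l, rfl⟩)
      -- The c independent combinations of c vectors span the same space, so N' is spanned by
      -- elements of Y.
      have heq : N'.space = Submodule.span K (Set.range p') := by
        refine Submodule.eq_of_le_of_finrank_le hle ?_
        rw [N'.finrank_space]
        exact (finrank_range_le_card p').trans (Fintype.card_fin c).le
      have hN' : N' ∈ {N : Grassmannian K H c |
          Submodule.span K ((N.space : Set H) ∩ Y) = N.space} := by
        refine le_antisymm (Submodule.span_le.2 Set.inter_subset_left) ?_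
        rw [heq]
        refine Submodule.span_mono ?_
        rintro _ ⟨l, rfl⟩
        exact ⟨Submodule.subset_span ⟨l, rfl⟩, hpY l⟩
      have h3 := subset_closure hN'
      rw [hcl] at h3
      have h4 := (vanishesAt_iff hD N' (Module.Basis.span hli)).1 (h3 f hf)
      have h5 : (fun j => ((Module.Basis.span hli j : _) : H)) = fun j => ∑ l, g j l • p' l :=
        funext fun j => congrArg Subtype.val (Module.Basis.span_apply hli j)
      rw [h5] at h4
      rw [h4, zero_mul]
    have h6 := h F h1
    rw [hF fun j => (B j : H)] at h6
    have h7 : pluckerCoord (fun j => (B j : H)) (chartForms b) = 1 := by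
      rw [← funext hframe, pluckerCoord_frame_chartForms]
    rwa [h7, mul_one] at h6

end Secant

end Grassmannian

section VanishesOnSpans

variable {K ι : Type*} [Field K] {X : Set (ι → K)}

/-- Combinations of combinations are combinations of the same elements; the equivalence keeps the
number of elements equal to the length of the tuple. -/
lemma VanishesOnSpans.aeval_linear {c c' : Type*} [Fintype c] [Fintype c'] (e : c ≃ c')
    {F : MvPolynomial (c × ι) K} (hF : VanishesOnSpans X F) (h : c → c' → K) :
    VanishesOnSpans X (aeval (fun q : c × ι =>
      ∑ l : c', C (h q.1 l) * (MvPolynomial.X (l, q.2) : MvPolynomial (c' × ι) K)) F) := by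
  intro p hp g
  rw [eval_aeval, ← hF (fun l => p (e l)) (fun l => hp _) fun i l => ∑ l', h i l' * g l' (e l)]
  congr 2
  ext q
  simp only [map_sum, map_mul, eval_C, eval_X, Finset.mul_sum, Finset.sum_mul]
  rw [Finset.sum_comm]
  refine Fintype.sum_equiv e.symm _ _ fun l => ?_
  simp [mul_assoc]

lemma eval_aeval_linear {c c' : Type*} [Fintype c'] (F : MvPolynomial (c × ι) K)
    (h : c → c' → K) (v : c' → ι → K) :
    eval (fun q => v q.1 q.2) (aeval (fun q : c × ι =>
      ∑ l : c', C (h q.1 l) * (MvPolynomial.X (l, q.2) : MvPolynomial (c' × ι) K)) F) =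
      eval (fun q => ∑ l, h q.1 l * v l q.2) F := by
  rw [eval_aeval]
  simp

/-- If the tuples `v₁` and `v₂` are limits of tuples of linear combinations of elements of `X`, then
so is their concatenation. -/
lemma eval_sum_eq_zero_of_vanishesOnSpans {c₁ c₂ : Type*} [Fintype c₁] [Fintype c₂]
    {v₁ : c₁ → ι → K} {v₂ : c₂ → ι → K}
    (h₁ : ∀ F : MvPolynomial (c₁ × ι) K, VanishesOnSpans X F → eval (fun q => v₁ q.1 q.2) F = 0)
    (h₂ : ∀ F : MvPolynomial (c₂ × ι) K, VanishesOnSpans X F → eval (fun q => v₂ q.1 q.2) F = 0)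
    {F : MvPolynomial ((c₁ ⊕ c₂) × ι) K} (hF : VanishesOnSpans X F) :
    eval (fun q => Sum.elim v₁ v₂ q.1 q.2) F = 0 := by
  -- Limits are taken one block at a time: first reach v₁ with the second block an honest tuple of
  -- combinations, then keep v₁ fixed and reach v₂.
  have key : ∀ p₂ : c₂ → ι → K, (∀ i, p₂ i ∈ X) → ∀ g₂ : c₂ → c₂ → K,
      eval (fun q => Sum.elim v₁ (fun i k => ∑ l, g₂ i l * p₂ l k) q.1 q.2) F = 0 := by
    intro p₂ hp₂ g₂
    have h := h₁ (aeval (fun q : (c₁ ⊕ c₂) × ι => Sum.elim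
      (fun i k => (MvPolynomial.X (i, k) : MvPolynomial (c₁ × ι) K))
      (fun i k => C (∑ l, g₂ i l * p₂ l k)) q.1 q.2) F) (by
        intro p₁ hp₁ g₁
        rw [eval_aeval, ← hF (Sum.elim p₁ p₂) (by rintro (i | i) <;> simp [hp₁, hp₂])
          (Sum.elim (fun i => Sum.elim (g₁ i) 0) fun i => Sum.elim 0 (g₂ i))]
        congr 2
        ext ⟨i | i, k⟩ <;> simp)
    rw [eval_aeval] at h
    rw [← h]
    congr 2
    ext ⟨i | i, k⟩ <;> simp
  have h := h₂ (aeval (fun q : (c₁ ⊕ c₂) × ι => Sum.elim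
    (fun i k => (C (v₁ i k) : MvPolynomial (c₂ × ι) K))
    (fun i k => MvPolynomial.X (i, k)) q.1 q.2) F) (by
      intro p₂ hp₂ g₂
      rw [eval_aeval, ← key p₂ hp₂ g₂]
      congr 2
      ext ⟨i | i, k⟩ <;> simp)
  rw [eval_aeval] at h
  rw [← h]
  congr 2
  ext ⟨i | i, k⟩ <;> simp

end VanishesOnSpans

/-! ### Coisotropy in a chart. -/

namespace Grassmannian

section Criterion

variable {K W : Type*} [Field K] [AddCommGroup W] [Module K W] [FiniteDimensional K W]
  {d m : ℕ} (b : Module.Basis (Fin d ⊕ Fin m) K W) (x : Fin d × Fin m → K)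

/-- Matrices of rank at most one. -/
def rankOneSet (K : Type*) [Field K] (d m : ℕ) : Set (Fin d × Fin m → K) :=
  {v | ∃ (u : Fin d → K) (w : Fin m → K), v = fun k => u k.1 * w k.2}

lemma image_segreCone :
    conormalEquiv b x '' segreCone K (W ⧸ (chart b x).space) (chart b x).space =
      rankOneSet K d m := by
  ext v
  constructor
  · rintro ⟨η, hη, rfl⟩
    obtain ⟨⟨y, _⟩, hy⟩ := (finrank_le_one_iff).1 hη
    have h1 : ∀ i, ∃ a : K, a • y = η (quotBasis b x i) := fun i => by
      obtain ⟨a, ha⟩ := hy ⟨η (quotBasis b x i), LinearMap.mem_range_self _ _⟩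
      exact ⟨a, congrArg Subtype.val ha⟩
    choose a ha using h1
    refine ⟨fun j => (chartBasis b x).repr y j, a, ?_⟩
    ext ⟨j, i⟩
    rw [conormalEquiv_apply, LinearMap.toMatrix_apply, ← ha]
    simp [mul_comm]
  · rintro ⟨u, w, rfl⟩
    obtain ⟨η, hη⟩ := (conormalEquiv b x).surjective fun k => u k.1 * w k.2
    refine ⟨η, ?_, hη⟩
    have h1 : LinearMap.range η ≤ Submodule.span K {∑ j, u j • chartBasis b x j} := by
      rw [LinearMap.range_eq_map, ← (quotBasis b x).span_eq, Submodule.map_span, Submodule.span_le]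
      rintro _ ⟨_, ⟨i, rfl⟩, rfl⟩
      refine Submodule.mem_span_singleton.2 ⟨w i, ?_⟩
      rw [← (chartBasis b x).sum_repr (η (quotBasis b x i)), Finset.smul_sum]
      refine Finset.sum_congr rfl fun j _ => ?_
      have := congrFun hη (j, i)
      rw [conormalEquiv_apply, LinearMap.toMatrix_apply] at this
      rw [this, smul_smul, mul_comm]
    exact (Submodule.finrank_mono h1).trans ((finrank_span_le_card _).trans (by simp))

variable [IsAlgClosed K]

lemma map_conormalSpace {S : Set (Grassmannian K W d)} (hx : chart b x ∈ S) :
    (conormalSpace S (chart b x)).map (conormalEquiv b x).toLinearMap = gradientSpace b x S := by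
  ext v
  constructor
  · rintro ⟨η, hη, rfl⟩
    exact (mem_conormalSpace_chart b x hx η).1 hη
  · intro hv
    obtain ⟨η, rfl⟩ := (conormalEquiv b x).surjective v
    exact ⟨η, (mem_conormalSpace_chart b x hx η).2 hv, rfl⟩

/-- The condition of coisotropy at a point, in a chart. -/
theorem exists_mem_secantVariety_iff {S : Set (Grassmannian K W d)} (hx : chart b x ∈ S) {c : ℕ}
    (hc : Module.finrank K (gradientSpace b x S) = c) :
    (∃ N ∈ secantVariety (K := K) (segreCone K (W ⧸ (chart b x).space) (chart b x).space) c,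
      N.space = conormalSpace S (chart b x)) ↔
      ∀ F : MvPolynomial (Fin c × (Fin d × Fin m)) K, VanishesOnSpans (rankOneSet K d m) F →
        ∀ p : Fin c → MvPolynomial (Fin d × Fin m) K, (∀ i, p i ∈ chartIdeal b S) →
          eval (fun q => gradient x (p q.1) q.2) F = 0 := by
  constructor
  · rintro ⟨N, hN, hNs⟩ F hF p hp
    obtain ⟨B⟩ := exists_basis N
    rw [mem_secantVariety_iff (conormalEquiv b x) _ B, image_segreCone] at hN
    have h1 : ∀ i, ∃ h : Fin c → K,
        ∑ l, h l • conormalEquiv b x (B l) = gradient x (p i) := by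
      intro i
      obtain ⟨η, hη⟩ := (conormalEquiv b x).surjective (gradient x (p i))
      have h2 : η ∈ N.space := by
        rw [hNs, mem_conormalSpace_chart b x hx, hη]
        exact ⟨p i, hp i, rfl⟩
      refine ⟨fun l => B.repr ⟨η, h2⟩ l, ?_⟩
      have h3 : ∑ l, B.repr ⟨η, h2⟩ l • (B l : (W ⧸ (chart b x).space) →ₗ[K] _) = η := by
        have := congrArg Subtype.val (B.sum_repr ⟨η, h2⟩)
        rwa [Submodule.coe_sum] at this
      have h4 := congrArg (conormalEquiv b x) h3
      rw [map_sum, hη] at h4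
      simpa only [map_smul] using h4
    choose h hh using h1
    -- The gradients may be dependent; they are combinations of the basis B, and the equations are
    -- stable under such substitutions.
    have h4 := hN _ (hF.aeval_linear (Equiv.refl _) h)
    rw [eval_aeval_linear F h fun l => conormalEquiv b x (B l)] at h4
    rw [← h4]
    congr 2
    ext q
    rw [← hh]
    simp
  · intro h
    have hfin : Module.finrank K (conormalSpace S (chart b x)) = c := by
      rw [← hc, ← map_conormalSpace b x hx]
      exact (LinearEquiv.finrank_map_eq (conormalEquiv b x) _).symm
    let N : Grassmannian K ((W ⧸ (chart b x).space) →ₗ[K] (chart b x).space) c :=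
      ⟨conormalSpace S (chart b x), hfin⟩
    refine ⟨N, ?_, rfl⟩
    obtain ⟨B⟩ := exists_basis N
    rw [mem_secantVariety_iff (conormalEquiv b x) _ B, image_segreCone]
    intro F hF
    have h1 : ∀ i, ∃ p ∈ chartIdeal b S, gradient x p = conormalEquiv b x (B i) := fun i =>
      (mem_conormalSpace_chart b x hx _).1 (B i).2
    choose p hp hp' using h1
    rw [← h F hF p hp]
    simp only [hp']

end Criterion

/-! ### Codimension, and varieties of small dimension. -/

section Codimension

variable {K W : Type*} [Field K] [IsAlgClosed K] [AddCommGroup W] [Module K W]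
  [FiniteDimensional K W] {d m : ℕ} (b : Module.Basis (Fin d ⊕ Fin m) K W)

lemma hasCodim_iff_height_chartIdeal (hW : Module.finrank K W = d + m)
    {S : Set (Grassmannian K W d)} (hc : IsClosed S) (hi : IsIrreducible S)
    (hne : (chart b ⁻¹' S).Nonempty) (c : ℕ) :
    HasCodim S c ↔ (chartIdeal b S).height = c := by
  have h2 := topologicalKrullDim_add_height_chartIdeal b hW hc hi hne
  rw [HasCodim, hW, Nat.add_sub_cancel_left, ← h2]
  generalize (chartIdeal b S).height = e at *
  generalize topologicalKrullDim S = D at *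
  generalize d * m = N at *
  induction D with
  | bot =>
    rw [WithBot.bot_add] at h2
    exact absurd h2 (by norm_cast)
  | coe D =>
    have h3 : D + e = N := by exact_mod_cast h2
    have hD : D ≠ ⊤ := by
      rintro rfl; rw [top_add] at h3; exact ENat.natCast_ne_top N (by exact_mod_cast h3.symm)
    have he : e ≠ ⊤ := by
      rintro rfl; rw [add_top] at h3; exact ENat.natCast_ne_top N (by exact_mod_cast h3.symm)
    lift D to ℕ using hD
    lift e to ℕ using he
    norm_cast at *
    omega

lemma exists_hasCodim (hW : Module.finrank K W = d + m) {S : Set (Grassmannian K W d)}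
    (hc : IsClosed S) (hi : IsIrreducible S) : ∃ D c : ℕ, topologicalKrullDim S = D ∧
      HasCodim S c ∧ D + c = d * m := by
  obtain ⟨L, hL⟩ := hi.nonempty
  obtain ⟨B⟩ := exists_basis L
  obtain ⟨b, -, hb⟩ := exists_basis_chart hW L B
  have h2 := topologicalKrullDim_add_height_chartIdeal b hW hc hi ⟨0, by
    rw [Set.mem_preimage, hb]; exact hL⟩
  have hcod : ∀ c, HasCodim S c ↔ topologicalKrullDim S + (c : WithBot ℕ∞) = (d * m : ℕ) :=
    fun c => by rw [HasCodim, hW, Nat.add_sub_cancel_left]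
  simp only [hcod]
  clear hcod
  generalize (chartIdeal b S).height = e at *
  generalize topologicalKrullDim S = D at *
  generalize d * m = N at *
  induction D with
  | bot =>
    rw [WithBot.bot_add] at h2
    exact absurd h2 (by norm_cast)
  | coe D =>
    have h3 : D + e = N := by exact_mod_cast h2
    have hD : D ≠ ⊤ := by
      rintro rfl; rw [top_add] at h3; exact ENat.natCast_ne_top N (by exact_mod_cast h3.symm)
    have he : e ≠ ⊤ := by
      rintro rfl; rw [add_top] at h3; exact ENat.natCast_ne_top N (by exact_mod_cast h3.symm)
    lift D to ℕ using hD
    lift e to ℕ using he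
    exact ⟨D, e, rfl, by exact_mod_cast h3, by exact_mod_cast h3⟩

/-- Irreducible subvarieties of small dimension are coisotropic. -/
theorem isCoisotropic_of_topologicalKrullDim_le [CharZero K] {V : Type*} [AddCommGroup V]
    [Module K V] [FiniteDimensional K V] {D m : ℕ} (hV : Module.finrank K V = (D + 1) + (m + 1))
    {S : Set (Grassmannian K V (D + 1))} (hc : IsClosed S) (hi : IsIrreducible S)
    (hdim : topologicalKrullDim S ≤ ((D + m : ℕ) : WithBot ℕ∞)) : IsCoisotropic S := by
  obtain ⟨r, c, hr, hcod, hrc⟩ := exists_hasCodim hV hc hi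
  rw [hr] at hdim
  have hrm : r ≤ D + m := by exact_mod_cast hdim
  -- From r + c = (D + 1)(m + 1) and r ≤ D + m; this also gives c ≥ 1.
  have hDm : D * m + 1 ≤ c := by
    have : (D + 1) * (m + 1) = D * m + D + m + 1 := by ring
    omega
  refine ⟨hc, hi, c, by omega, hcod, fun L hL => ?_⟩
  obtain ⟨B⟩ := exists_basis L
  obtain ⟨b, -, rfl⟩ := exists_basis_chart hV L B
  have hht := (hasCodim_iff_height_chartIdeal b hV hc hi ⟨0, hL.1⟩ c).1 hcod
  have hfin := (mem_regularLocus_chart b 0 hV hc hi hL.1).1 hL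
  rw [hht] at hfin
  refine (exists_mem_secantVariety_iff b 0 hL.1 (by exact_mod_cast hfin)).2 fun F hF p _ => ?_
  have hF0 : F = 0 := eq_zero_of_vanishing_on_rankOne_tuples hDm F fun G u w =>
    hF (fun l k => u l k.1 * w l k.2) (fun i => ⟨u i, w i, rfl⟩) G
  rw [hF0, map_zero]

end Codimension

end Grassmannian

/-- Two subspaces of the same dimension have a common complement. -/
theorem Submodule.exists_isCompl_isCompl {K W : Type*} [Field K] [AddCommGroup W] [Module K W]
    [FiniteDimensional K W] (m : ℕ) (U V : Submodule K W)
    (hU : Module.finrank K U + m = Module.finrank K W)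
    (hV : Module.finrank K V + m = Module.finrank K W) : ∃ H, IsCompl U H ∧ IsCompl V H := by
  induction m generalizing U V with
  | zero =>
    rw [Submodule.eq_top_of_finrank_eq (S := U) hU, Submodule.eq_top_of_finrank_eq (S := V) hV]
    exact ⟨⊥, isCompl_top_bot, isCompl_top_bot⟩
  | succ m ih =>
    have hne : ∀ U : Submodule K W, Module.finrank K U + (m + 1) = Module.finrank K W →
        ∃ a, a ∉ U := by
      intro U hU
      by_contra! h
      rw [(Submodule.eq_top_iff'.2 h), finrank_top] at hU
      omega
    -- A vector space is not the union of two proper subspaces; adjoining w to both lowers the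
    -- codimension.
    obtain ⟨w, hwU, hwV⟩ : ∃ w, w ∉ U ∧ w ∉ V := by
      obtain ⟨a, ha⟩ := hne U hU
      obtain ⟨a', ha'⟩ := hne V hV
      by_cases haV : a ∈ V
      · by_cases haU : a' ∈ U
        · exact ⟨a + a', fun h => ha ((Submodule.add_mem_iff_left _ haU).1 h),
            fun h => ha' ((Submodule.add_mem_iff_right _ haV).1 h)⟩
        · exact ⟨a', haU, ha'⟩
      · exact ⟨a, ha, haV⟩
    have hw0 : w ≠ 0 := fun h => hwU (h ▸ U.zero_mem)
    have hdisj : ∀ U : Submodule K W, w ∉ U → Disjoint U (Submodule.span K {w}) := fun U hwU =>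
      Submodule.disjoint_span_singleton.2 fun h => absurd h hwU
    have hfin : ∀ U : Submodule K W, w ∉ U → Module.finrank K U + (m + 1) = Module.finrank K W →
        Module.finrank K (U ⊔ Submodule.span K {w} : Submodule K W) + m = Module.finrank K W := by
      intro U hwU hU
      have := Submodule.finrank_sup_add_finrank_inf_eq U (Submodule.span K {w})
      rw [(hdisj U hwU).eq_bot, finrank_bot, finrank_span_singleton hw0] at this
      omega
    obtain ⟨H, hH₁, hH₂⟩ := ih _ _ (hfin U hwU hU) (hfin V hwV hV)
    refine ⟨Submodule.span K {w} ⊔ H, ?_, ?_⟩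
    · exact ⟨(hdisj U hwU).disjoint_sup_right_of_disjoint_sup_left hH₁.disjoint,
        by rw [codisjoint_iff, ← sup_assoc]; exact hH₁.codisjoint.eq_top⟩
    · exact ⟨(hdisj V hwV).disjoint_sup_right_of_disjoint_sup_left hH₂.disjoint,
        by rw [codisjoint_iff, ← sup_assoc]; exact hH₂.codisjoint.eq_top⟩

/-! ### Components of generically transverse intersections. -/

namespace Grassmannian

section Intersection

variable {K W : Type*} [Field K] [AddCommGroup W] [Module K W]
  [FiniteDimensional K W] {d m : ℕ}

/-- Any two points of the Grassmannian lie in a common chart. -/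
lemma exists_basis_chart_pair (hW : Module.finrank K W = d + m) (L L' : Grassmannian K W d) :
    ∃ (b : Module.Basis (Fin d ⊕ Fin m) K W) (x x' : Fin d × Fin m → K),
      chart b x = L ∧ chart b x' = L' := by
  obtain ⟨H, hH, hH'⟩ := Submodule.exists_isCompl_isCompl m L.space L'.space
    (by rw [L.finrank_space, hW]) (by rw [L'.finrank_space, hW])
  obtain ⟨B⟩ := exists_basis L
  have hr : Module.finrank K H = m := by
    have := Submodule.finrank_add_eq_of_isCompl hH
    rw [L.finrank_space, hW] at this
    omega
  let E := Module.finBasisOfFinrankEq K H hr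
  let b := (B.prod E).map (Submodule.prodEquivOfIsCompl _ _ hH)
  -- The chart forms cut out H, so a singular minor would give a nonzero vector of L in H.
  have key : ∀ (L : Grassmannian K W d), Disjoint L.space H → L ∈ Set.range (chart b) := by
    intro L hL
    obtain ⟨B⟩ := exists_basis L
    refine mem_range_chart b B fun h0 => ?_
    obtain ⟨a, ha, ha'⟩ := Matrix.exists_mulVec_eq_zero_iff.2 h0
    have h1 : ∀ i, b.coord (Sum.inl i) (∑ j, a j • (B j : W)) = 0 := by
      intro i
      have := congrFun ha' i
      simp only [map_sum, map_smul, smul_eq_mul]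
      simpa [Matrix.mulVec, dotProduct, chartForms, mul_comm] using this
    have h2 : ∑ j, a j • (B j : W) ∈ H := by
      rw [← b.sum_repr (∑ j, a j • (B j : W)), Fintype.sum_sum_type]
      refine add_mem (Submodule.sum_mem _ fun i _ => ?_) (Submodule.sum_mem _ fun i _ => ?_)
      · rw [show b.repr (∑ j, a j • (B j : W)) (Sum.inl i) = 0 from h1 i, zero_smul]
        exact zero_mem _
      · refine Submodule.smul_mem _ _ ?_
        simp [b]
    have h3 : ∑ j, a j • (B j : W) ∈ L.space :=
      Submodule.sum_mem _ fun j _ => Submodule.smul_mem _ _ (B j).2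
    have h4 : ∑ j, a j • B j = 0 := by
      apply Subtype.ext
      simpa using Submodule.disjoint_def.1 hL _ h3 h2
    exact ha (funext (Fintype.linearIndependent_iff.1 B.linearIndependent a h4))
  obtain ⟨x, hx⟩ := key L hH.disjoint
  obtain ⟨x', hx'⟩ := key L' hH'.disjoint
  exact ⟨b, x, x', hx, hx'⟩

lemma IsIrreducibleComponent.isClosed {Z S : Set (Grassmannian K W d)} (hS : IsClosed S)
    (hZ : IsIrreducibleComponent Z S) : IsClosed Z := by
  have h1 : closure Z ≤ Z :=
    hZ.2 ⟨hZ.1.1.closure, closure_minimal hZ.1.2 hS⟩ subset_closure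
  exact isClosed_of_closure_subset h1

variable [IsAlgClosed K] (b : Module.Basis (Fin d ⊕ Fin m) K W) (x : Fin d × Fin m → K)

/-- For a prime Q between the sum and the ideal of Z, the closure of its zero locus is irreducible,
lies in S₁ ∩ S₂ and contains Z, hence equals Z by maximality. -/
lemma chartIdeal_mem_minimalPrimes {Z S₁ S₂ : Set (Grassmannian K W d)} (h₁ : IsClosed S₁)
    (h₂ : IsClosed S₂) (hZ : IsIrreducibleComponent Z (S₁ ∩ S₂)) (hx : chart b x ∈ Z) :
    chartIdeal b Z ∈ (chartIdeal b S₁ ⊔ chartIdeal b S₂).minimalPrimes := by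
  have hZc : IsClosed Z := hZ.isClosed (h₁.inter h₂)
  have hpre : (chart b ⁻¹' Z).Nonempty := ⟨x, hx⟩
  refine ⟨⟨isPrime_chartIdeal b hZ.1.1 hpre, sup_le
    (chartIdeal_anti b (hZ.1.2.trans Set.inter_subset_left))
    (chartIdeal_anti b (hZ.1.2.trans Set.inter_subset_right))⟩, ?_⟩
  rintro Q ⟨hQ, hle⟩ hQZ
  let T : Set (Grassmannian K W d) :=
    closure ((fun y : AffineChart b => chart b y) '' (MvPolynomial.zeroLocus K Q : Set _))
  have hT : IsIrreducible T :=
    ((isIrreducible_zeroLocus b Q).image _ (isOpenEmbedding_chart b).continuous.continuousOn).closure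
  have hTS : T ⊆ S₁ ∩ S₂ := by
    refine closure_minimal ?_ (h₁.inter h₂)
    rintro _ ⟨y, hy, rfl⟩
    exact ⟨(mem_zeroLocus_chartIdeal b h₁ y).1 (zeroLocus_anti_mono (le_sup_left.trans hle) hy),
      (mem_zeroLocus_chartIdeal b h₂ y).1 (zeroLocus_anti_mono (le_sup_right.trans hle) hy)⟩
  have hZT : Z ⊆ T := by
    have h3 := closure_image_preimage_of_isPreirreducible _
      (isOpenEmbedding_chart b).isOpenMap Z hpre hZ.1.1.2 hZc
    rw [← h3]
    refine closure_mono (Set.image_mono ?_)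
    intro y hy
    exact zeroLocus_anti_mono hQZ ((mem_zeroLocus_chartIdeal b hZc y).2 hy)
  have hTZ : T ⊆ Z := hZ.2 ⟨hT, hTS⟩ hZT
  intro p hp
  rw [← IsPrime.vanishingIdeal_zeroLocus (K := K) Q]
  intro y hy
  exact (mem_chartIdeal b).1 hp y (hTZ (subset_closure ⟨y, hy, rfl⟩))

/-- A common conormal vector annihilates both tangent spaces, hence their sum, which is everything.
-/
lemma disjoint_gradientSpace {S₁ S₂ : Set (Grassmannian K W d)}
    (h : TransverseAt S₁ S₂ (chart b x)) :
    Disjoint (gradientSpace b x S₁) (gradientSpace b x S₂) := by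
  rw [Submodule.disjoint_def]
  intro v hv₁ hv₂
  obtain ⟨η, rfl⟩ := (conormalEquiv b x).surjective v
  rw [← mem_conormalSpace_chart b x h.1.1] at hv₁
  rw [← mem_conormalSpace_chart b x h.2.1.1] at hv₂
  have key : ∀ ψ, LinearMap.trace K (chart b x).space (η ∘ₗ ψ) = 0 := by
    intro ψ
    have hψ : ψ ∈ tangentSpace S₁ (chart b x) ⊔ tangentSpace S₂ (chart b x) :=
      h.2.2 ▸ Submodule.mem_top
    obtain ⟨ψ₁, h₁, ψ₂, h₂, rfl⟩ := Submodule.mem_sup.1 hψ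
    rw [LinearMap.comp_add, map_add, hv₁ ψ₁ h₁, hv₂ ψ₂ h₂, add_zero]
  ext k
  obtain ⟨ψ, hψ⟩ := (tangentEquiv b x).surjective (Pi.single k 1)
  have := key ψ
  rw [trace_comp_eq_sum, hψ] at this
  simpa [Pi.single_apply] using this

/-- Generators of the gradient space with linearly independent gradients. -/
lemma exists_linearIndependent_gradient {S : Set (Grassmannian K W d)} {c : ℕ}
    (hc : Module.finrank K (gradientSpace b x S) = c) :
    ∃ g : Fin c → MvPolynomial (Fin d × Fin m) K, (∀ i, g i ∈ chartIdeal b S) ∧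
      LinearIndependent K (fun i => gradient x (g i)) ∧
      Submodule.span K (Set.range fun i => gradient x (g i)) = gradientSpace b x S := by
  let B := Module.finBasisOfFinrankEq K (gradientSpace b x S) hc
  have h1 : ∀ i, ∃ p ∈ chartIdeal b S, gradient x p = B i := fun i => (B i).2
  choose g hg hg' using h1
  refine ⟨g, hg, ?_, ?_⟩
  · simp only [hg']
    exact B.linearIndependent.map' (Submodule.subtype _) (Submodule.ker_subtype _)
  · simp only [hg']
    have := congrArg (Submodule.map (gradientSpace b x S).subtype) B.span_eq
    rw [Submodule.map_span, Submodule.map_top, Submodule.range_subtype, ← Set.range_comp] at this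
    exact this

/-- No more gradients than the height of the ideal can be independent at a point of S, so this many
already span. -/
lemma span_gradient_eq {S : Set (Grassmannian K W d)} (hi : IsIrreducible S)
    (hx : chart b x ∈ S) {κ : Type*} [Fintype κ]
    (hht : (chartIdeal b S).height = Fintype.card κ)
    {g : κ → MvPolynomial (Fin d × Fin m) K} (hg : ∀ i, g i ∈ chartIdeal b S)
    (hli : LinearIndependent K fun i => gradient x (g i)) :
    Submodule.span K (Set.range fun i => gradient x (g i)) = gradientSpace b x S := by
  have := isPrime_chartIdeal b hi ⟨x, hx⟩
  refine Submodule.eq_of_le_of_finrank_le ?_ ?_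
  · refine Submodule.span_le.2 ?_
    rintro _ ⟨i, rfl⟩
    exact ⟨g i, hg i, rfl⟩
  · rw [finrank_span_eq_card hli]
    obtain ⟨g', hg', hli', -⟩ := exists_linearIndependent_gradient b x (S := S) rfl
    have h1 : x ∈ MvPolynomial.zeroLocus K (chartIdeal b S) :=
      fun p hp => (mem_chartIdeal b).1 hp x hx
    have h2 := card_le_height_of_linearIndependent_gradient h1 g' hg' hli'
    rw [hht, Fintype.card_fin] at h2
    exact_mod_cast h2

end Intersection

end Grassmannian

namespace Grassmannian

section Intersection

variable {K W : Type*} [Field K] [IsAlgClosed K] [AddCommGroup W] [Module K W]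
  [FiniteDimensional K W] {d m : ℕ} (b : Module.Basis (Fin d ⊕ Fin m) K W)
  (x : Fin d × Fin m → K)

/-- At a regular point, the functions in the ideal of a coisotropic variety satisfy the equations
of the tuples of linear combinations of matrices of rank one. -/
lemma eval_gradient_eq_zero_of_linearIndependent (hW : Module.finrank K W = d + m)
    {S : Set (Grassmannian K W d)} (hc : IsClosed S) (hi : IsIrreducible S) {c : ℕ}
    (hht : (chartIdeal b S).height = c)
    (hS : ∀ L ∈ regularLocus S, ∃ N ∈ secantVariety (K := K) (segreCone K (W ⧸ L.space) L.space) c,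
      N.space = conormalSpace S L) (hx : chart b x ∈ S)
    {g : Fin c → MvPolynomial (Fin d × Fin m) K} (hg : ∀ i, g i ∈ chartIdeal b S)
    (hli : LinearIndependent K fun i => gradient x (g i))
    {F : MvPolynomial (Fin c × (Fin d × Fin m)) K} (hF : VanishesOnSpans (rankOneSet K d m) F) :
    eval (fun q => gradient x (g q.1) q.2) F = 0 := by
  have h1 := span_gradient_eq b x hi hx (by rw [hht, Fintype.card_fin]) hg hli
  have h2 : Module.finrank K (gradientSpace b x S) = c := by
    rw [← h1, finrank_span_eq_card hli, Fintype.card_fin]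
  have h3 : chart b x ∈ regularLocus S :=
    (mem_regularLocus_chart b x hW hc hi hx).2 (by rw [h2, hht])
  exact (exists_mem_secantVariety_iff b x hx h2).1 (hS _ h3) F hF g hg

/-- The components of generically transverse intersections of coisotropic varieties are
coisotropic. -/
theorem isCoisotropic_of_isIrreducibleComponent_inter (hW : Module.finrank K W = d + m)
    {S₁ S₂ Z : Set (Grassmannian K W d)} (h₁ : IsCoisotropic S₁) (h₂ : IsCoisotropic S₂)
    (hZ : IsIrreducibleComponent Z (S₁ ∩ S₂)) (ht : ∃ L ∈ Z, TransverseAt S₁ S₂ L) :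
    IsCoisotropic Z := by
  obtain ⟨hc₁, hi₁, c₁, hpos, hcod₁, hS₁⟩ := h₁
  obtain ⟨hc₂, hi₂, c₂, -, hcod₂, hS₂⟩ := h₂
  obtain ⟨L₀, hL₀, ht⟩ := ht
  have hZc : IsClosed Z := hZ.isClosed (hc₁.inter hc₂)
  have hZi : IsIrreducible Z := hZ.1.1
  have hZ₁ : Z ⊆ S₁ := hZ.1.2.trans Set.inter_subset_left
  have hZ₂ : Z ⊆ S₂ := hZ.1.2.trans Set.inter_subset_right
  have key : ∀ L ∈ Z, ∃ (b : Module.Basis (Fin d ⊕ Fin m) K W) (x : Fin d × Fin m → K),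
      chart b x = L ∧ (chartIdeal b Z).height = (c₁ + c₂ : ℕ) ∧
      ∀ F : MvPolynomial (Fin (c₁ + c₂) × (Fin d × Fin m)) K,
        VanishesOnSpans (rankOneSet K d m) F →
        ∀ p : Fin (c₁ + c₂) → MvPolynomial (Fin d × Fin m) K, (∀ i, p i ∈ chartIdeal b Z) →
          eval (fun q => gradient x (p q.1) q.2) F = 0 := by
    intro L hL
    -- One chart containing both the given point and the transversal point lets information spread
    -- from the latter to the former.
    obtain ⟨b, x, x₀, rfl, rfl⟩ := exists_basis_chart_pair hW L L₀
    have hne : (chart b ⁻¹' Z).Nonempty := ⟨x₀, hL₀⟩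
    have hP := isPrime_chartIdeal b hZi hne
    have hP₁ := isPrime_chartIdeal b hi₁ (hne.mono (Set.preimage_mono hZ₁))
    have hP₂ := isPrime_chartIdeal b hi₂ (hne.mono (Set.preimage_mono hZ₂))
    have hht₁ := (hasCodim_iff_height_chartIdeal b hW hc₁ hi₁ ⟨x₀, hZ₁ hL₀⟩ c₁).1 hcod₁
    have hht₂ := (hasCodim_iff_height_chartIdeal b hW hc₂ hi₂ ⟨x₀, hZ₂ hL₀⟩ c₂).1 hcod₂
    have hf₁ := (mem_regularLocus_chart b x₀ hW hc₁ hi₁ (hZ₁ hL₀)).1 ht.1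
    have hf₂ := (mem_regularLocus_chart b x₀ hW hc₂ hi₂ (hZ₂ hL₀)).1 ht.2.1
    rw [hht₁] at hf₁
    rw [hht₂] at hf₂
    obtain ⟨g₁, hg₁, hli₁, hsp₁⟩ :=
      exists_linearIndependent_gradient b x₀ (S := S₁) (by exact_mod_cast hf₁)
    obtain ⟨g₂, hg₂, hli₂, hsp₂⟩ :=
      exists_linearIndependent_gradient b x₀ (S := S₂) (by exact_mod_cast hf₂)
    have hli : LinearIndependent K
        (Sum.elim (fun i => gradient x₀ (g₁ i)) fun i => gradient x₀ (g₂ i)) :=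
      hli₁.sum_type hli₂ (by rw [hsp₁, hsp₂]; exact disjoint_gradientSpace b x₀ ht)
    have hht : (chartIdeal b Z).height = (c₁ + c₂ : ℕ) := by
      have := height_eq_add_of_mem_minimalPrimes_sup
        (chartIdeal_mem_minimalPrimes b x₀ hc₁ hc₂ hZ hL₀)
        ((mem_zeroLocus_chartIdeal b hZc x₀).2 hL₀) g₁ hg₁ (by rw [hht₁, Fintype.card_fin])
        g₂ hg₂ (by rw [hht₂, Fintype.card_fin]) hli
      rwa [Fintype.card_fin, Fintype.card_fin] at this
    refine ⟨b, x, rfl, hht, fun F hF p hp => ?_⟩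
    have hli' : LinearIndependent K fun k => gradient x₀ (Sum.elim g₁ g₂ k) := by
      convert hli using 1
      ext1 (i | i) <;> rfl
    obtain ⟨δ, hδ₀, hδ⟩ := exists_linearIndependent_gradient_nhds hli'
    -- Where δ ≠ 0 the joint gradients stay independent. They span the conormal space of Z, and the
    -- two subfamilies show that y is regular on S₁ and on S₂, so coisotropy applies to each.
    have hgen : ∀ y, chart b y ∈ Z → eval y δ ≠ 0 →
        eval (fun q => gradient y (p q.1) q.2) F = 0 := by
      intro y hy hδy
      have hly := hδ y hδy
      have hgZ : ∀ k, Sum.elim g₁ g₂ k ∈ chartIdeal b Z := by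
        rintro (i | i)
        · exact chartIdeal_anti b hZ₁ (hg₁ i)
        · exact chartIdeal_anti b hZ₂ (hg₂ i)
      have hsp := span_gradient_eq b y hZi hy (by simpa using hht) hgZ hly
      have h1 : ∀ j, ∃ h : Fin c₁ ⊕ Fin c₂ → K,
          ∑ l, h l • gradient y (Sum.elim g₁ g₂ l) = gradient y (p j) := by
        intro j
        refine (Submodule.mem_span_range_iff_exists_fun K).1 ?_
        rw [hsp]
        exact ⟨p j, hp j, rfl⟩
      choose h hh using h1
      have h2 := eval_sum_eq_zero_of_vanishesOnSpans
        (v₁ := fun i => gradient y (g₁ i)) (v₂ := fun i => gradient y (g₂ i))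
        (fun F hF => eval_gradient_eq_zero_of_linearIndependent b y hW hc₁ hi₁ hht₁ hS₁ (hZ₁ hy)
          hg₁ (hly.comp Sum.inl Sum.inl_injective) hF)
        (fun F hF => eval_gradient_eq_zero_of_linearIndependent b y hW hc₂ hi₂ hht₂ hS₂ (hZ₂ hy)
          hg₂ (hly.comp Sum.inr Sum.inr_injective) hF)
        (hF.aeval_linear finSumFinEquiv.symm h)
      rw [eval_aeval_linear] at h2
      rw [← h2]
      congr 2
      ext q
      rw [← hh]
      simp
    -- The equation F on the gradients as a function of the point. Since δG vanishes on Z and δ(x₀)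
    -- ≠ 0, primality puts G in the ideal of Z, which covers x as well.
    let G : MvPolynomial (Fin d × Fin m) K := aeval (fun q => pderiv q.2 (p q.1)) F
    have hG : ∀ y, eval y G = eval (fun q => gradient y (p q.1) q.2) F := fun y => eval_aeval _ _ _
    have hδG : δ * G ∈ chartIdeal b Z := by
      rw [mem_chartIdeal]
      intro y hy
      rw [map_mul]
      by_cases hδy : eval y δ = 0
      · rw [hδy, zero_mul]
      · rw [hG, hgen y hy hδy, mul_zero]
    have hGZ : G ∈ chartIdeal b Z :=
      (hP.mem_or_mem hδG).resolve_left fun h => hδ₀ ((mem_chartIdeal b).1 h x₀ hL₀)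
    rw [← hG]
    exact (mem_chartIdeal b).1 hGZ x hL
  refine ⟨hZc, hZi, c₁ + c₂, by omega, ?_, fun L hL => ?_⟩
  · obtain ⟨b, x, rfl, hht, -⟩ := key L₀ hL₀
    exact (hasCodim_iff_height_chartIdeal b hW hZc hZi ⟨x, hL₀⟩ _).2 hht
  · obtain ⟨b, x, rfl, hht, hF⟩ := key L hL.1
    have hfin := (mem_regularLocus_chart b x hW hZc hZi hL.1).1 hL
    rw [hht] at hfin
    exact (exists_mem_secantVariety_iff b x hL.1 (by exact_mod_cast hfin)).2 hF

end Intersection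

end Grassmannian

end

theorem proposition1p4 (K : Type*) [Field K] [IsAlgClosed K] [CharZero K] (n ℓ : ℕ) (hℓ : ℓ < n) :
    (∀ S : Set (Grassmannian K (Fin (n + 1) → K) (ℓ + 1)),
      IsClosed S → IsIrreducible S → topologicalKrullDim S ≤ ((n - 1 : ℕ) : WithBot ℕ∞) →
        Grassmannian.IsCoisotropic S) ∧
    (∀ S₁ S₂ : Set (Grassmannian K (Fin (n + 1) → K) (ℓ + 1)),
      Grassmannian.IsCoisotropic S₁ → Grassmannian.IsCoisotropic S₂ →
        Grassmannian.GenericallyTransverse S₁ S₂ →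
        ∀ Z, Grassmannian.IsIrreducibleComponent Z (S₁ ∩ S₂) →
          Grassmannian.IsCoisotropic Z) := by
  -- With this m the matrices have size (ℓ + 1) × (m + 1), and the bound n - 1 is ℓ + m, the
  -- dimension of the Segre variety.
  obtain ⟨m, rfl⟩ : ∃ m, n = ℓ + m + 1 := ⟨n - ℓ - 1, by omega⟩
  have hW : Module.finrank K (Fin (ℓ + m + 1 + 1) → K) = (ℓ + 1) + (m + 1) := by
    rw [Module.finrank_fintype_fun_eq_card, Fintype.card_fin]
    omega
  exact ⟨fun S hc hi hdim => Grassmannian.isCoisotropic_of_topologicalKrullDim_le hW hc hi hdim,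
    fun S₁ S₂ h₁ h₂ ht Z hZ =>
      Grassmannian.isCoisotropic_of_isIrreducibleComponent_inter hW h₁ h₂ hZ (ht Z hZ)⟩
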